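/- Let $g\ge 1$. Let $\Gamma_g=\mathrm{Sp}(g,\mathbb Z)$, let $\Gamma_g[4]$ be the kernel of reduction mod $4$, and let $\Gamma_g[4,8]$ be the group of all $M=\begin{pmatrix}A&B\\ C&D\end{pmatrix}\in\Gamma_g[4]$ such that the diagonals of $AB'$ and $CD'$ are $\equiv 0 \bmod 8$ (where $'$ denotes the transpose). Let $\mathcal H_g$ be the Siegel upper half space of genus $g$, with $M\tau=(A\tau+B)(C\tau+D)^{-1}$. Let $S$ be a positive definite $4\times 4$ matrix such that $S$ and $16S^{-1}$ are integral. An integral $4\times g$ matrix $V$ is called isotropic for $(S,4)$ if $V'S^{-1}V$ and $4S^{-1}V$ are integral; for such $V$ put $$\vartheta_{S,V}(\tau)=\sum_{G\in\mathbb Z^{4\times g}}\exp\Bigl(\tfrac{\pi i}{4}\,\mathrm{tr}\bigl(G'SG\,\tau+2G'V\bigr)\Bigr),\qquad \tau\in\mathcal H_g.$$ Then there is exactly one character $\varepsilon_S:\Gamma_g[4,8]\to S^1=\{\zeta\in\mathbb C:|\zeta|=1\}$ (the multiplier system attached to $S$) such that $$\vartheta_{S,V}(M\tau)=\varepsilon_S(M)\,\det(C\tau+D)^2\,\vartheta_{S,V}(\tau)$$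 for all isotropic $V$, all $M\in\Gamma_g[4,8]$ and all $\tau\in\mathcal H_g$. The character $\varepsilon_S$ is trivial if and only if $\det S$ is the square of an integer. -/

import Mathlib

open Matrix

/-- The principal congruence subgroup `Γ_g[q]`: the kernel of the reduction of `Sp(g, ℤ)` mod `q`. -/
def principalCongruenceGroup (g q : ℕ) : Subgroup (symplecticGroup (Fin g) ℤ) :=
  MonoidHom.ker
    (((Int.castRingHom (ZMod q)).mapMatrix :
        Matrix (Fin g ⊕ Fin g) (Fin g ⊕ Fin g) ℤ →+* Matrix (Fin g ⊕ Fin g) (Fin g ⊕ Fin g) (ZMod q)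
      ).toMonoidHom.comp (symplecticGroup (Fin g) ℤ).subtype)

section Blocks

variable {g : ℕ}

/-- The block `A` of `M = (A B; C D)`. -/
def blockA (M : symplecticGroup (Fin g) ℤ) : Matrix (Fin g) (Fin g) ℤ := M.1.toBlocks₁₁

/-- The block `B` of `M = (A B; C D)`. -/
def blockB (M : symplecticGroup (Fin g) ℤ) : Matrix (Fin g) (Fin g) ℤ := M.1.toBlocks₁₂

/-- The block `C` of `M = (A B; C D)`. -/
def blockC (M : symplecticGroup (Fin g) ℤ) : Matrix (Fin g) (Fin g) ℤ := M.1.toBlocks₂₁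

/-- The block `D` of `M = (A B; C D)`. -/
def blockD (M : symplecticGroup (Fin g) ℤ) : Matrix (Fin g) (Fin g) ℤ := M.1.toBlocks₂₂

theorem fromBlocks_blocks (M : symplecticGroup (Fin g) ℤ) :
    fromBlocks (blockA M) (blockB M) (blockC M) (blockD M) = M.1 :=
  fromBlocks_toBlocks _

theorem blocks_mul (M N : symplecticGroup (Fin g) ℤ) :
    blockA (M * N) = blockA M * blockA N + blockB M * blockC N ∧
    blockB (M * N) = blockA M * blockB N + blockB M * blockD N ∧
    blockC (M * N) = blockC M * blockA N + blockD M * blockC N ∧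
    blockD (M * N) = blockC M * blockB N + blockD M * blockD N := by
  have h : (M * N).1 = M.1 * N.1 := rfl
  rw [← fromBlocks_blocks M, ← fromBlocks_blocks N, fromBlocks_multiply] at h
  simp only [blockA, blockB, blockC, blockD] at h ⊢
  rw [h]
  simp

theorem blocks_inv (M : symplecticGroup (Fin g) ℤ) :
    blockA M⁻¹ = (blockD M)ᵀ ∧ blockB M⁻¹ = -(blockB M)ᵀ ∧
    blockC M⁻¹ = -(blockC M)ᵀ ∧ blockD M⁻¹ = (blockA M)ᵀ := by
  have h := SymplecticGroup.coe_inv M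
  rw [← fromBlocks_blocks M] at h
  simp only [J, fromBlocks_transpose, fromBlocks_neg, fromBlocks_multiply] at h
  simp only [blockA, blockB, blockC, blockD] at h ⊢
  rw [h]
  simp

theorem blocks_rel (M : symplecticGroup (Fin g) ℤ) :
    (blockA M)ᵀ * blockC M = (blockC M)ᵀ * blockA M ∧
    (blockB M)ᵀ * blockD M = (blockD M)ᵀ * blockB M ∧
    (blockA M)ᵀ * blockD M - (blockC M)ᵀ * blockB M = 1 := by
  have h := M.2
  rw [← fromBlocks_blocks M, SymplecticGroup.fromBlocks_mem_iff] at h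
  exact h

theorem blocks_rel' (M : symplecticGroup (Fin g) ℤ) :
    blockA M * (blockB M)ᵀ = blockB M * (blockA M)ᵀ ∧
    blockC M * (blockD M)ᵀ = blockD M * (blockC M)ᵀ ∧
    blockA M * (blockD M)ᵀ - blockB M * (blockC M)ᵀ = 1 := by
  have h := blocks_rel M⁻¹
  obtain ⟨h1, h2, h3, h4⟩ := blocks_inv M
  rw [h1, h2, h3, h4] at h
  obtain ⟨r1, r2, r3⟩ := h
  simp only [transpose_neg, transpose_transpose, Matrix.mul_neg, Matrix.neg_mul, neg_inj] at r1 r2 r3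
  refine ⟨r2.symm, r1.symm, ?_⟩
  have := congrArg transpose r3
  simp only [transpose_sub, transpose_mul, transpose_transpose, transpose_one,
    neg_neg] at this
  rw [← this]

theorem principal_blocks {q : ℕ} {M : symplecticGroup (Fin g) ℤ}
    (hM : M ∈ principalCongruenceGroup g q) (i j : Fin g) :
    (q : ℤ) ∣ blockB M i j ∧ (q : ℤ) ∣ blockC M i j := by
  have h : M.1.map (Int.castRingHom (ZMod q)) = 1 := hM
  have h1 := congrFun (congrFun h (Sum.inl i)) (Sum.inr j)
  have h2 := congrFun (congrFun h (Sum.inr i)) (Sum.inl j)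
  simp only [map_apply, Int.coe_castRingHom, one_apply, reduceCtorEq, if_false] at h1 h2
  exact ⟨(ZMod.intCast_zmod_eq_zero_iff_dvd _ _).1 h1, (ZMod.intCast_zmod_eq_zero_iff_dvd _ _).1 h2⟩

/-- The diagonal of an integral matrix is divisible by `n`. -/
def DiagDvd (n : ℕ) (P : Matrix (Fin g) (Fin g) ℤ) : Prop := ∀ i, (n : ℤ) ∣ P i i

theorem DiagDvd.add {n : ℕ} {P Q : Matrix (Fin g) (Fin g) ℤ} (hP : DiagDvd n P)
    (hQ : DiagDvd n Q) : DiagDvd n (P + Q) := fun i => dvd_add (hP i) (hQ i)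

theorem DiagDvd.sub {n : ℕ} {P Q : Matrix (Fin g) (Fin g) ℤ} (hP : DiagDvd n P)
    (hQ : DiagDvd n Q) : DiagDvd n (P - Q) := fun i => dvd_sub (hP i) (hQ i)

theorem DiagDvd.add_transpose {q : ℕ} {P : Matrix (Fin g) (Fin g) ℤ}
    (hP : ∀ i j, (q : ℤ) ∣ P i j) : DiagDvd (2 * q) (P + Pᵀ) := by
  intro i
  obtain ⟨c, hc⟩ := hP i i
  exact ⟨c, by simp only [Matrix.add_apply, transpose_apply, hc]; push_cast; ring⟩

theorem DiagDvd.conj {q : ℕ} {P : Matrix (Fin g) (Fin g) ℤ} (hP : DiagDvd (2 * q) P)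
    (hs : Pᵀ = P) (hq : ∀ i j, (q : ℤ) ∣ P i j) (X : Matrix (Fin g) (Fin g) ℤ) :
    DiagDvd (2 * q) (X * P * Xᵀ) := by
  intro i
  rw [← ZMod.intCast_zmod_eq_zero_iff_dvd]
  have e : (X * P * Xᵀ) i i = ∑ p : Fin g × Fin g, X i p.1 * P p.1 p.2 * X i p.2 := by
    rw [mul_apply, Fintype.sum_prod_type_right]
    simp only [mul_apply, transpose_apply, Finset.sum_mul]
  rw [e, Int.cast_sum]
  refine Finset.sum_involution (fun p _ => (p.2, p.1)) ?_ ?_ (by simp) (by simp)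
  · rintro ⟨j, k⟩ -
    rw [← Int.cast_add, ZMod.intCast_zmod_eq_zero_iff_dvd]
    have hjk : P k j = P j k := congrFun (congrFun hs j) k
    obtain ⟨c, hc⟩ := hq j k
    exact ⟨X i j * X i k * c, by simp only [hjk, hc]; push_cast; ring⟩
  · rintro ⟨j, k⟩ - hne heq
    apply hne
    obtain rfl : k = j := (Prod.ext_iff.1 heq).1
    rw [ZMod.intCast_zmod_eq_zero_iff_dvd]
    exact Dvd.dvd.mul_right (Dvd.dvd.mul_left (hP k) _) _

theorem dvd_mul_left_entries {q : ℕ} {Q : Matrix (Fin g) (Fin g) ℤ}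
    (hQ : ∀ i j, (q : ℤ) ∣ Q i j) (P : Matrix (Fin g) (Fin g) ℤ) (i j : Fin g) :
    (q : ℤ) ∣ (P * Q) i j := by
  rw [mul_apply]
  exact Finset.dvd_sum fun k _ => Dvd.dvd.mul_left (hQ k j) _

theorem dvd_mul_right_entries {q : ℕ} {P : Matrix (Fin g) (Fin g) ℤ}
    (hP : ∀ i j, (q : ℤ) ∣ P i j) (Q : Matrix (Fin g) (Fin g) ℤ) (i j : Fin g) :
    (q : ℤ) ∣ (P * Q) i j := by
  rw [mul_apply]
  exact Finset.dvd_sum fun k _ => Dvd.dvd.mul_right (hP i k) _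

end Blocks

/-- Igusa's congruence group
`Γ_g[q,2q] = {M ∈ Γ_g[q] ; (A Bᵀ)₀ ≡ (C Dᵀ)₀ ≡ 0 mod 2q}`, where `P₀` is the diagonal of `P`. -/
def igusaGroup (g q : ℕ) : Subgroup (symplecticGroup (Fin g) ℤ) where
  carrier := {M | M ∈ principalCongruenceGroup g q ∧
    DiagDvd (2 * q) (blockA M * (blockB M)ᵀ) ∧ DiagDvd (2 * q) (blockC M * (blockD M)ᵀ)}
  one_mem' := by
    have hB : blockB (1 : symplecticGroup (Fin g) ℤ) = 0 := by ext i j; simp [blockB, toBlocks₁₂]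
    have hC : blockC (1 : symplecticGroup (Fin g) ℤ) = 0 := by ext i j; simp [blockC, toBlocks₂₁]
    refine ⟨one_mem _, fun i => ?_, fun i => ?_⟩
    · rw [hB]; simp
    · rw [hC]; simp
  mul_mem' := by
    rintro M N ⟨hM, hM1, hM2⟩ ⟨hN, hN1, hN2⟩
    obtain ⟨eA, eB, eC, eD⟩ := blocks_mul M N
    obtain ⟨n1, n2, n3⟩ := blocks_rel' N
    have n3' : blockA N * (blockD N)ᵀ = 1 + blockB N * (blockC N)ᵀ := by rw [← n3]; abel
    have s1 : (blockA N * (blockB N)ᵀ)ᵀ = blockA N * (blockB N)ᵀ := by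
      rw [transpose_mul, transpose_transpose, n1]
    have s2 : (blockC N * (blockD N)ᵀ)ᵀ = blockC N * (blockD N)ᵀ := by
      rw [transpose_mul, transpose_transpose, n2]
    have q1 : ∀ i j, (q : ℤ) ∣ (blockA N * (blockB N)ᵀ) i j :=
      dvd_mul_left_entries (fun i j => (principal_blocks hN j i).1) _
    have q2 : ∀ i j, (q : ℤ) ∣ (blockC N * (blockD N)ᵀ) i j :=
      dvd_mul_right_entries (fun i j => (principal_blocks hN i j).2) _
    have key : ∀ X Y : Matrix (Fin g) (Fin g) ℤ, DiagDvd (2 * q) (X * Yᵀ) →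
        DiagDvd (2 * q) ((X * blockA N + Y * blockC N) * (X * blockB N + Y * blockD N)ᵀ) := by
      intro X Y hXY
      have e : (X * blockA N + Y * blockC N) * (X * blockB N + Y * blockD N)ᵀ =
          X * (blockA N * (blockB N)ᵀ) * Xᵀ + Y * (blockC N * (blockD N)ᵀ) * Yᵀ + X * Yᵀ +
          (Y * (blockC N * (blockB N)ᵀ) * Xᵀ + (Y * (blockC N * (blockB N)ᵀ) * Xᵀ)ᵀ) := by
        have e1 : X * blockA N * ((blockD N)ᵀ * Yᵀ) =
            X * Yᵀ + X * (blockB N * (blockC N)ᵀ) * Yᵀ := by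
          rw [Matrix.mul_assoc, ← Matrix.mul_assoc (blockA N), n3']
          noncomm_ring
        simp only [transpose_add, transpose_mul, transpose_transpose, Matrix.add_mul,
          Matrix.mul_add, e1]
        simp only [Matrix.mul_assoc]
        abel
      rw [e]
      refine (((hN1.conj s1 q1 X).add (hN2.conj s2 q2 Y)).add hXY).add (DiagDvd.add_transpose ?_)
      exact dvd_mul_right_entries (dvd_mul_left_entries
        (dvd_mul_right_entries (fun i j => (principal_blocks hN i j).2) _) _) _
    refine ⟨mul_mem hM hN, ?_, ?_⟩
    · rw [eA, eB]; exact key _ _ hM1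
    · rw [eC, eD]; exact key _ _ hM2
  inv_mem' := by
    rintro M ⟨hM, hM1, hM2⟩
    obtain ⟨eA, eB, eC, eD⟩ := blocks_inv M
    obtain ⟨r1, r2, r3⟩ := blocks_rel M
    obtain ⟨n1, n2, n3⟩ := blocks_rel' M
    have s1 : (blockA M * (blockB M)ᵀ)ᵀ = blockA M * (blockB M)ᵀ := by
      rw [transpose_mul, transpose_transpose, n1]
    have s2 : (blockC M * (blockD M)ᵀ)ᵀ = blockC M * (blockD M)ᵀ := by
      rw [transpose_mul, transpose_transpose, n2]
    have q1 : ∀ i j, (q : ℤ) ∣ (blockA M * (blockB M)ᵀ) i j :=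
      dvd_mul_left_entries (fun i j => (principal_blocks hM j i).1) _
    have q2 : ∀ i j, (q : ℤ) ∣ (blockC M * (blockD M)ᵀ) i j :=
      dvd_mul_right_entries (fun i j => (principal_blocks hM i j).2) _
    have k1 : (blockD M)ᵀ * (-(blockB M)ᵀ)ᵀ =
        (blockB M)ᵀ * (blockC M * (blockD M)ᵀ) * ((blockB M)ᵀ)ᵀ -
        (blockD M)ᵀ * (blockA M * (blockB M)ᵀ) * ((blockD M)ᵀ)ᵀ := by
      rw [n1, transpose_neg, transpose_transpose, transpose_transpose]
      calc (blockD M)ᵀ * -blockB M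
          = -((blockD M)ᵀ * blockB M * ((blockA M)ᵀ * blockD M - (blockC M)ᵀ * blockB M)) := by
            rw [r3]; simp
        _ = (blockD M)ᵀ * blockB M * (blockC M)ᵀ * blockB M -
            (blockD M)ᵀ * (blockB M * (blockA M)ᵀ) * blockD M := by noncomm_ring
        _ = _ := by rw [← r2, n2]; noncomm_ring
    have k2 : (-(blockC M)ᵀ) * ((blockA M)ᵀ)ᵀ =
        (blockC M)ᵀ * (blockA M * (blockB M)ᵀ) * ((blockC M)ᵀ)ᵀ -
        (blockA M)ᵀ * (blockC M * (blockD M)ᵀ) * ((blockA M)ᵀ)ᵀ := by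
      have r3' : (blockD M)ᵀ * blockA M - (blockB M)ᵀ * blockC M = 1 := by
        have := congrArg transpose r3
        simpa only [transpose_sub, transpose_mul, transpose_transpose, transpose_one] using this
      rw [transpose_transpose, transpose_transpose]
      calc (-(blockC M)ᵀ) * blockA M
          = -((blockC M)ᵀ * blockA M * ((blockD M)ᵀ * blockA M - (blockB M)ᵀ * blockC M)) := by
            rw [r3']; simp
        _ = (blockC M)ᵀ * (blockA M * (blockB M)ᵀ) * blockC M -
            (blockC M)ᵀ * blockA M * (blockD M)ᵀ * blockA M := by noncomm_ring
        _ = _ := by rw [← r1]; noncomm_ring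
    refine ⟨inv_mem hM, ?_, ?_⟩
    · rw [eA, eB, k1]
      exact (hM2.conj s2 q2 _).sub (hM1.conj s1 q1 _)
    · rw [eC, eD, k2]
      exact (hM1.conj s1 q1 _).sub (hM2.conj s2 q2 _)

/-- The Siegel upper half space of genus `g`. -/
def siegelHalfSpace (g : ℕ) : Set (Matrix (Fin g) (Fin g) ℂ) :=
  {τ | τᵀ = τ ∧ (τ.map Complex.im).PosDef}

section Modular

variable {g r : ℕ}

/-- `C τ + D` for `M = (A B; C D)`. -/
noncomputable def siegelDenom (M : symplecticGroup (Fin g) ℤ) (τ : Matrix (Fin g) (Fin g) ℂ) :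
    Matrix (Fin g) (Fin g) ℂ :=
  (blockC M).map (Int.cast : ℤ → ℂ) * τ + (blockD M).map (Int.cast : ℤ → ℂ)

/-- `M τ = (A τ + B) (C τ + D)⁻¹` for `M = (A B; C D)`. -/
noncomputable def siegelAct (M : symplecticGroup (Fin g) ℤ) (τ : Matrix (Fin g) (Fin g) ℂ) :
    Matrix (Fin g) (Fin g) ℂ :=
  ((blockA M).map (Int.cast : ℤ → ℂ) * τ + (blockB M).map (Int.cast : ℤ → ℂ)) *
    (siegelDenom M τ)⁻¹

/-- A real matrix is integral if all its entries are integers. -/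
def IsIntegralMatrix {m n : Type*} (P : Matrix m n ℝ) : Prop :=
  ∃ Q : Matrix m n ℤ, P = Q.map (Int.cast : ℤ → ℝ)

/-- The integral `r × g` matrix `V` is isotropic for `(S, q)`: the matrices
`S⁻¹[V] = Vᵀ S⁻¹ V` and `q S⁻¹ V` are integral. -/
def IsIsotropic (q : ℕ) (S : Matrix (Fin r) (Fin r) ℤ) (V : Matrix (Fin r) (Fin g) ℤ) : Prop :=
  IsIntegralMatrix ((V.map (Int.cast : ℤ → ℝ))ᵀ * (S.map (Int.cast : ℤ → ℝ))⁻¹ *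
    V.map (Int.cast : ℤ → ℝ)) ∧
  IsIntegralMatrix ((q : ℝ) • ((S.map (Int.cast : ℤ → ℝ))⁻¹ * V.map (Int.cast : ℤ → ℝ)))

/-- The theta series
`ϑ_{S,V}(τ) = ∑_G exp((π i / q) tr(S[G] τ + 2 Gᵀ V))`, where `G` runs over all integral
`r × g` matrices and `S[G] = Gᵀ S G`. -/
noncomputable def thetaSeries (q : ℕ) (S : Matrix (Fin r) (Fin r) ℤ) (V : Matrix (Fin r) (Fin g) ℤ)
    (τ : Matrix (Fin g) (Fin g) ℂ) : ℂ :=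
  ∑' G : Matrix (Fin r) (Fin g) ℤ,
    Complex.exp ((Real.pi : ℂ) * Complex.I / (q : ℂ) *
      trace ((Gᵀ * S * G).map (Int.cast : ℤ → ℂ) * τ +
        (2 : ℂ) • (Gᵀ * V).map (Int.cast : ℤ → ℂ)))

/-- For a `4 × 4` matrix `S` (so that the weight `4 / 2 = 2` is integral and a multiplier system is
a character), `ε` is the multiplier system of the theta series attached to `(S, q)`: all `ϑ_{S,V}`
with isotropic `V` satisfy `ϑ_{S,V}(M τ) = ε(M) det(C τ + D)² ϑ_{S,V}(τ)` for `M ∈ Γ_g[q,2q]`. -/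
def IsThetaMultiplier (q : ℕ) (S : Matrix (Fin 4) (Fin 4) ℤ) (ε : igusaGroup g q →* Circle) :
    Prop :=
  ∀ V : Matrix (Fin 4) (Fin g) ℤ, IsIsotropic q S V →
    ∀ M : igusaGroup g q, ∀ τ ∈ siegelHalfSpace g,
      thetaSeries q S V (siegelAct M.1 τ) =
        (ε M : ℂ) * (siegelDenom M.1 τ).det ^ 2 * thetaSeries q S V τ

end Modular

/-!
The transformation law is read off from theta inversion, and the triviality question becomes one
about Gauss sums modulo the odd number `det D`.

For `M = (A B; C D)` in `Γ_g[4,8]` the matrix `D` is invertible over `ℚ`, since `det D` is odd, and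
`M τ = B D⁻¹ + D⁻ᵀ (τ⁻¹ + D⁻¹ C)⁻¹ D⁻¹`. Splitting the summation in `ϑ_{S,V}(M τ)` over the residue
classes of `ℤ^{4×g}` modulo `ℤ^{4×g} Dᵀ` and applying theta inversion (`theta_inversion`, that is
Poisson summation for a Gaussian) on both sides of the translation `τ⁻¹ ↦ τ⁻¹ + D⁻¹ C` gives the
transformation law (`thetaSeries_siegelAct`) with the multiplier

  `ε(M) = det(D)⁻² ∑_G exp((πi/4) tr(S[G] B D⁻¹))`,  `G ∈ ℤ^{4×g} / ℤ^{4×g} Dᵀ`.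

Here the congruences that define `Γ_g[4,8]` make the phase periodic, and isotropy of `V` together
with integrality of `16 S⁻¹` lets one complete the square by an integral translation
(`sum_gaussPhase_mul`), so that `V` drops out. As `ϑ_{S,0}` does not vanish at `i`, the multiplier
is unique and multiplicative.

Put `N = |det D|`. Reduction modulo `N` turns this sum, up to a factor, into the Gauss sum
`∑_G ψ(tr(S[G] F))` over `4 × g` matrices modulo `N`, with `ψ` the standard character of `ℤ/N` and
`F = N B D⁻¹ / 8` (`IsScaledQuotient.matGauss_eq_gaussSum4`). It depends on `S` only up to
congruence over `ℤ/N`. Since `N` is odd and `det S` is a power of `2`, hence a unit modulo `N`, `S`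
is congruent to `diag(1, 1, 1, det S)` (`hasDiagNormalForm_zmod`). Applied to `diag(1, -1, 1, -1)`,
which is thus congruent to the unit matrix, this evaluates the Gauss sum of the unit matrix, because
`∑_z ψ(F[z])` times `∑_z ψ(-F[z])` only counts the kernel of `F`; no sign has to be determined.
Hence `ε(M) = 1` if `det S` is a square (`gaussSum4_of_isSquare`). Applied to `diag(1, 1, d, d)` the
normal form gives `ε(M)² = 1` in general (`gaussSum4_sq`), so `ε` takes values in the unit circle.

If `det S` is not a square, it is an odd power of `2`. Then an element of `Γ_g[4,8]` with
`det D = 5` has multiplier `-1` (`gaussSum4_diagElement`), because `2` is not a square modulo `5`.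
-/

/-! ### Poisson summation on `ℤ^ι` -/

theorem summable_prod_of_summable {ι : Type*} [Fintype ι] {f : ι → ℤ → ℝ}
    (h0 : ∀ i n, 0 ≤ f i n) (hs : ∀ i, Summable (f i)) :
    Summable fun n : ι → ℤ => ∏ i, f i (n i) := by
  classical
  refine summable_of_sum_le (c := ∏ i, ∑' n, f i n)
    (fun n => Finset.prod_nonneg fun i _ => h0 i _) fun s => ?_
  have hsub : s ⊆ Fintype.piFinset fun i => s.image fun n => n i := fun n hn =>
    Fintype.mem_piFinset.2 fun i => Finset.mem_image_of_mem _ hn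
  calc ∑ n ∈ s, ∏ i, f i (n i)
      ≤ ∑ n ∈ Fintype.piFinset fun i => s.image fun n => n i, ∏ i, f i (n i) :=
        Finset.sum_le_sum_of_subset_of_nonneg hsub fun n _ _ =>
          Finset.prod_nonneg fun i _ => h0 i _
    _ = ∏ i, ∑ n ∈ s.image fun n => n i, f i n := (Finset.prod_univ_sum _ _).symm
    _ ≤ ∏ i, ∑' n, f i n := Finset.prod_le_prod
        (fun i _ => Finset.sum_nonneg fun n _ => h0 i n)
        fun i _ => (hs i).sum_le_tsum _ fun n _ => h0 i n

theorem summable_exp_neg_mul_sq {c : ℝ} (hc : 0 < c) :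
    Summable fun n : ℤ => Real.exp (-c * (n : ℝ) ^ 2) := by
  have h := ((summable_jacobiTheta₂_term_iff 0 (Complex.I * (c / Real.pi : ℝ))).2 (by
    rw [Complex.I_mul_im, Complex.ofReal_re]; positivity)).norm
  refine h.congr fun n => ?_
  have hp : (Real.pi : ℂ) ≠ 0 := by exact_mod_cast Real.pi_ne_zero
  have : (2 * Real.pi * Complex.I * n * 0 : ℂ) +
      Real.pi * Complex.I * (n : ℂ) ^ 2 * (Complex.I * (c / Real.pi : ℝ)) =
      ((-c * (n : ℝ) ^ 2 : ℝ) : ℂ) := by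
    push_cast
    field_simp
    linear_combination (n : ℂ) ^ 2 * c * Complex.I_sq
  rw [jacobiTheta₂_term, this, Complex.norm_exp, Complex.ofReal_re]

/-- A vector with integral coordinates, seen in `ℝ^ι`. -/
def intVec {ι : Type*} (n : ι → ℤ) : ι → ℝ := fun i => (n i : ℝ)

/-- The Fourier transform on `ℝ^ι`, normalised by the character `exp(-2πi ξ·x)`. -/
noncomputable def piFourier {ι : Type*} [Fintype ι] (f : (ι → ℝ) → ℂ) (ξ : ι → ℝ) : ℂ :=
  ∫ x : ι → ℝ, Complex.exp (-(2 * Real.pi * Complex.I * ∑ i, (ξ i : ℂ) * x i)) * f x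

open MeasureTheory in
/-- An integral over `ℝ^ι` is the sum of the integrals over the translates of the half-open unit
cube. -/
theorem hasSum_integral_box {ι : Type*} [Fintype ι] {f : (ι → ℝ) → ℂ} (hf : Integrable f) :
    HasSum (fun n : ι → ℤ => ∫ x in {x : ι → ℝ | ∀ i, x i ∈ Set.Ioc (0 : ℝ) (0 + 1)},
      f (x + intVec n)) (∫ x, f x) := by
  set s : (ι → ℤ) → Set (ι → ℝ) := fun n => {x | ∀ i, x i - n i ∈ Set.Ioc (0 : ℝ) (0 + 1)} with hs
  have hmeas : ∀ n, MeasurableSet (s n) := fun n => by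
    have : s n = Set.pi Set.univ fun i => Set.Ioc (n i : ℝ) (n i + 1) := by
      ext x
      simp only [hs, Set.mem_ofPred_eq, Set.mem_Ioc, Set.mem_pi, Set.mem_univ, true_implies]
      refine forall_congr' fun i => ?_
      constructor <;> rintro ⟨h1, h2⟩ <;> constructor <;> linarith
    rw [this]
    exact MeasurableSet.univ_pi fun i => measurableSet_Ioc
  have hunion : ⋃ n, s n = Set.univ := by
    ext x
    simp only [Set.mem_iUnion, Set.mem_univ, iff_true]
    refine ⟨fun i => ⌈x i⌉ - 1, fun i => ?_⟩
    have h1 := Int.ceil_lt_add_one (x i)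
    have h2 := Int.le_ceil (x i)
    constructor <;> push_cast <;> linarith
  have hdisj : Pairwise (Function.onFun Disjoint s) := by
    intro m n hmn
    refine Set.disjoint_left.2 fun x hm hn => hmn (funext fun i => ?_)
    obtain ⟨h1, h2⟩ := hm i
    obtain ⟨h3, h4⟩ := hn i
    have a1 : (m i : ℝ) < n i + 1 := by linarith
    have a2 : (n i : ℝ) < m i + 1 := by linarith
    have a3 : m i < n i + 1 := by exact_mod_cast a1
    have a4 : n i < m i + 1 := by exact_mod_cast a2
    omega
  have h := hasSum_integral_iUnion (μ := volume) hmeas hdisj (f := f) (by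
    rw [hunion]; exact hf.integrableOn)
  rw [hunion, setIntegral_univ] at h
  convert! h using 1
  funext n
  have hp : MeasurePreserving (fun x : ι → ℝ => x + intVec n) volume volume :=
    measurePreserving_add_right volume (intVec n)
  rw [← hp.setIntegral_preimage_emb (MeasurableEquiv.addRight (intVec n)).measurableEmbedding f]
  congr 2
  ext x
  simp [hs, intVec]

open MeasureTheory TopologicalSpace UnitAddTorus in
/-- **Poisson summation** for a continuous integrable function on `ℝ^ι` whose translates are
locally uniformly summable and whose Fourier transform is summable over `ℤ^ι`. -/
theorem tsum_add_intVec_eq_tsum_piFourier {ι : Type*} [Fintype ι] (f : C(ι → ℝ, ℂ))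
    (hK : ∀ K : Compacts (ι → ℝ), Summable fun n : ι → ℤ =>
      ‖(f.comp (ContinuousMap.addRight (intVec n))).restrict K‖)
    (hI : Integrable f) (hs : Summable fun k : ι → ℤ => piFourier f (intVec k)) (x : ι → ℝ) :
    ∑' n : ι → ℤ, f (x + intVec n) = ∑' k : ι → ℤ,
      piFourier f (intVec k) * Complex.exp (2 * Real.pi * Complex.I * ∑ i, (k i : ℂ) * x i) := by
  let proj : (ι → ℝ) → UnitAddTorus ι := fun x i => (x i : UnitAddCircle)
  have hproj : IsOpenQuotientMap proj :=
    IsOpenQuotientMap.piMap fun _ => QuotientAddGroup.isOpenQuotientMap_mk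
  set F : C(ι → ℝ, ℂ) := ∑' n : ι → ℤ, f.comp (ContinuousMap.addRight (intVec n)) with hF
  have hsumm := ContinuousMap.summable_of_locally_summable_norm hK
  have hFx : ∀ x, F x = ∑' n : ι → ℤ, f (x + intVec n) := fun x => by
    rw [hF, ← ContinuousMap.tsum_apply hsumm]
    rfl
  -- the sum over all translates descends to the torus, where its Fourier series converges to it
  have hper : ∀ x y, proj x = proj y → F x = F y := by
    intro x y hxy
    have : ∀ i, ∃ n : ℤ, x i = y i + n := fun i => by
      have h := congrFun hxy i
      rw [eq_comm, ← sub_eq_zero, ← AddCircle.coe_sub, AddCircle.coe_eq_zero_iff] at h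
      obtain ⟨n, hn⟩ := h
      exact ⟨-n, by simp at hn; push_cast; linarith⟩
    choose n hn using this
    rw [hFx, hFx, ← (Equiv.addLeft n).tsum_eq fun m => f (y + intVec m)]
    refine tsum_congr fun m => congrArg f (funext fun i => ?_)
    simp only [Pi.add_apply, intVec, hn, Equiv.coe_addLeft, Int.cast_add]
    ring
  let Ft : C(UnitAddTorus ι, ℂ) :=
    ⟨fun t => F (Function.surjInv hproj.surjective t), by
      rw [hproj.isQuotientMap.continuous_iff]
      convert F.continuous using 1
      ext x
      exact hper _ _ (Function.surjInv_eq hproj.surjective _)⟩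
  have hFt : ∀ x, Ft (proj x) = F x := fun x => hper _ _ (Function.surjInv_eq hproj.surjective _)
  have hmF : ∀ (k : ι → ℤ) (x : ι → ℝ), mFourier k (proj x) =
      Complex.exp (2 * Real.pi * Complex.I * ∑ i, (k i : ℂ) * x i) := fun k x => by
    simp only [mFourier, ContinuousMap.coe_mk, proj, fourier_coe_apply, ← Complex.exp_sum,
      Finset.mul_sum]
    congr 1
    refine Finset.sum_congr rfl fun i _ => ?_
    push_cast
    ring
  have hcoeff : ∀ k, mFourierCoeff Ft k = piFourier f (intVec k) := by
    intro k
    rw [mFourierCoeff_eq_integral Ft k 0]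
    set e : (ι → ℝ) → ℂ := fun x =>
      Complex.exp (-(2 * Real.pi * Complex.I * ∑ i, (intVec k i : ℂ) * x i)) with he
    have he' : ∀ x, mFourier (-k) (proj x) = e x := fun x => by
      rw [hmF, he]
      simp [intVec]
    have hecont : Continuous e := by fun_prop
    have henorm : ∀ x, ‖e x‖ = 1 := fun x => by
      have : -(2 * Real.pi * Complex.I * ∑ i, (intVec k i : ℂ) * x i) =
          ((-(2 * Real.pi * ∑ i, intVec k i * x i) : ℝ) : ℂ) * Complex.I := by
        push_cast; ring
      rw [he]
      simp only [this]
      exact Complex.norm_exp_ofReal_mul_I _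
    have heper : ∀ (n : ι → ℤ) x, e (x + intVec n) = e x := fun n x => by
      rw [← he', ← he']
      congr 1
      ext i
      simp [proj, intVec]
    have hint : Integrable fun x => e x * f x :=
      hI.bdd_mul hecont.aestronglyMeasurable (c := 1)
        (Filter.Eventually.of_forall fun x => (henorm x).le)
    have hbox := hasSum_integral_box hint
    -- unfold the integral over `ℝ^ι` to the unit cube
    rw [piFourier, ← hbox.tsum_eq]
    set s : Set (ι → ℝ) := {x : ι → ℝ | ∀ i, x i ∈ Set.Ioc (0 : ℝ) (0 + 1)}
    have hsub : s ⊆ Set.Icc (0 : ι → ℝ) 1 := fun x hx =>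
      ⟨fun i => (hx i).1.le, fun i => by simpa using (hx i).2⟩
    have hsfin : volume s < ⊤ := (measure_mono hsub).trans_lt isCompact_Icc.measure_lt_top
    let K : Compacts (ι → ℝ) := ⟨Set.Icc 0 1, isCompact_Icc⟩
    have hbd : ∀ n, ∀ x ∈ s, ‖e (x + intVec n) * f (x + intVec n)‖ ≤
        ‖(f.comp (ContinuousMap.addRight (intVec n))).restrict K‖ := fun n x hx => by
      rw [norm_mul, henorm, one_mul]
      exact ((f.comp (ContinuousMap.addRight (intVec n))).restrict K).norm_coe_le_norm
        ⟨x, hsub hx⟩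
    have hsmeas : MeasurableSet s := by
      have : s = Set.pi Set.univ fun _ => Set.Ioc (0 : ℝ) (0 + 1) := by ext; simp [s]
      rw [this]
      exact MeasurableSet.univ_pi fun i => measurableSet_Ioc
    rw [hasSum_integral_of_summable_integral_norm (μ := volume.restrict s)
      (F := fun n x => e (x + intVec n) * f (x + intVec n)) ?_ ?_ |>.tsum_eq]
    · refine setIntegral_congr_fun hsmeas fun x _ => ?_
      change mFourier (-k) (proj x) • Ft (proj x) = _
      rw [he', hFt, hFx, smul_eq_mul, ← tsum_mul_left]
      refine tsum_congr fun n => ?_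
      change e x * f (x + intVec n) = e (x + intVec n) * f (x + intVec n)
      rw [heper]
    · intro n
      exact (hint.comp_add_right (intVec n)).integrableOn
    · refine Summable.of_nonneg_of_le (fun n => integral_nonneg fun x => norm_nonneg _)
        (fun n => ?_) ((hK K).mul_right (volume.real s))
      have := norm_setIntegral_le_of_norm_le_const (μ := volume) (s := s)
        (f := fun x => ‖e (x + intVec n) * f (x + intVec n)‖) hsfin
        (C := ‖(f.comp (ContinuousMap.addRight (intVec n))).restrict K‖)
        (fun x hx => by rw [norm_norm]; exact hbd n x hx)
      exact (Real.le_norm_self _).trans this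
  have := (hasSum_mFourier_series_apply_of_summable (f := Ft)
    (by simpa only [funext hcoeff] using hs) (proj x)).tsum_eq
  rw [hFt, hFx] at this
  rw [← this]
  refine tsum_congr fun k => ?_
  rw [hcoeff, hmF, smul_eq_mul]

/-! ### Gaussians on `ℝ^ι` with complex parameters -/

/-- The Gaussian `exp(πi ∑ zᵢ (L x)ᵢ²)`, where `L` is a real change of coordinates that diagonalises
the quadratic form and the `zᵢ` lie in the upper half plane. -/
noncomputable def gaussPi {ι : Type*} [Fintype ι] (L : Matrix ι ι ℝ) (z : ι → ℂ) (x : ι → ℝ) : ℂ :=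
  Complex.exp (Real.pi * Complex.I * ∑ i, z i * ((L *ᵥ x) i : ℂ) ^ 2)

section Gauss

variable {ι : Type*} [Fintype ι] {L : Matrix ι ι ℝ} {z : ι → ℂ}

theorem norm_gaussPi (x : ι → ℝ) :
    ‖gaussPi L z x‖ = Real.exp (-(Real.pi * ∑ i, (z i).im * ((L *ᵥ x) i) ^ 2)) := by
  rw [gaussPi, Complex.norm_exp]
  congr 1
  rw [mul_assoc, Complex.re_ofReal_mul, Complex.I_mul_re, Complex.im_sum, mul_neg]
  congr 2
  refine Finset.sum_congr rfl fun i _ => ?_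
  rw [← Complex.ofReal_pow, Complex.im_mul_ofReal]

theorem continuous_gaussPi : Continuous (gaussPi L z) := by
  unfold gaussPi
  have : ∀ i, Continuous fun x : ι → ℝ => (L *ᵥ x) i := fun i => by
    simp only [mulVec, dotProduct]
    fun_prop
  fun_prop

theorem norm_exp_dot (v x : ι → ℝ) :
    ‖Complex.exp (2 * Real.pi * Complex.I * ∑ i, (v i : ℂ) * x i)‖ = 1 := by
  have : 2 * Real.pi * Complex.I * ∑ i, (v i : ℂ) * x i =
      ((2 * Real.pi * ∑ i, v i * x i : ℝ) : ℂ) * Complex.I := by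
    push_cast; ring
  rw [this]
  exact Complex.norm_exp_ofReal_mul_I _

theorem summable_exp_neg_mul_sum_sq {c : ℝ} (hc : 0 < c) :
    Summable fun n : ι → ℤ => Real.exp (-c * ∑ i, intVec n i ^ 2) := by
  refine (summable_prod_of_summable (ι := ι) (f := fun _ n => Real.exp (-c * (n : ℝ) ^ 2))
    (fun _ _ => (Real.exp_pos _).le) fun _ => summable_exp_neg_mul_sq hc).congr fun n => ?_
  rw [← Real.exp_sum, Finset.mul_sum]
  rfl

/-- Translation costs only a constant and half of the exponent, locally uniformly in `x`. -/
theorem exp_neg_sum_add_sq_le {c : ℝ} (hc : 0 < c) (x y : ι → ℝ) :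
    Real.exp (-c * ∑ i, (x + y) i ^ 2) ≤
      Real.exp (c * ∑ i, x i ^ 2) * Real.exp (-(c / 2) * ∑ i, y i ^ 2) := by
  rw [← Real.exp_add, Real.exp_le_exp]
  have : ∑ i, y i ^ 2 ≤ ∑ i, (2 * (x + y) i ^ 2 + 2 * x i ^ 2) :=
    Finset.sum_le_sum fun i _ => by
      rw [Pi.add_apply]; nlinarith [sq_nonneg (2 * x i + y i)]
  rw [Finset.sum_add_distrib, ← Finset.mul_sum, ← Finset.mul_sum] at this
  nlinarith

variable [DecidableEq ι]

/-- The Gaussian decays like `exp(-c |x|²)`, as `L` is invertible. -/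
theorem exists_norm_gaussPi_le (hL : L.det ≠ 0) (hz : ∀ i, 0 < (z i).im) :
    ∃ c > 0, ∀ x : ι → ℝ, ‖gaussPi L z x‖ ≤ Real.exp (-c * ∑ i, x i ^ 2) := by
  set C₁ : ℝ := ∑ i, ∑ j, L⁻¹ i j ^ 2
  set C₂ : ℝ := ∑ i, ((z i).im)⁻¹
  have h1 : 0 ≤ C₁ := Finset.sum_nonneg fun i _ => Finset.sum_nonneg fun j _ => sq_nonneg _
  have h2 : 0 ≤ C₂ := Finset.sum_nonneg fun i _ => (inv_pos.2 (hz i)).le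
  have key : ∀ x : ι → ℝ, ∑ i, x i ^ 2 ≤ (C₁ * C₂ + 1) * ∑ i, (z i).im * ((L *ᵥ x) i) ^ 2 := by
    intro x
    set y := L *ᵥ x with hy
    have hx : x = L⁻¹ *ᵥ y := by
      rw [hy, mulVec_mulVec, nonsing_inv_mul _ (isUnit_iff_ne_zero.2 hL), one_mulVec]
    have hq : 0 ≤ ∑ i, (z i).im * y i ^ 2 :=
      Finset.sum_nonneg fun i _ => mul_nonneg (hz i).le (sq_nonneg _)
    have e1 : ∑ i, x i ^ 2 ≤ C₁ * ∑ j, y j ^ 2 := by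
      rw [Finset.sum_mul]
      refine Finset.sum_le_sum fun i _ => ?_
      conv_lhs => rw [hx]
      exact Finset.sum_mul_sq_le_sq_mul_sq _ _ _
    have e2 : ∑ j, y j ^ 2 ≤ C₂ * ∑ i, (z i).im * y i ^ 2 := by
      rw [Finset.sum_mul]
      refine Finset.sum_le_sum fun i _ => ?_
      have : (z i).im * y i ^ 2 ≤ ∑ i, (z i).im * y i ^ 2 :=
        Finset.single_le_sum (f := fun i => (z i).im * y i ^ 2)
          (fun i _ => mul_nonneg (hz i).le (sq_nonneg _)) (Finset.mem_univ i)
      calc y i ^ 2 = ((z i).im)⁻¹ * ((z i).im * y i ^ 2) := by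
            rw [inv_mul_cancel_left₀ (hz i).ne']
        _ ≤ _ := mul_le_mul_of_nonneg_left this (inv_pos.2 (hz i)).le
    nlinarith [mul_le_mul_of_nonneg_left e2 h1]
  refine ⟨Real.pi / (C₁ * C₂ + 1), by positivity, fun x => ?_⟩
  rw [norm_gaussPi, Real.exp_le_exp, neg_mul, neg_le_neg_iff, div_mul_eq_mul_div,
    div_le_iff₀ (by positivity), mul_assoc, mul_comm (∑ i, _)]
  exact mul_le_mul_of_nonneg_left (key x) Real.pi_pos.le

theorem summable_gaussPi (hL : L.det ≠ 0) (hz : ∀ i, 0 < (z i).im) (x : ι → ℝ) :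
    Summable fun n : ι → ℤ => gaussPi L z (x + intVec n) := by
  obtain ⟨c, hc, hle⟩ := exists_norm_gaussPi_le hL hz
  exact Summable.of_norm_bounded
    ((summable_exp_neg_mul_sum_sq (half_pos hc)).mul_left (Real.exp (c * ∑ i, x i ^ 2)))
    fun n => (hle _).trans (exp_neg_sum_add_sq_le hc _ _)

/-- The factor by which the Fourier transform of `gaussPi L z` differs from a Gaussian. -/
noncomputable def gaussPiConst (L : Matrix ι ι ℝ) (z : ι → ℂ) : ℂ :=
  (|L.det|⁻¹ : ℝ) * ∏ i, (Real.pi / (-(Real.pi * Complex.I * z i))) ^ (1 / 2 : ℂ)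

/-- In the coordinates `L x` the integrand of the Fourier transform at `u` becomes a diagonal
Gaussian with linear term `L⁻ᵀ u`. -/
theorem mul_gaussPi_eq (hL : L.det ≠ 0) (u x : ι → ℝ) :
    Complex.exp (-(2 * Real.pi * Complex.I * ∑ i, (u i : ℂ) * x i)) * gaussPi L z x =
      Complex.exp (-∑ i, -(Real.pi * Complex.I * z i) * ((L *ᵥ x) i : ℂ) ^ 2 +
        ∑ i, -(2 * Real.pi * Complex.I * ((L⁻¹ᵀ *ᵥ u) i : ℝ)) * ((L *ᵥ x) i : ℝ)) := by
  have h : ∑ i, u i * x i = ∑ i, (L⁻¹ᵀ *ᵥ u) i * (L *ᵥ x) i := by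
    change u ⬝ᵥ x = (L⁻¹ᵀ *ᵥ u) ⬝ᵥ (L *ᵥ x)
    rw [dotProduct_mulVec, mulVec_transpose, vecMul_vecMul,
      nonsing_inv_mul _ (isUnit_iff_ne_zero.2 hL), vecMul_one]
  have h' : ∑ i, (u i : ℂ) * x i = ∑ i, ((L⁻¹ᵀ *ᵥ u) i : ℂ) * ((L *ᵥ x) i : ℝ) := by
    exact_mod_cast congrArg (Complex.ofReal) h
  rw [gaussPi, ← Complex.exp_add, h', add_comm]
  congr 2
  · rw [Finset.mul_sum, ← Finset.sum_neg_distrib]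
    exact Finset.sum_congr rfl fun i _ => by ring
  · rw [Finset.mul_sum, ← Finset.sum_neg_distrib]
    exact Finset.sum_congr rfl fun i _ => by ring

open MeasureTheory in
theorem piFourier_gaussPi (hL : L.det ≠ 0) (hz : ∀ i, 0 < (z i).im) (u : ι → ℝ) :
    piFourier (gaussPi L z) u = gaussPiConst L z * gaussPi L⁻¹ᵀ (fun i => -(z i)⁻¹) u := by
  have hb : ∀ i, 0 < (-(Real.pi * Complex.I * z i)).re := fun i => by
    rw [Complex.neg_re, mul_assoc, Complex.re_ofReal_mul, Complex.I_mul_re]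
    have := mul_pos Real.pi_pos (hz i)
    linarith
  set F : (ι → ℝ) → ℂ := fun y =>
    Complex.exp (-∑ i, -(Real.pi * Complex.I * z i) * (y i : ℂ) ^ 2 +
        ∑ i, -(2 * Real.pi * Complex.I * ((L⁻¹ᵀ *ᵥ u) i : ℝ)) * (y i : ℝ)) with hF
  have hFc : Continuous F := by fun_prop
  have e1 : piFourier (gaussPi L z) u = ∫ x, F (toLin' L x) :=
    integral_congr_ae (Filter.Eventually.of_forall fun x => mul_gaussPi_eq hL u x)
  have hcont : Continuous (toLin' L) := LinearMap.continuous_of_finiteDimensional _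
  rw [e1, ← integral_map hcont.aemeasurable hFc.aestronglyMeasurable,
    Real.map_matrix_volume_pi_eq_smul_volume_pi hL, integral_smul_measure, hF,
    GaussianFourier.integral_cexp_neg_sum_mul_add hb, Finset.prod_mul_distrib, gaussPiConst,
    ← Complex.exp_sum, gaussPi, ENNReal.toReal_ofReal (abs_nonneg _), abs_inv, Complex.real_smul,
    mul_assoc ((|L.det|⁻¹ : ℝ) : ℂ), Finset.mul_sum]
  congr 3
  refine Finset.sum_congr rfl fun i _ => ?_
  have hz0 : z i ≠ 0 := fun h => by simpa [h] using hz i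
  have hp : (Real.pi : ℂ) ≠ 0 := by exact_mod_cast Real.pi_ne_zero
  field_simp
  ring_nf

open MeasureTheory in
theorem integrable_gaussPi (hL : L.det ≠ 0) (hz : ∀ i, 0 < (z i).im) :
    Integrable (gaussPi L z) := by
  obtain ⟨c, hc, hle⟩ := exists_norm_gaussPi_le hL hz
  have h := (GaussianFourier.integrable_cexp_neg_mul_sum_add (ι := ι) (b := c)
    (by simpa using hc) 0).norm
  refine h.mono' continuous_gaussPi.aestronglyMeasurable (Filter.Eventually.of_forall fun x => ?_)
  refine (hle x).trans_eq ?_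
  rw [Complex.norm_exp]
  congr 1
  have : (-(c : ℂ) * ∑ i, (x i : ℂ) ^ 2 + ∑ i, (0 : ι → ℂ) i * x i) =
      ((-c * ∑ i, x i ^ 2 : ℝ) : ℂ) := by
    push_cast; simp
  rw [this, Complex.ofReal_re]

theorem im_neg_inv_pos {w : ℂ} (hw : 0 < w.im) : 0 < (-w⁻¹).im := by
  rw [Complex.neg_im, Complex.inv_im, neg_div, neg_neg]
  exact div_pos hw (Complex.normSq_pos.2 fun h => by simp [h] at hw)

open MeasureTheory TopologicalSpace in
/-- Poisson summation for a Gaussian shifted by `x` and modulated by the character with frequency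
`v`. -/
theorem tsum_gaussPi (hL : L.det ≠ 0) (hz : ∀ i, 0 < (z i).im) (v x : ι → ℝ) :
    ∑' n : ι → ℤ, Complex.exp (2 * Real.pi * Complex.I * ∑ i, (v i : ℂ) * (x + intVec n) i) *
        gaussPi L z (x + intVec n) =
      gaussPiConst L z * ∑' k : ι → ℤ, gaussPi L⁻¹ᵀ (fun i => -(z i)⁻¹) (intVec k - v) *
        Complex.exp (2 * Real.pi * Complex.I * ∑ i, (k i : ℂ) * x i) := by
  obtain ⟨c, hc, hle⟩ := exists_norm_gaussPi_le hL hz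
  have hechar : Continuous fun x : ι → ℝ =>
    Complex.exp (2 * Real.pi * Complex.I * ∑ i, (v i : ℂ) * x i) := by fun_prop
  let f : C(ι → ℝ, ℂ) := ⟨fun x =>
    Complex.exp (2 * Real.pi * Complex.I * ∑ i, (v i : ℂ) * x i) * gaussPi L z x,
    hechar.mul continuous_gaussPi⟩
  have hfn : ∀ x, ‖f x‖ = ‖gaussPi L z x‖ := fun x => by
    rw [ContinuousMap.coe_mk, norm_mul, norm_exp_dot, one_mul]
  have hF : ∀ u, piFourier f u =
      gaussPiConst L z * gaussPi L⁻¹ᵀ (fun i => -(z i)⁻¹) (u - v) := fun u => by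
    rw [← piFourier_gaussPi hL hz]
    refine integral_congr_ae (Filter.Eventually.of_forall fun x => ?_)
    simp only [f, ContinuousMap.coe_mk]
    rw [← mul_assoc, ← Complex.exp_add, ← mul_neg, ← mul_add, ← mul_neg,
      ← Finset.sum_neg_distrib, ← Finset.sum_neg_distrib, ← Finset.sum_add_distrib]
    congr 4
    funext i
    rw [Pi.sub_apply]
    push_cast
    ring
  have hdual : (L⁻¹ᵀ).det ≠ 0 := by
    rw [det_transpose, det_nonsing_inv, Ring.inverse_eq_inv']
    exact inv_ne_zero hL
  have h := tsum_add_intVec_eq_tsum_piFourier f ?_ ?_ ?_ x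
  · rw [← tsum_mul_left]
    refine h.trans (tsum_congr fun k => ?_)
    rw [hF, mul_assoc]
  · intro K
    obtain ⟨B, hB⟩ := (K.isCompact.image (f := fun x : ι → ℝ => ∑ i, x i ^ 2)
      (by fun_prop)).bddAbove
    refine Summable.of_nonneg_of_le (fun _ => norm_nonneg _) (fun n => ?_)
      ((summable_exp_neg_mul_sum_sq (ι := ι) (half_pos hc)).mul_left (Real.exp (c * B)))
    refine (ContinuousMap.norm_le _ (by positivity)).2 fun y => ?_
    change ‖f (y.1 + intVec n)‖ ≤ _
    rw [hfn]
    refine ((hle _).trans (exp_neg_sum_add_sq_le hc _ _)).trans ?_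
    gcongr
    exact hB ⟨y.1, y.2, rfl⟩
  · refine (integrable_gaussPi hL hz).norm.mono' f.continuous.aestronglyMeasurable
      (Filter.Eventually.of_forall fun x => (hfn x).le)
  · simp only [hF, sub_eq_add_neg, add_comm _ (-v)]
    exact (summable_gaussPi hdual (fun i => im_neg_inv_pos (hz i)) (-v)).mul_left _

end Gauss

/-! ### Casts of matrices -/

/-- A real matrix seen as a complex matrix. -/
noncomputable def matC {m n : Type*} (X : Matrix m n ℝ) : Matrix m n ℂ := X.map Complex.ofRealHom

/-- An integral matrix seen as a real matrix. -/
noncomputable def matR {m n : Type*} (X : Matrix m n ℤ) : Matrix m n ℝ := X.map (Int.castRingHom ℝ)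

section Casts

variable {l m n : Type*}

@[simp] theorem matC_apply (X : Matrix m n ℝ) (i : m) (j : n) : matC X i j = (X i j : ℂ) := rfl

@[simp] theorem matR_apply (X : Matrix m n ℤ) (i : m) (j : n) : matR X i j = (X i j : ℝ) := rfl

theorem matC_add (X Y : Matrix m n ℝ) : matC (X + Y) = matC X + matC Y := by ext; simp

theorem matC_smul (c : ℝ) (X : Matrix m n ℝ) : matC (c • X) = (c : ℂ) • matC X := by ext; simp

theorem matC_transpose (X : Matrix m n ℝ) : matC Xᵀ = (matC X)ᵀ := rfl

theorem matC_mul [Fintype m] (X : Matrix l m ℝ) (Y : Matrix m n ℝ) :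
    matC (X * Y) = matC X * matC Y := Matrix.map_mul

theorem matC_one [DecidableEq m] : matC (1 : Matrix m m ℝ) = 1 :=
  Matrix.map_one _ (map_zero _) (map_one _)

theorem matC_det [Fintype m] [DecidableEq m] (X : Matrix m m ℝ) : (matC X).det = (X.det : ℂ) :=
  (Complex.ofRealHom.map_det X).symm

theorem matC_trace [Fintype m] (X : Matrix m m ℝ) : (matC X).trace = (X.trace : ℂ) :=
  (AddMonoidHom.map_trace Complex.ofRealHom X).symm

theorem matC_inv [Fintype m] [DecidableEq m] {X : Matrix m m ℝ} (hX : X.det ≠ 0) :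
    matC X⁻¹ = (matC X)⁻¹ := by
  symm
  apply inv_eq_left_inv
  rw [← matC_mul, nonsing_inv_mul _ (isUnit_iff_ne_zero.2 hX), matC_one]

theorem matR_add (X Y : Matrix m n ℤ) : matR (X + Y) = matR X + matR Y := by ext; simp

theorem matR_sub (X Y : Matrix m n ℤ) : matR (X - Y) = matR X - matR Y := by ext; simp

theorem matR_smul (c : ℤ) (X : Matrix m n ℤ) : matR (c • X) = (c : ℝ) • matR X := by ext; simp

theorem matR_transpose (X : Matrix m n ℤ) : matR Xᵀ = (matR X)ᵀ := rfl

theorem matR_mul [Fintype m] (X : Matrix l m ℤ) (Y : Matrix m n ℤ) :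
    matR (X * Y) = matR X * matR Y := Matrix.map_mul

theorem matR_one [DecidableEq m] : matR (1 : Matrix m m ℤ) = 1 :=
  Matrix.map_one _ (map_zero _) (map_one _)

theorem matR_det [Fintype m] [DecidableEq m] (X : Matrix m m ℤ) : (matR X).det = (X.det : ℝ) :=
  ((Int.castRingHom ℝ).map_det X).symm

theorem matR_trace [Fintype m] (X : Matrix m m ℤ) : (matR X).trace = (X.trace : ℝ) :=
  (AddMonoidHom.map_trace (Int.castRingHom ℝ) X).symm

end Casts

/-! ### The Siegel upper half space -/

theorem exists_eq_transpose_mul_diagonal_mul {n : Type*} [Fintype n] [DecidableEq n]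
    {A : Matrix n n ℝ} (hA : A.IsHermitian) :
    ∃ U : Matrix n n ℝ, Uᵀ * U = 1 ∧ A = Uᵀ * diagonal hA.eigenvalues * U := by
  refine ⟨(star hA.eigenvectorUnitary : unitaryGroup n ℝ).1, ?_, ?_⟩
  · have := Unitary.coe_mul_star_self hA.eigenvectorUnitary
    simpa [star_eq_conjTranspose, conjTranspose_eq_transpose_of_trivial] using this
  · conv_lhs => rw [hA.spectral_theorem]
    simp [Unitary.conjStarAlgAut_apply, star_eq_conjTranspose,
      conjTranspose_eq_transpose_of_trivial]

theorem Matrix.PosDef.exists_eq_transpose_mul_self {n : Type*} [Fintype n] [DecidableEq n]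
    {A : Matrix n n ℝ} (hA : A.PosDef) : ∃ Q : Matrix n n ℝ, Q.det ≠ 0 ∧ A = Qᵀ * Q := by
  obtain ⟨U, hU, h⟩ := exists_eq_transpose_mul_diagonal_mul hA.1
  have hQ : A = (diagonal (fun i => √(hA.1.eigenvalues i)) * U)ᵀ *
      (diagonal (fun i => √(hA.1.eigenvalues i)) * U) := by
    rw [transpose_mul, diagonal_transpose, Matrix.mul_assoc, ← Matrix.mul_assoc (diagonal _),
      diagonal_mul_diagonal, ← Matrix.mul_assoc]
    conv_lhs => rw [h]
    congr 3
    funext i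
    exact (Real.mul_self_sqrt (hA.eigenvalues_pos i).le).symm
  refine ⟨_, fun h0 => hA.det_pos.ne' ?_, hQ⟩
  rw [hQ, det_mul, h0, mul_zero]

section Siegel

variable {g : ℕ}

/-- Congruence by a real matrix diagonalises a point of the Siegel upper half space. -/
theorem exists_diagonalization {τ : Matrix (Fin g) (Fin g) ℂ} (hτ : τ ∈ siegelHalfSpace g) :
    ∃ (R : Matrix (Fin g) (Fin g) ℝ) (z : Fin g → ℂ), R.det ≠ 0 ∧ (∀ i, 0 < (z i).im) ∧
      τ = (matC R)ᵀ * diagonal z * matC R := by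
  obtain ⟨hsym, hpos⟩ := hτ
  obtain ⟨W, hW, hY⟩ := hpos.exists_eq_transpose_mul_self
  have hWu : IsUnit W.det := isUnit_iff_ne_zero.2 hW
  set X : Matrix (Fin g) (Fin g) ℝ := τ.map Complex.re
  have hX : Xᵀ = X := by
    change (τᵀ).map Complex.re = τ.map Complex.re
    rw [hsym]
  have hH : (W⁻¹ᵀ * X * W⁻¹).IsHermitian := by
    rw [IsHermitian, conjTranspose_eq_transpose_of_trivial]
    simp only [transpose_mul, transpose_transpose, hX, Matrix.mul_assoc]
  obtain ⟨d, U, hU, h⟩ : ∃ (d : Fin g → ℝ) (U : Matrix (Fin g) (Fin g) ℝ), Uᵀ * U = 1 ∧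
      W⁻¹ᵀ * X * W⁻¹ = Uᵀ * diagonal d * U := ⟨_, exists_eq_transpose_mul_diagonal_mul hH⟩
  have hUdet : U.det ≠ 0 := fun h0 => by
    have := congrArg det hU
    rw [det_mul, h0, mul_zero, det_one] at this
    exact zero_ne_one this
  have hXW : X = (U * W)ᵀ * diagonal d * (U * W) := by
    have : X = Wᵀ * (W⁻¹ᵀ * X * W⁻¹) * W := by
      rw [← Matrix.mul_assoc, ← Matrix.mul_assoc, ← transpose_mul, nonsing_inv_mul _ hWu,
        transpose_one, Matrix.one_mul, Matrix.mul_assoc, nonsing_inv_mul _ hWu, Matrix.mul_one]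
    refine this.trans ?_
    rw [h]
    simp only [transpose_mul, Matrix.mul_assoc]
  have hYW : τ.map Complex.im = (U * W)ᵀ * (U * W) := by
    rw [hY, transpose_mul, Matrix.mul_assoc, ← Matrix.mul_assoc Uᵀ, hU, Matrix.one_mul]
  refine ⟨U * W, fun i => d i + Complex.I, ?_, fun i => by simp, ?_⟩
  · rw [det_mul]; exact mul_ne_zero hUdet hW
  · have e1 : τ = matC X + Complex.I • matC (τ.map Complex.im) := by
      ext i j
      simp only [X, Matrix.add_apply, Matrix.smul_apply, matC_apply, map_apply, smul_eq_mul]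
      rw [mul_comm, Complex.re_add_im]
    have e2 : diagonal (fun i => (d i : ℂ) + Complex.I) =
        matC (diagonal d) + Complex.I • (1 : Matrix (Fin g) (Fin g) ℂ) := by
      ext i j
      by_cases hij : i = j
      · subst hij; simp
      · simp [hij]
    rw [e2, Matrix.mul_add, Matrix.add_mul, ← matC_transpose, ← matC_mul, ← matC_mul, ← hXW,
      Matrix.mul_smul, Matrix.mul_one, Matrix.smul_mul, ← matC_mul, ← hYW]
    exact e1

theorem mem_siegelHalfSpace_of_diagonalization {R : Matrix (Fin g) (Fin g) ℝ} {z : Fin g → ℂ}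
    (hR : R.det ≠ 0) (hz : ∀ i, 0 < (z i).im) :
    (matC R)ᵀ * diagonal z * matC R ∈ siegelHalfSpace g := by
  refine ⟨by simp only [transpose_mul, transpose_transpose, diagonal_transpose, Matrix.mul_assoc],
    ?_⟩
  have : ((matC R)ᵀ * diagonal z * matC R).map Complex.im =
      Rᴴ * diagonal (fun i => (z i).im) * R := by
    ext i j
    have hd : ∀ a b, (diagonal z a b).im = diagonal (fun i => (z i).im) a b := fun a b => by
      rw [diagonal_apply, diagonal_apply]
      split_ifs <;> simp
    simp only [map_apply, mul_apply, transpose_apply, conjTranspose_apply, matC_apply,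
      star_trivial, Complex.im_sum, Complex.im_mul_ofReal, Complex.im_ofReal_mul, hd]
  rw [this]
  refine (PosDef.diagonal hz).conjTranspose_mul_mul_same ?_
  exact mulVec_injective_of_isUnit ((isUnit_iff_isUnit_det _).2 (isUnit_iff_ne_zero.2 hR))

theorem siegelHalfSpace_det_ne_zero {τ : Matrix (Fin g) (Fin g) ℂ} (hτ : τ ∈ siegelHalfSpace g) :
    τ.det ≠ 0 := by
  obtain ⟨R, z, hR, hz, rfl⟩ := exists_diagonalization hτ
  have h1 : (matC R).det ≠ 0 := by rw [matC_det]; exact_mod_cast hR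
  rw [det_mul, det_mul, det_transpose, det_diagonal]
  exact mul_ne_zero (mul_ne_zero h1 (Finset.prod_ne_zero_iff.2 fun i _ h => by
    simpa [h] using hz i)) h1

theorem neg_inv_diagonalization {R : Matrix (Fin g) (Fin g) ℝ} {z : Fin g → ℂ}
    (hR : R.det ≠ 0) (hz : ∀ i, 0 < (z i).im) :
    -((matC R)ᵀ * diagonal z * matC R)⁻¹ =
      (matC R⁻¹ᵀ)ᵀ * diagonal (fun i => -(z i)⁻¹) * matC R⁻¹ᵀ := by
  have hz0 : ∀ i, z i ≠ 0 := fun i h => by simpa [h] using hz i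
  have hu : IsUnit (matC R).det := by
    rw [matC_det, isUnit_iff_ne_zero]; exact_mod_cast hR
  have hut : IsUnit (matC R)ᵀ.det := by rwa [det_transpose]
  rw [neg_eq_iff_eq_neg]
  apply inv_eq_right_inv
  rw [matC_transpose, transpose_transpose, matC_inv hR, transpose_nonsing_inv]
  have : diagonal (fun i => -(z i)⁻¹) = -diagonal (fun i => (z i)⁻¹) := by
    rw [diagonal_neg]
  rw [this]
  simp only [Matrix.mul_neg, Matrix.neg_mul, neg_neg]
  calc (matC R)ᵀ * diagonal z * matC R * ((matC R)⁻¹ * diagonal (fun i => (z i)⁻¹) * (matC R)ᵀ⁻¹)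
      = (matC R)ᵀ * (diagonal z * (matC R * (matC R)⁻¹) * diagonal (fun i => (z i)⁻¹)) *
        (matC R)ᵀ⁻¹ := by simp only [Matrix.mul_assoc]
    _ = 1 := by
      rw [mul_nonsing_inv _ hu, Matrix.mul_one, diagonal_mul_diagonal]
      simp only [mul_inv_cancel₀ (hz0 _)]
      rw [diagonal_one, Matrix.mul_one, mul_nonsing_inv _ hut]

theorem siegelHalfSpace_neg_inv {τ : Matrix (Fin g) (Fin g) ℂ} (hτ : τ ∈ siegelHalfSpace g) :
    -τ⁻¹ ∈ siegelHalfSpace g := by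
  obtain ⟨R, z, hR, hz, rfl⟩ := exists_diagonalization hτ
  rw [neg_inv_diagonalization hR hz]
  refine mem_siegelHalfSpace_of_diagonalization ?_ fun i => im_neg_inv_pos (hz i)
  rw [det_transpose, det_nonsing_inv, Ring.inverse_eq_inv']
  exact inv_ne_zero hR

theorem siegelHalfSpace_congr {τ : Matrix (Fin g) (Fin g) ℂ} (hτ : τ ∈ siegelHalfSpace g)
    {P : Matrix (Fin g) (Fin g) ℝ} (hP : P.det ≠ 0) :
    (matC P)ᵀ * τ * matC P ∈ siegelHalfSpace g := by
  obtain ⟨R, z, hR, hz, rfl⟩ := exists_diagonalization hτ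
  have : (matC P)ᵀ * ((matC R)ᵀ * diagonal z * matC R) * matC P =
      (matC (R * P))ᵀ * diagonal z * matC (R * P) := by
    simp only [matC_mul, transpose_mul, Matrix.mul_assoc]
  rw [this]
  exact mem_siegelHalfSpace_of_diagonalization (by rw [det_mul]; exact mul_ne_zero hR hP) hz

theorem siegelHalfSpace_add_real {τ : Matrix (Fin g) (Fin g) ℂ} (hτ : τ ∈ siegelHalfSpace g)
    {P : Matrix (Fin g) (Fin g) ℝ} (hP : Pᵀ = P) : τ + matC P ∈ siegelHalfSpace g := by
  refine ⟨by rw [transpose_add, hτ.1, ← matC_transpose, hP], ?_⟩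
  convert hτ.2 using 1
  ext i j
  simp

end Siegel

/-! ### Theta inversion -/

/-- The character `t ↦ exp(2πit)` of `ℝ`. -/
noncomputable def eChar (t : ℝ) : ℂ := Complex.exp (2 * Real.pi * Complex.I * t)

theorem eChar_add (s t : ℝ) : eChar (s + t) = eChar s * eChar t := by
  rw [eChar, eChar, eChar, ← Complex.exp_add]; push_cast; ring_nf

theorem eChar_int (n : ℤ) : eChar n = 1 := by
  rw [eChar, Complex.exp_eq_one_iff]
  exact ⟨n, by push_cast; ring⟩

theorem eChar_zero : eChar 0 = 1 := by simpa using eChar_int 0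

theorem eChar_add_int (t : ℝ) (n : ℤ) : eChar (t + n) = eChar t := by
  rw [eChar_add, eChar_int, mul_one]

theorem norm_eChar (t : ℝ) : ‖eChar t‖ = 1 := by
  have : 2 * Real.pi * Complex.I * (t : ℂ) = ((2 * Real.pi * t : ℝ) : ℂ) * Complex.I := by
    push_cast; ring
  rw [eChar, this]
  exact Complex.norm_exp_ofReal_mul_I _

section Inversion

variable {g : ℕ}

/-- The Gaussian `exp((πi/4) tr(S[X] τ))` in a real matrix variable `X`. -/
noncomputable def qExp (S : Matrix (Fin 4) (Fin 4) ℝ) (τ : Matrix (Fin g) (Fin g) ℂ)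
    (X : Matrix (Fin 4) (Fin g) ℝ) : ℂ :=
  Complex.exp (Real.pi * Complex.I / 4 * trace (matC (Xᵀ * S * X) * τ))

open scoped Kronecker in
/-- `S = Qᵀ Q` and `τ = Rᵀ diag(z) R` exhibit the quadratic form `tr(S[X] τ)` in the entries of `X`
as diagonal in the coordinates `(R ⊗ Q) vec X`. The scaling `c` accounts for `X` and for `4 X`. -/
theorem gaussPi_kronecker (Q : Matrix (Fin 4) (Fin 4) ℝ) (R : Matrix (Fin g) (Fin g) ℝ)
    (z : Fin g → ℂ) (X : Matrix (Fin 4) (Fin g) ℝ) (c : ℝ) :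
    gaussPi (R ⊗ₖ Q) (fun p => z p.1 * (c ^ 2 / 4)) (vec X) =
      qExp (Qᵀ * Q) ((matC R)ᵀ * diagonal z * matC R) (c • X) := by
  rw [gaussPi, qExp, kronecker_mulVec_vec, mul_div_assoc, mul_assoc, mul_assoc]
  congr 2
  set Y := Q * X * Rᵀ with hY
  have h1 : trace (matC ((c • X)ᵀ * (Qᵀ * Q) * (c • X)) * ((matC R)ᵀ * diagonal z * matC R)) =
      (c : ℂ) ^ 2 * trace ((matC Y)ᵀ * matC Y * diagonal z) := by
    have : matC ((c • X)ᵀ * (Qᵀ * Q) * (c • X)) =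
        (c : ℂ) ^ 2 • ((matC (Q * X))ᵀ * matC (Q * X)) := by
      rw [transpose_smul, Matrix.smul_mul, Matrix.smul_mul, Matrix.mul_smul, smul_smul, matC_smul,
        ← matC_transpose, ← matC_mul, transpose_mul]
      push_cast
      simp only [Matrix.mul_assoc, sq]
    rw [this, Matrix.smul_mul, trace_smul, smul_eq_mul]
    congr 1
    rw [← Matrix.mul_assoc, trace_mul_comm, hY, matC_mul (Q * X), transpose_mul, matC_transpose,
      transpose_transpose]
    simp only [Matrix.mul_assoc]
  have h2 : trace ((matC Y)ᵀ * matC Y * diagonal z) =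
      ∑ p : Fin g × Fin 4, z p.1 * ((vec Y p : ℝ) : ℂ) ^ 2 := by
    rw [Fintype.sum_prod_type, trace]
    refine Finset.sum_congr rfl fun i _ => ?_
    rw [diag_apply, mul_diagonal, mul_apply, mul_comm, Finset.mul_sum]
    refine Finset.sum_congr rfl fun a _ => ?_
    simp only [transpose_apply, matC_apply, vec]
    ring
  rw [h1, h2, Finset.mul_sum, Finset.mul_sum, Finset.mul_sum]
  refine Finset.sum_congr rfl fun p _ => ?_
  ring

/-- Integral matrices as integral vectors, column by column. -/
def vecEquiv (g : ℕ) : Matrix (Fin 4) (Fin g) ℤ ≃ (Fin g × Fin 4 → ℤ) where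
  toFun X := vec X
  invFun x := of fun a i => x (i, a)
  left_inv _ := rfl
  right_inv _ := rfl

theorem trace_transpose_mul_eq_sum_vec (X Y : Matrix (Fin 4) (Fin g) ℝ) :
    trace (Xᵀ * Y) = ∑ p : Fin g × Fin 4, vec X p * vec Y p := by
  rw [Fintype.sum_prod_type, trace]
  rfl

open scoped Kronecker in
/-- **Theta inversion.** In even rank `4` the square roots in the automorphy factor combine to
`κ det τ ^ (-2)`, where `κ` depends only on `S` and `g`. -/
theorem theta_inversion {S : Matrix (Fin 4) (Fin 4) ℝ} (hS : S.PosDef) (g : ℕ) :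
    ∃ κ : ℂ, ∀ τ ∈ siegelHalfSpace g, ∀ X V : Matrix (Fin 4) (Fin g) ℝ,
      ∑' G : Matrix (Fin 4) (Fin g) ℤ,
          eChar (trace ((X + matR G)ᵀ * V) / 4) * qExp S τ (X + matR G) =
        κ * (τ.det ^ 2)⁻¹ * ∑' K : Matrix (Fin 4) (Fin g) ℤ,
          qExp S⁻¹ (-τ⁻¹) ((4 : ℝ) • matR K - V) * eChar (trace (Xᵀ * matR K)) := by
  obtain ⟨Q, hQ, rfl⟩ := hS.exists_eq_transpose_mul_self
  refine ⟨(|Q.det ^ g|⁻¹ : ℝ) * (-16) ^ g, fun τ hτ X V => ?_⟩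
  obtain ⟨R, z, hR, hz, rfl⟩ := exists_diagonalization hτ
  have hz0 : ∀ i, z i ≠ 0 := fun i h => by simpa [h] using hz i
  have hL : (R ⊗ₖ Q).det ≠ 0 := by
    rw [det_kronecker]; exact mul_ne_zero (pow_ne_zero _ hR) (pow_ne_zero _ hQ)
  have hz4 : ∀ p : Fin g × Fin 4, 0 < (z p.1 * (((1 : ℝ) : ℂ) ^ 2 / 4)).im := fun p => by
    have : (((1 : ℝ) : ℂ) ^ 2 / 4) = ((1 / 4 : ℝ) : ℂ) := by push_cast; norm_num
    rw [this, Complex.im_mul_ofReal]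
    have := hz p.1
    positivity
  have h := tsum_gaussPi hL hz4 (vec ((1 / 4 : ℝ) • V)) (vec X)
  rw [← (vecEquiv g).tsum_eq, ← (vecEquiv g).tsum_eq] at h
  have hconst : gaussPiConst (R ⊗ₖ Q) (fun p => z p.1 * (((1 : ℝ) : ℂ) ^ 2 / 4)) =
      (|Q.det ^ g|⁻¹ : ℝ) * (-16) ^ g * (((matC R)ᵀ * diagonal z * matC R).det ^ 2)⁻¹ := by
    have hRc : (R.det : ℂ) ≠ 0 := by exact_mod_cast hR
    have hp : (Real.pi : ℂ) ≠ 0 := by exact_mod_cast Real.pi_ne_zero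
    have e1 : ∀ i, (((Real.pi : ℂ) / (-(Real.pi * Complex.I * (z i * (((1 : ℝ) : ℂ) ^ 2 / 4))))) ^
        (1 / 2 : ℂ)) ^ 4 = -16 * (z i ^ 2)⁻¹ := fun i => by
      have hz' := hz0 i
      have : ∀ w : ℂ, (w ^ (1 / 2 : ℂ)) ^ 4 = w ^ 2 := fun w => by
        have := Complex.cpow_nat_inv_pow w (n := 2) two_ne_zero
        push_cast at this
        rw [one_div, show (4 : ℕ) = 2 * 2 from rfl, pow_mul, this]
      rw [this]
      field_simp
      simp [Complex.I_sq]
      norm_num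
    rw [gaussPiConst, det_kronecker, Fintype.prod_prod_type]
    simp only [Finset.prod_const, Finset.card_univ, Fintype.card_fin, e1]
    rw [Finset.prod_mul_distrib, Finset.prod_const, Finset.card_univ, Fintype.card_fin,
      Finset.prod_inv_distrib, Finset.prod_pow, det_mul, det_mul, det_transpose, det_diagonal,
      matC_det, abs_mul, abs_of_nonneg (show 0 ≤ R.det ^ 4 by positivity)]
    push_cast
    have : ∏ i, z i ≠ 0 := Finset.prod_ne_zero_iff.2 fun i _ => hz0 i
    simp only [mul_inv, mul_pow]
    field_simp
  rw [hconst] at h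
  convert h using 1
  · refine tsum_congr fun G => ?_
    have e : vec X + intVec (vecEquiv g G) = vec (X + matR G) := rfl
    rw [e, gaussPi_kronecker, one_smul, eChar]
    congr 3
    rw [trace_transpose_mul_eq_sum_vec]
    push_cast
    rw [Finset.sum_div]
    refine Finset.sum_congr rfl fun p _ => ?_
    simp only [vec, Matrix.smul_apply, smul_eq_mul]
    push_cast
    ring
  · congr 1
    refine tsum_congr fun K => ?_
    have e : intVec (vecEquiv g K) - vec ((1 / 4 : ℝ) • V) = vec (matR K - (1 / 4 : ℝ) • V) := rfl
    have e2 : (fun p : Fin g × Fin 4 => -(z p.1 * (((1 : ℝ) : ℂ) ^ 2 / 4))⁻¹) =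
        fun p => (fun i => -(z i)⁻¹) p.1 * (((4 : ℝ) : ℂ) ^ 2 / 4) := by
      funext p
      have := hz0 p.1
      push_cast
      field_simp
    have e3 : (R ⊗ₖ Q)⁻¹ᵀ = R⁻¹ᵀ ⊗ₖ Q⁻¹ᵀ := by
      rw [inv_kronecker]; exact (kroneckerMap_transpose _ _ _).symm
    rw [e, e2, e3, gaussPi_kronecker Q⁻¹ᵀ R⁻¹ᵀ (fun i => -(z i)⁻¹) (matR K - (1 / 4 : ℝ) • V) 4,
      eChar, neg_inv_diagonalization hR hz, transpose_transpose, Matrix.mul_inv_rev]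
    congr 2
    · rw [transpose_nonsing_inv]
    · rw [smul_sub, smul_smul]; norm_num
    · congr 1
      rw [trace_transpose_mul_eq_sum_vec]
      push_cast
      refine Finset.sum_congr rfl fun p _ => ?_
      rw [mul_comm]
      rfl

open scoped Kronecker in
theorem summable_qExp {S : Matrix (Fin 4) (Fin 4) ℝ} (hS : S.PosDef)
    {τ : Matrix (Fin g) (Fin g) ℂ} (hτ : τ ∈ siegelHalfSpace g) (X : Matrix (Fin 4) (Fin g) ℝ)
    {c : ℝ} (hc : 0 < c) :
    Summable fun G : Matrix (Fin 4) (Fin g) ℤ => qExp S τ (c • (X + matR G)) := by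
  obtain ⟨Q, hQ, rfl⟩ := hS.exists_eq_transpose_mul_self
  obtain ⟨R, z, hR, hz, rfl⟩ := exists_diagonalization hτ
  have hL : (R ⊗ₖ Q).det ≠ 0 := by
    rw [det_kronecker]; exact mul_ne_zero (pow_ne_zero _ hR) (pow_ne_zero _ hQ)
  have hz4 : ∀ p : Fin g × Fin 4, 0 < (z p.1 * ((c : ℂ) ^ 2 / 4)).im := fun p => by
    have : ((c : ℂ) ^ 2 / 4) = ((c ^ 2 / 4 : ℝ) : ℂ) := by push_cast; norm_num
    rw [this, Complex.im_mul_ofReal]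
    have := hz p.1
    positivity
  refine ((vecEquiv g).summable_iff.2 (summable_gaussPi hL hz4 (vec X))).congr fun G => ?_
  exact gaussPi_kronecker Q R z (X + matR G) c

end Inversion

/-! ### Blocks of elements of Igusa's group -/

/-- The relations and congruences satisfied by the blocks of an element of `Γ_g[4,8]`. -/
structure IgusaBlocks {g : ℕ} (A B C D : Matrix (Fin g) (Fin g) ℤ) : Prop where
  ac_symm : Aᵀ * C = Cᵀ * A
  bd_symm : Bᵀ * D = Dᵀ * B
  ad_sub_cb : Aᵀ * D - Cᵀ * B = 1
  dvd_a : ∀ i j, (4 : ℤ) ∣ (A - 1) i j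
  dvd_b : ∀ i j, (4 : ℤ) ∣ B i j
  dvd_c : ∀ i j, (4 : ℤ) ∣ C i j
  dvd_d : ∀ i j, (4 : ℤ) ∣ (D - 1) i j
  diag_bd : DiagDvd 8 (Dᵀ * B)
  diag_ac : DiagDvd 8 (Aᵀ * C)

section Blocks

variable {g : ℕ} {A B C D : Matrix (Fin g) (Fin g) ℤ}

theorem igusaBlocks_of_mem {M : symplecticGroup (Fin g) ℤ} (hM : M ∈ igusaGroup g 4) :
    IgusaBlocks (blockA M) (blockB M) (blockC M) (blockD M) := by
  have h1 := hM.1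
  obtain ⟨-, i1, i2⟩ := (igusaGroup g 4).inv_mem hM
  obtain ⟨r1, r2, r3⟩ := blocks_rel M
  obtain ⟨e1, e2, e3, e4⟩ := blocks_inv M
  rw [e1, e2, transpose_neg, transpose_transpose, Matrix.mul_neg] at i1
  rw [e3, e4, transpose_transpose, Matrix.neg_mul] at i2
  have hred : M.1.map (Int.castRingHom (ZMod 4)) = 1 := h1
  refine ⟨r1, r2, r3, fun i j => ?_, fun i j => (principal_blocks h1 i j).1,
    fun i j => (principal_blocks h1 i j).2, fun i j => ?_, fun i => ?_, fun i => ?_⟩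
  · have h := congrFun (congrFun hred (Sum.inl i)) (Sum.inl j)
    refine (ZMod.intCast_zmod_eq_zero_iff_dvd _ 4).1 ?_
    rw [Matrix.sub_apply, Int.cast_sub, sub_eq_zero]
    refine Eq.trans h ?_
    simp only [one_apply, Sum.inl.injEq]
    split_ifs <;> simp
  · have h := congrFun (congrFun hred (Sum.inr i)) (Sum.inr j)
    refine (ZMod.intCast_zmod_eq_zero_iff_dvd _ 4).1 ?_
    rw [Matrix.sub_apply, Int.cast_sub, sub_eq_zero]
    refine Eq.trans h ?_
    simp only [one_apply, Sum.inr.injEq]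
    split_ifs <;> simp
  · have := i1 i
    rwa [Matrix.neg_apply, dvd_neg] at this
  · have := i2 i
    rwa [Matrix.neg_apply, dvd_neg, ← r1] at this

/-- A matrix congruent to `1` modulo `4` has determinant congruent to `1` modulo `4`. -/
theorem det_cast_zmod_four (h : ∀ i j, (4 : ℤ) ∣ (D - 1) i j) : ((D.det : ℤ) : ZMod 4) = 1 := by
  have : D.map (Int.castRingHom (ZMod 4)) = 1 := by
    ext i j
    have := (ZMod.intCast_zmod_eq_zero_iff_dvd _ 4).2 (h i j)
    rw [Matrix.sub_apply, Int.cast_sub, sub_eq_zero] at this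
    refine Eq.trans this ?_
    simp only [one_apply]
    split_ifs <;> simp
  have h2 := (Int.castRingHom (ZMod 4)).map_det D
  rw [RingHom.mapMatrix_apply, this, det_one] at h2
  exact h2

theorem det_odd (h : ∀ i j, (4 : ℤ) ∣ (D - 1) i j) : Odd D.det := by
  have h1 : ((D.det - 1 : ℤ) : ZMod 4) = 0 := by
    rw [Int.cast_sub, det_cast_zmod_four h]; simp
  obtain ⟨c, hc⟩ := (ZMod.intCast_zmod_eq_zero_iff_dvd _ 4).1 h1
  exact ⟨2 * c, by push_cast at hc; linarith⟩

/-- The trace of a product of a symmetric matrix with a symmetric matrix that is divisible by `4`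
and has diagonal divisible by `8`. -/
theorem eight_dvd_trace_mul {W E : Matrix (Fin g) (Fin g) ℤ} (hW : Wᵀ = W) (hE : Eᵀ = E)
    (h4 : ∀ i j, (4 : ℤ) ∣ E i j) (h8 : DiagDvd 8 E) : (8 : ℤ) ∣ trace (W * E) := by
  refine (ZMod.intCast_zmod_eq_zero_iff_dvd _ 8).1 ?_
  have e : trace (W * E) = ∑ p : Fin g × Fin g, W p.1 p.2 * E p.2 p.1 := by
    rw [Fintype.sum_prod_type]
    rfl
  rw [e, Int.cast_sum]
  refine Finset.sum_involution (fun p _ => (p.2, p.1)) ?_ ?_ (by simp) (by simp)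
  · rintro ⟨j, k⟩ -
    rw [← Int.cast_add]
    refine (ZMod.intCast_zmod_eq_zero_iff_dvd _ 8).2 ?_
    have h1 : W k j = W j k := congrFun (congrFun hW j) k
    have h2 : E k j = E j k := congrFun (congrFun hE j) k
    obtain ⟨c, hc⟩ := h4 j k
    exact ⟨W j k * c, by simp only [h1, h2, hc]; push_cast; ring⟩
  · rintro ⟨j, k⟩ - hne heq
    apply hne
    obtain rfl : k = j := (Prod.ext_iff.1 heq).1
    exact (ZMod.intCast_zmod_eq_zero_iff_dvd _ 8).2 (Dvd.dvd.mul_left (h8 k) _)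

theorem dvd_trace_mul {m : Type*} [Fintype m] {n : Type*} [Fintype n] {W : Matrix m n ℤ}
    {E : Matrix n m ℤ} {d : ℤ} (h : ∀ i j, d ∣ E i j) : d ∣ trace (W * E) :=
  Finset.dvd_sum fun i _ => by
    rw [diag_apply, mul_apply]
    exact Finset.dvd_sum fun j _ => Dvd.dvd.mul_left (h _ _) _

namespace IgusaBlocks

theorem det_ne_zero (h : IgusaBlocks A B C D) : D.det ≠ 0 := fun h0 => by
  have := det_odd h.dvd_d
  rw [h0] at this
  exact absurd this (by decide)

end IgusaBlocks

end Blocks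

/-! ### The action of `Γ_g[4,8]` through the entries of `D⁻¹` -/

section Action

variable {g : ℕ}

theorem map_intCast_eq {m n : Type*} (X : Matrix m n ℤ) :
    X.map (Int.cast : ℤ → ℂ) = matC (matR X) := by ext; simp

theorem isUnit_matR_det {D : Matrix (Fin g) (Fin g) ℤ} (hD : D.det ≠ 0) : IsUnit (matR D).det := by
  rw [matR_det, isUnit_iff_ne_zero]; exact_mod_cast hD

namespace IgusaBlocks

variable {A B C D : Matrix (Fin g) (Fin g) ℤ}

theorem isUnit_det (h : IgusaBlocks A B C D) : IsUnit (matR D).det := isUnit_matR_det h.det_ne_zero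

theorem transpose_b_mul_inv (h : IgusaBlocks A B C D) :
    (matR B * (matR D)⁻¹)ᵀ = matR B * (matR D)⁻¹ := by
  have hu := h.isUnit_det
  have hut : IsUnit (matR D)ᵀ.det := by rwa [det_transpose]
  have e := congrArg matR h.bd_symm
  rw [matR_mul, matR_mul, matR_transpose, matR_transpose] at e
  rw [transpose_mul, transpose_nonsing_inv]
  calc (matR D)ᵀ⁻¹ * (matR B)ᵀ = (matR D)ᵀ⁻¹ * ((matR B)ᵀ * matR D) * (matR D)⁻¹ := by
        rw [Matrix.mul_assoc, Matrix.mul_assoc, mul_nonsing_inv _ hu, Matrix.mul_one]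
    _ = _ := by
        rw [e, ← Matrix.mul_assoc (matR D)ᵀ⁻¹, nonsing_inv_mul _ hut, Matrix.one_mul]

theorem transpose_c_mul_b (h : IgusaBlocks A B C D) :
    (matR C)ᵀ * (matR B * (matR D)⁻¹) = (matR A)ᵀ - (matR D)⁻¹ := by
  have e := congrArg matR h.ad_sub_cb
  rw [matR_sub, matR_mul, matR_mul, matR_transpose, matR_transpose, matR_one] at e
  have e' : (matR C)ᵀ * matR B = (matR A)ᵀ * matR D - 1 := by rw [← e]; abel
  rw [← Matrix.mul_assoc, e', Matrix.sub_mul, Matrix.mul_assoc, mul_nonsing_inv _ h.isUnit_det,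
    Matrix.mul_one, Matrix.one_mul]

/-- `A = B D⁻¹ C + D⁻ᵀ`. -/
theorem a_eq (h : IgusaBlocks A B C D) :
    matR A = matR B * (matR D)⁻¹ * matR C + ((matR D)⁻¹)ᵀ := by
  have e := congrArg transpose h.transpose_c_mul_b
  rw [transpose_mul, h.transpose_b_mul_inv, transpose_sub, transpose_transpose,
    transpose_transpose] at e
  rw [e]; abel

theorem transpose_inv_mul_c (h : IgusaBlocks A B C D) :
    ((matR D)⁻¹ * matR C)ᵀ = (matR D)⁻¹ * matR C := by
  -- `D⁻¹ C = Aᵀ C - Cᵀ (B D⁻¹) C`, a difference of symmetric matrices.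
  have e : (matR D)⁻¹ * matR C =
      (matR A)ᵀ * matR C - (matR C)ᵀ * (matR B * (matR D)⁻¹) * matR C := by
    rw [h.transpose_c_mul_b, Matrix.sub_mul]; abel
  have s : ((matR A)ᵀ * matR C)ᵀ = (matR A)ᵀ * matR C := by
    rw [transpose_mul, transpose_transpose, ← matR_transpose, ← matR_transpose, ← matR_mul,
      ← matR_mul, h.ac_symm]
  rw [e, transpose_sub, s, transpose_mul, transpose_mul, h.transpose_b_mul_inv,
    transpose_transpose]
  simp only [Matrix.mul_assoc]

end IgusaBlocks

/-- The point `(τ⁻¹ + D⁻¹ C)⁻¹`, written so that it visibly lies in the Siegel upper half space. -/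
noncomputable def siegelShift (C D : Matrix (Fin g) (Fin g) ℤ) (τ : Matrix (Fin g) (Fin g) ℂ) :
    Matrix (Fin g) (Fin g) ℂ :=
  -(-τ⁻¹ + matC (-((matR D)⁻¹ * matR C)))⁻¹

variable {A B C D : Matrix (Fin g) (Fin g) ℤ}

theorem siegelShift_aux_mem (h : IgusaBlocks A B C D) {τ : Matrix (Fin g) (Fin g) ℂ}
    (hτ : τ ∈ siegelHalfSpace g) :
    -τ⁻¹ + matC (-((matR D)⁻¹ * matR C)) ∈ siegelHalfSpace g :=
  siegelHalfSpace_add_real (siegelHalfSpace_neg_inv hτ) (by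
    rw [transpose_neg, h.transpose_inv_mul_c])

theorem siegelShift_mem (h : IgusaBlocks A B C D) {τ : Matrix (Fin g) (Fin g) ℂ}
    (hτ : τ ∈ siegelHalfSpace g) : siegelShift C D τ ∈ siegelHalfSpace g :=
  siegelHalfSpace_neg_inv (siegelShift_aux_mem h hτ)

theorem neg_inv_neg {X : Matrix (Fin g) (Fin g) ℂ} : (-X)⁻¹ = -X⁻¹ := by
  by_cases hX : IsUnit X.det
  · apply inv_eq_left_inv
    rw [Matrix.neg_mul, Matrix.mul_neg, neg_neg, nonsing_inv_mul _ hX]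
  · have : ¬ IsUnit (-X).det := by
      rw [det_neg]
      intro h
      exact hX (isUnit_of_mul_isUnit_right h)
    rw [nonsing_inv_apply_not_isUnit _ hX, nonsing_inv_apply_not_isUnit _ this, neg_zero]

theorem neg_siegelShift_inv (h : IgusaBlocks A B C D) {τ : Matrix (Fin g) (Fin g) ℂ}
    (hτ : τ ∈ siegelHalfSpace g) :
    -(siegelShift C D τ)⁻¹ = -τ⁻¹ + matC (-((matR D)⁻¹ * matR C)) := by
  have hu : IsUnit (-τ⁻¹ + matC (-((matR D)⁻¹ * matR C))).det :=
    isUnit_iff_ne_zero.2 (siegelHalfSpace_det_ne_zero (siegelShift_aux_mem h hτ))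
  rw [siegelShift, neg_inv_neg, neg_neg, nonsing_inv_nonsing_inv _ hu]

theorem siegelDenom_eq {M : symplecticGroup (Fin g) ℤ}
    (h : IgusaBlocks (blockA M) (blockB M) (blockC M) (blockD M))
    {τ : Matrix (Fin g) (Fin g) ℂ} (hτ : τ ∈ siegelHalfSpace g) :
    siegelDenom M τ =
      matC (matR (blockD M)) * (siegelShift (blockC M) (blockD M) τ)⁻¹ * τ := by
  have hτu : IsUnit τ.det := isUnit_iff_ne_zero.2 (siegelHalfSpace_det_ne_zero hτ)
  have e : (siegelShift (blockC M) (blockD M) τ)⁻¹ =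
      τ⁻¹ + matC ((matR (blockD M))⁻¹ * matR (blockC M)) := by
    rw [← neg_neg (siegelShift (blockC M) (blockD M) τ)⁻¹, neg_siegelShift_inv h hτ]
    ext i j
    simp only [Matrix.neg_apply, Matrix.add_apply, matC_apply]
    push_cast
    ring
  rw [e, Matrix.mul_add, ← matC_mul, ← Matrix.mul_assoc, mul_nonsing_inv _ h.isUnit_det,
    Matrix.one_mul, Matrix.add_mul, Matrix.mul_assoc, nonsing_inv_mul _ hτu, Matrix.mul_one,
    siegelDenom, map_intCast_eq, map_intCast_eq, add_comm]

theorem siegelDenom_det_ne_zero {M : symplecticGroup (Fin g) ℤ}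
    (h : IgusaBlocks (blockA M) (blockB M) (blockC M) (blockD M))
    {τ : Matrix (Fin g) (Fin g) ℂ} (hτ : τ ∈ siegelHalfSpace g) : (siegelDenom M τ).det ≠ 0 := by
  have h1 := siegelHalfSpace_det_ne_zero (siegelShift_mem h hτ)
  have h2 := siegelHalfSpace_det_ne_zero hτ
  have h3 := h.det_ne_zero
  rw [siegelDenom_eq h hτ, det_mul, det_mul, matC_det, matR_det, det_nonsing_inv,
    Ring.inverse_eq_inv']
  refine mul_ne_zero (mul_ne_zero ?_ (inv_ne_zero h1)) h2
  exact_mod_cast h3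

/-- For `D` invertible over `ℚ`, `M τ` is a congruence transform of `siegelShift C D τ` translated
by a rational symmetric matrix. -/
theorem siegelAct_eq {M : symplecticGroup (Fin g) ℤ}
    (h : IgusaBlocks (blockA M) (blockB M) (blockC M) (blockD M))
    {τ : Matrix (Fin g) (Fin g) ℂ} (hτ : τ ∈ siegelHalfSpace g) :
    siegelAct M τ = (matC (matR (blockD M))⁻¹)ᵀ * siegelShift (blockC M) (blockD M) τ *
      matC (matR (blockD M))⁻¹ + matC (matR (blockB M) * (matR (blockD M))⁻¹) := by
  have hden : IsUnit (siegelDenom M τ).det := isUnit_iff_ne_zero.2 (siegelDenom_det_ne_zero h hτ)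
  have h1 : IsUnit (siegelShift (blockC M) (blockD M) τ).det :=
    isUnit_iff_ne_zero.2 (siegelHalfSpace_det_ne_zero (siegelShift_mem h hτ))
  set P := (matR (blockD M))⁻¹ with hP
  set t := siegelShift (blockC M) (blockD M) τ
  have hPd : matC P * matC (matR (blockD M)) = 1 := by
    rw [← matC_mul, hP, nonsing_inv_mul _ h.isUnit_det, matC_one]
  have e : (blockA M).map (Int.cast : ℤ → ℂ) * τ + (blockB M).map (Int.cast : ℤ → ℂ) =
      ((matC P)ᵀ * t * matC P + matC (matR (blockB M) * P)) * siegelDenom M τ := by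
    rw [Matrix.add_mul]
    have e1 : (matC P)ᵀ * t * matC P * siegelDenom M τ = (matC P)ᵀ * τ := by
      rw [siegelDenom_eq h hτ]
      calc _ = (matC P)ᵀ * (t * ((matC P * matC (matR (blockD M))) * t⁻¹)) * τ := by
            simp only [Matrix.mul_assoc]; rfl
        _ = _ := by rw [hPd, Matrix.one_mul, mul_nonsing_inv _ h1, Matrix.mul_one]
    have e2 : matC (matR (blockB M) * P) * siegelDenom M τ =
        matC (matR (blockB M) * P * matR (blockC M)) * τ + matC (matR (blockB M)) := by
      rw [siegelDenom, map_intCast_eq, map_intCast_eq, Matrix.mul_add, ← Matrix.mul_assoc,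
        ← matC_mul, ← matC_mul, Matrix.mul_assoc _ P (matR (blockD M)), hP,
        nonsing_inv_mul _ h.isUnit_det, Matrix.mul_one]
    rw [e1, e2, map_intCast_eq, map_intCast_eq, h.a_eq, matC_add, Matrix.add_mul, ← hP,
      matC_transpose]
    abel
  rw [siegelAct, e, Matrix.mul_assoc, mul_nonsing_inv _ hden, Matrix.mul_one]

theorem siegelAct_mem {M : symplecticGroup (Fin g) ℤ}
    (h : IgusaBlocks (blockA M) (blockB M) (blockC M) (blockD M))
    {τ : Matrix (Fin g) (Fin g) ℂ} (hτ : τ ∈ siegelHalfSpace g) :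
    siegelAct M τ ∈ siegelHalfSpace g := by
  rw [siegelAct_eq h hτ]
  refine siegelHalfSpace_add_real (siegelHalfSpace_congr (siegelShift_mem h hτ) ?_)
    h.transpose_b_mul_inv
  rw [det_nonsing_inv, Ring.inverse_eq_inv']
  exact inv_ne_zero h.isUnit_det.ne_zero

/-- The cocycle property of `C τ + D`. -/
theorem siegelDenom_mul {M N : symplecticGroup (Fin g) ℤ}
    (hN : IgusaBlocks (blockA N) (blockB N) (blockC N) (blockD N))
    {τ : Matrix (Fin g) (Fin g) ℂ} (hτ : τ ∈ siegelHalfSpace g) :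
    siegelDenom (M * N) τ = siegelDenom M (siegelAct N τ) * siegelDenom N τ := by
  have hden : IsUnit (siegelDenom N τ).det := isUnit_iff_ne_zero.2 (siegelDenom_det_ne_zero hN hτ)
  obtain ⟨-, -, e3, e4⟩ := blocks_mul M N
  rw [siegelDenom, siegelDenom, e3, e4, Matrix.add_mul, siegelAct, Matrix.mul_assoc,
    Matrix.mul_assoc, nonsing_inv_mul _ hden, Matrix.mul_one, siegelDenom]
  simp only [map_intCast_eq, matR_add, matR_mul, matC_add, matC_mul]
  noncomm_ring

theorem siegelAct_mul {M N : symplecticGroup (Fin g) ℤ}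
    (hN : IgusaBlocks (blockA N) (blockB N) (blockC N) (blockD N))
    {τ : Matrix (Fin g) (Fin g) ℂ} (hτ : τ ∈ siegelHalfSpace g) :
    siegelAct (M * N) τ = siegelAct M (siegelAct N τ) := by
  have hN' : IsUnit (siegelDenom N τ).det := isUnit_iff_ne_zero.2 (siegelDenom_det_ne_zero hN hτ)
  obtain ⟨e1, e2, -, -⟩ := blocks_mul M N
  rw [siegelAct, siegelDenom_mul hN hτ, Matrix.mul_inv_rev, ← Matrix.mul_assoc]
  conv_rhs => rw [siegelAct]
  congr 1
  rw [siegelAct, e1, e2]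
  have : (blockB M).map (Int.cast : ℤ → ℂ) =
      (blockB M).map (Int.cast : ℤ → ℂ) * siegelDenom N τ * (siegelDenom N τ)⁻¹ := by
    rw [Matrix.mul_assoc, mul_nonsing_inv _ hN', Matrix.mul_one]
  rw [this, ← Matrix.mul_assoc, ← Matrix.add_mul]
  congr 1
  rw [siegelDenom]
  simp only [map_intCast_eq, matR_add, matR_mul, matC_add, matC_mul]
  noncomm_ring

end Action

/-! ### Residue classes of `ℤ^{4×g}` modulo `D` -/

section Residues

variable {g : ℕ} {A B C D : Matrix (Fin g) (Fin g) ℤ}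

/-- The lattice `ℤ^{4×g} Dᵀ`. -/
def rowLattice (D : Matrix (Fin g) (Fin g) ℤ) : Submodule ℤ (Matrix (Fin 4) (Fin g) ℤ) :=
  LinearMap.range (mulRightLinearMap (Fin 4) ℤ Dᵀ)

/-- The finite quotient `ℤ^{4×g} / ℤ^{4×g} Dᵀ`. -/
abbrev RowQuot (D : Matrix (Fin g) (Fin g) ℤ) : Type := Matrix (Fin 4) (Fin g) ℤ ⧸ rowLattice D

theorem mul_transpose_injective (hD : D.det ≠ 0) :
    Function.Injective fun H : Matrix (Fin 4) (Fin g) ℤ => H * Dᵀ := by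
  intro X Y hXY
  have h := congrArg (fun Z => Z * (Dᵀ).adjugate) hXY
  simp only [Matrix.mul_assoc, mul_adjugate, det_transpose, Matrix.mul_smul, Matrix.mul_one] at h
  exact smul_right_injective _ hD h

open scoped Kronecker in
/-- Right multiplication by `Dᵀ` is `D ⊗ 1` on vectorised matrices, of determinant `det(D)⁴`. -/
theorem natCard_rowQuot (hD : D.det ≠ 0) : Nat.card (RowQuot D) = D.det.natAbs ^ 4 := by
  let f : Matrix (Fin 4) (Fin g) ℤ →ₗ[ℤ] Matrix (Fin 4) (Fin g) ℤ :=
    mulRightLinearMap (Fin 4) ℤ Dᵀ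
  let e : Matrix (Fin 4) (Fin g) ℤ ≃ₗ[ℤ] rowLattice D :=
    LinearEquiv.ofInjective f (mul_transpose_injective hD)
  have h1 := Submodule.natAbs_det_equiv (rowLattice D) e
  have h2 : (rowLattice D).subtype ∘ₗ
      AddMonoidHom.toIntLinearMap (e : Matrix (Fin 4) (Fin g) ℤ →+ rowLattice D) = f := by
    ext1 X
    rfl
  rw [h2] at h1
  rw [RowQuot, ← h1]
  let v : Matrix (Fin 4) (Fin g) ℤ ≃ₗ[ℤ] (Fin g × Fin 4 → ℤ) :=
    { vecEquiv g with
      map_add' := fun _ _ => rfl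
      map_smul' := fun _ _ => rfl }
  have h3 : (v : _ →ₗ[ℤ] _) ∘ₗ f ∘ₗ (v.symm : _ →ₗ[ℤ] _) =
      toLin' (D ⊗ₖ (1 : Matrix (Fin 4) (Fin 4) ℤ)) := by
    refine LinearMap.ext fun x => ?_
    obtain ⟨X, rfl⟩ := v.surjective x
    have := kronecker_mulVec_vec (1 : Matrix (Fin 4) (Fin 4) ℤ) X D
    rw [Matrix.one_mul] at this
    simp only [LinearMap.comp_apply, LinearEquiv.coe_coe, LinearEquiv.symm_apply_apply,
      toLin'_apply]
    exact this.symm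
  rw [← LinearMap.det_conj f v, h3, LinearMap.det_toLin', det_kronecker, det_one, one_pow, mul_one,
    Int.natAbs_pow, Fintype.card_fin]

theorem finite_rowQuot (hD : D.det ≠ 0) : Finite (RowQuot D) := by
  apply Nat.finite_of_card_ne_zero
  rw [natCard_rowQuot hD]
  exact pow_ne_zero _ (Int.natAbs_ne_zero.2 hD)

/-- Every integral matrix is uniquely a chosen residue modulo `ℤ^{4×g} Dᵀ` plus an element of that
lattice. -/
noncomputable def residueEquiv (hD : D.det ≠ 0) :
    RowQuot D × Matrix (Fin 4) (Fin g) ℤ ≃ Matrix (Fin 4) (Fin g) ℤ :=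
  Equiv.ofBijective (fun p => Quotient.out p.1 + p.2 * Dᵀ) (by
    have hmk : ∀ (q : RowQuot D) (H : Matrix (Fin 4) (Fin g) ℤ),
        Submodule.Quotient.mk (p := rowLattice D) (Quotient.out q + H * Dᵀ) = q := fun q H => by
      conv_rhs => rw [← Quotient.out_eq q]
      refine (Submodule.Quotient.eq _).2 ?_
      rw [add_sub_cancel_left]
      exact ⟨H, rfl⟩
    constructor
    · rintro ⟨q, H⟩ ⟨q', H'⟩ h
      have hq : q = q' := by
        rw [← hmk q H, ← hmk q' H']
        exact congrArg _ h
      subst hq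
      exact Prod.ext rfl (mul_transpose_injective hD (add_left_cancel h))
    · intro G
      have : G - Quotient.out (Submodule.Quotient.mk (p := rowLattice D) G) ∈ rowLattice D :=
        (Submodule.Quotient.eq _).1 (Quotient.out_eq _).symm
      obtain ⟨H, hH⟩ := this
      refine ⟨(Submodule.Quotient.mk G, H), ?_⟩
      change Quotient.out _ + H * Dᵀ = G
      have hH' : H * Dᵀ = G - Quotient.out (Submodule.Quotient.mk (p := rowLattice D) G) := hH
      rw [hH', add_sub_cancel])

theorem residueEquiv_apply (hD : D.det ≠ 0) (q : RowQuot D) (H : Matrix (Fin 4) (Fin g) ℤ) :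
    residueEquiv hD (q, H) = Quotient.out q + H * Dᵀ := rfl

/-- Sums over residues modulo `ℤ^{4×g} Dᵀ` of periodic functions are invariant under translation. -/
theorem sum_out_add [Fintype (RowQuot D)] (f : Matrix (Fin 4) (Fin g) ℤ → ℂ)
    (hf : ∀ G H : Matrix (Fin 4) (Fin g) ℤ, f (G + H * Dᵀ) = f G) (Y : Matrix (Fin 4) (Fin g) ℤ) :
    ∑ q : RowQuot D, f (Quotient.out q + Y) = ∑ q : RowQuot D, f (Quotient.out q) := by
  let e : RowQuot D ≃ RowQuot D := Equiv.addRight (Submodule.Quotient.mk Y)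
  refine Eq.trans (Finset.sum_congr rfl fun q _ => ?_) (e.sum_comp fun q => f (Quotient.out q))
  have : Quotient.out q + Y - Quotient.out (q + Submodule.Quotient.mk (p := rowLattice D) Y) ∈
      rowLattice D := by
    refine (Submodule.Quotient.eq _).1 ?_
    rw [Submodule.Quotient.mk_add]
    have h0 : Submodule.Quotient.mk (p := rowLattice D) (Quotient.out q) = q := Quotient.out_eq q
    rw [h0]
    exact (Quotient.out_eq _).symm
  obtain ⟨H, hH⟩ := this
  have hH' : H * Dᵀ = Quotient.out q + Y -
    Quotient.out (q + Submodule.Quotient.mk (p := rowLattice D) Y) := hH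
  change _ = f (Quotient.out (q + Submodule.Quotient.mk Y))
  rw [← hf (Quotient.out (q + Submodule.Quotient.mk Y)) H, hH', add_sub_cancel]

end Residues

/-! ### The transformation formula -/

section Transformation

variable {g : ℕ} {A B C D : Matrix (Fin g) (Fin g) ℤ} {S : Matrix (Fin 4) (Fin 4) ℤ}

/-- The phase `exp((πi/4) tr(S[G] B D⁻¹))`. -/
noncomputable def gaussPhase (S : Matrix (Fin 4) (Fin 4) ℤ) (B D : Matrix (Fin g) (Fin g) ℤ)
    (G : Matrix (Fin 4) (Fin g) ℤ) : ℂ :=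
  eChar (trace ((matR G)ᵀ * matR S * matR G * (matR B * (matR D)⁻¹)) / 8)

/-- The Gauss sum of `gaussPhase` over residues modulo `ℤ^{4×g} Dᵀ`. -/
noncomputable def gaussSum4 (S : Matrix (Fin 4) (Fin 4) ℤ) (B D : Matrix (Fin g) (Fin g) ℤ) : ℂ :=
  ∑' q : RowQuot D, gaussPhase S B D (Quotient.out q)

theorem eChar_eq_of_sub {s t : ℝ} (n : ℤ) (h : s - t = n) : eChar s = eChar t := by
  rw [← eChar_add_int t n, ← h, add_sub_cancel]

/-- `S[G + Y] = S[G] + S[Y] +` a cross term, under a trace against a symmetric matrix. -/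
theorem trace_quad_add {S : Matrix (Fin 4) (Fin 4) ℝ} (hS : Sᵀ = S)
    {R : Matrix (Fin g) (Fin g) ℝ} (hR : Rᵀ = R) (G Y : Matrix (Fin 4) (Fin g) ℝ) :
    trace ((G + Y)ᵀ * S * (G + Y) * R) =
      trace (Gᵀ * S * G * R) + trace (Yᵀ * S * Y * R) + 2 * trace (Gᵀ * (S * Y * R)) := by
  have e : trace (Yᵀ * S * G * R) = trace (Gᵀ * (S * Y * R)) := by
    rw [← trace_transpose]
    simp only [transpose_mul, transpose_transpose, hS, hR]
    rw [trace_mul_comm]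
    simp only [Matrix.mul_assoc]
  rw [transpose_add]
  simp only [Matrix.add_mul, Matrix.mul_add, trace_add]
  rw [e]
  simp only [Matrix.mul_assoc]
  ring

theorem gaussPhase_periodic (h : IgusaBlocks A B C D) (hS : Sᵀ = S)
    (G H : Matrix (Fin 4) (Fin g) ℤ) : gaussPhase S B D (G + H * Dᵀ) = gaussPhase S B D G := by
  have hu := h.isUnit_det
  have hSr : (matR S)ᵀ = matR S := by rw [← matR_transpose, hS]
  -- the cross term is `2 tr(Gᵀ S H Bᵀ)`, divisible by `8`
  have e1 : (matR (H * Dᵀ)) * (matR B * (matR D)⁻¹) = matR (H * Bᵀ) := by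
    have : (matR D)ᵀ * (matR B * (matR D)⁻¹) = (matR B)ᵀ := by
      rw [← Matrix.mul_assoc, ← matR_transpose, ← matR_mul, ← h.bd_symm, matR_mul,
        Matrix.mul_assoc, mul_nonsing_inv _ hu, Matrix.mul_one, matR_transpose]
    rw [matR_mul, Matrix.mul_assoc, matR_transpose, this, ← matR_transpose, ← matR_mul]
  obtain ⟨c1, hc1⟩ : (4 : ℤ) ∣ trace ((Gᵀ * S * H) * Bᵀ) :=
    dvd_trace_mul fun i j => h.dvd_b j i
  -- the quadratic term is `tr(S[H] Bᵀ D)`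
  obtain ⟨c2, hc2⟩ : (8 : ℤ) ∣ trace ((Hᵀ * S * H) * (Dᵀ * B)) := by
    refine eight_dvd_trace_mul ?_ ?_ (fun i j => dvd_mul_left_entries h.dvd_b _ i j) h.diag_bd
    · simp only [transpose_mul, transpose_transpose, hS, Matrix.mul_assoc]
    · rw [transpose_mul, transpose_transpose, h.bd_symm]
  refine eChar_eq_of_sub (c1 + c2) ?_
  rw [matR_add, trace_quad_add hSr h.transpose_b_mul_inv]
  have t1 : trace ((matR G)ᵀ * (matR S * matR (H * Dᵀ) * (matR B * (matR D)⁻¹))) =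
      ((trace ((Gᵀ * S * H) * Bᵀ) : ℤ) : ℝ) := by
    rw [Matrix.mul_assoc (matR S), e1, ← matR_transpose, ← matR_mul, ← matR_mul, matR_trace]
    simp only [Matrix.mul_assoc]
  have t2 : trace ((matR (H * Dᵀ))ᵀ * matR S * matR (H * Dᵀ) * (matR B * (matR D)⁻¹)) =
      ((trace ((Hᵀ * S * H) * (Dᵀ * B)) : ℤ) : ℝ) := by
    rw [Matrix.mul_assoc _ (matR (H * Dᵀ)), e1, ← matR_transpose, ← matR_mul, ← matR_mul,
      matR_trace, ← h.bd_symm, transpose_mul, transpose_transpose, Matrix.mul_assoc D,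
      Matrix.mul_assoc D, trace_mul_comm D]
    simp only [Matrix.mul_assoc]
  rw [t1, t2, hc1, hc2]
  push_cast
  ring

theorem thetaSeries_eq (S : Matrix (Fin 4) (Fin 4) ℤ) (V : Matrix (Fin 4) (Fin g) ℤ)
    (τ : Matrix (Fin g) (Fin g) ℂ) :
    thetaSeries 4 S V τ = ∑' G : Matrix (Fin 4) (Fin g) ℤ,
      eChar (trace ((matR G)ᵀ * matR V) / 4) * qExp (matR S) τ (matR G) := by
  refine tsum_congr fun G => ?_
  rw [eChar, qExp, ← Complex.exp_add, map_intCast_eq, map_intCast_eq, trace_add, trace_smul,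
    matC_trace (matR (Gᵀ * V)), matR_mul, matR_mul, matR_mul, matR_transpose]
  congr 1
  push_cast
  rw [smul_eq_mul]
  ring

theorem qExp_add_real (S : Matrix (Fin 4) (Fin 4) ℝ) (τ : Matrix (Fin g) (Fin g) ℂ)
    (P : Matrix (Fin g) (Fin g) ℝ) (X : Matrix (Fin 4) (Fin g) ℝ) :
    qExp S (τ + matC P) X = qExp S τ X * eChar (trace (Xᵀ * S * X * P) / 8) := by
  rw [qExp, qExp, eChar, ← Complex.exp_add, Matrix.mul_add, trace_add, ← matC_mul, matC_trace]
  congr 1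
  push_cast
  ring

theorem qExp_congr (S : Matrix (Fin 4) (Fin 4) ℝ) (τ : Matrix (Fin g) (Fin g) ℂ)
    (P : Matrix (Fin g) (Fin g) ℝ) (X : Matrix (Fin 4) (Fin g) ℝ) :
    qExp S ((matC P)ᵀ * τ * matC P) X = qExp S τ (X * Pᵀ) := by
  rw [qExp, qExp, ← Matrix.mul_assoc, trace_mul_comm]
  congr 3
  simp only [transpose_mul, transpose_transpose, matC_mul, matC_transpose, Matrix.mul_assoc]

/-- Integrality data carried by an isotropic matrix for `(S, 4)` when `16 S⁻¹` is integral. -/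
structure IsotropicData (S : Matrix (Fin 4) (Fin 4) ℤ) (V : Matrix (Fin 4) (Fin g) ℤ) where
  /-- The integral matrix `16 S⁻¹`. -/
  T : Matrix (Fin 4) (Fin 4) ℤ
  /-- The integral matrix `4 S⁻¹ V`. -/
  U : Matrix (Fin 4) (Fin g) ℤ
  /-- The integral matrix `Vᵀ S⁻¹ V`. -/
  P : Matrix (Fin g) (Fin g) ℤ
  hT : (16 : ℝ) • (matR S)⁻¹ = matR T
  hU : (4 : ℝ) • ((matR S)⁻¹ * matR V) = matR U
  hP : (matR V)ᵀ * (matR S)⁻¹ * matR V = matR P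

/-- Completing the square: with `L = 4K - V`, the inhomogeneous Gauss sum is the homogeneous one
times `exp((πi/4) tr(S⁻¹[L] D⁻¹ C))`. -/
theorem sum_gaussPhase_mul (h : IgusaBlocks A B C D) (hS : Sᵀ = S) (hdet : (matR S).det ≠ 0)
    {V : Matrix (Fin 4) (Fin g) ℤ} (d : IsotropicData S V) (K : Matrix (Fin 4) (Fin g) ℤ)
    [Fintype (RowQuot D)] :
    ∑ q : RowQuot D, gaussPhase S B D (Quotient.out q) *
        eChar (trace ((matR (Quotient.out q))ᵀ * matR V) / 4 +
          trace ((matR (Quotient.out q) * ((matR D)⁻¹)ᵀ)ᵀ * matR (4 • K - V)) / 4) =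
      gaussSum4 S B D * eChar (trace ((matR (4 • K - V))ᵀ * (matR S)⁻¹ * matR (4 • K - V) *
        ((matR D)⁻¹ * matR C)) / 8) := by
  have hu := h.isUnit_det
  have hSu : IsUnit (matR S).det := isUnit_iff_ne_zero.2 hdet
  have hSr : (matR S)ᵀ = matR S := by rw [← matR_transpose, hS]
  have hSi : ((matR S)⁻¹)ᵀ = (matR S)⁻¹ := by rw [transpose_nonsing_inv, hSr]
  set L : Matrix (Fin 4) (Fin g) ℤ := 4 • K - V with hL
  have hLr : matR L = (4 : ℝ) • matR K - matR V := by
    rw [hL, matR_sub]; ext i j; simp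
  set f : Matrix (Fin 4) (Fin g) ℤ → ℂ := fun G => gaussPhase S B D G *
    eChar (trace ((matR G)ᵀ * matR V) / 4 +
      trace ((matR G * ((matR D)⁻¹)ᵀ)ᵀ * matR L) / 4) with hf
  have hper : ∀ G H : Matrix (Fin 4) (Fin g) ℤ, f (G + H * Dᵀ) = f G := by
    intro G H
    simp only [hf]
    rw [gaussPhase_periodic h hS]
    congr 1
    obtain ⟨c, hc⟩ : (4 : ℤ) ∣ trace ((Hᵀ * V) * (D - 1)) := dvd_trace_mul h.dvd_d
    refine eChar_eq_of_sub (c + trace (Hᵀ * K)) ?_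
    have e1 : matR (G + H * Dᵀ) * ((matR D)⁻¹)ᵀ = matR G * ((matR D)⁻¹)ᵀ + matR H := by
      rw [matR_add, matR_mul, Matrix.add_mul, Matrix.mul_assoc (matR H), matR_transpose,
        ← transpose_mul, nonsing_inv_mul _ hu, transpose_one, Matrix.mul_one]
    have e2 : trace ((matR (H * Dᵀ))ᵀ * matR V) =
        ((trace ((Hᵀ * V) * (D - 1)) : ℤ) : ℝ) + trace ((matR H)ᵀ * matR V) := by
      rw [Matrix.mul_sub, trace_sub, Matrix.mul_one, ← matR_transpose, ← matR_transpose,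
        ← matR_mul, ← matR_mul, matR_trace, matR_trace, transpose_mul, transpose_transpose,
        Matrix.mul_assoc, trace_mul_comm D]
      push_cast
      ring
    have e3 : trace ((matR H)ᵀ * matR L) =
        4 * ((trace (Hᵀ * K) : ℤ) : ℝ) - trace ((matR H)ᵀ * matR V) := by
      rw [hLr, Matrix.mul_sub, Matrix.mul_smul, trace_sub, trace_smul, ← matR_trace, matR_mul,
        matR_transpose, smul_eq_mul]
    rw [e1, matR_add, transpose_add, transpose_add, Matrix.add_mul, Matrix.add_mul, trace_add,
      trace_add, e2, e3, hc]
    push_cast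
    ring
  -- the integral translate `Y = S⁻¹ L Cᵀ`
  have hc4 : ∀ i j, ∃ c, C i j = 4 * c := h.dvd_c
  choose c4 hc4 using hc4
  set C4 : Matrix (Fin g) (Fin g) ℤ := of c4
  have hC : C = (4 : ℤ) • C4 := by ext i j; simp [C4, hc4]
  have hCr : matR C = (4 : ℝ) • matR C4 := by rw [hC, matR_smul]; norm_num
  set Y : Matrix (Fin 4) (Fin g) ℤ := d.T * K * C4ᵀ - d.U * C4ᵀ with hYdef
  have hY : matR Y = (matR S)⁻¹ * matR L * (matR C)ᵀ := by
    rw [hYdef, matR_sub, matR_mul, matR_mul, matR_mul, ← d.hT, ← d.hU, hLr, hCr, transpose_smul,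
      matR_transpose]
    simp only [Matrix.mul_sub, Matrix.sub_mul, Matrix.mul_smul, Matrix.smul_mul, smul_sub,
      smul_smul, Matrix.mul_assoc]
    norm_num
  have hSY : matR S * matR Y = matR L * (matR C)ᵀ := by
    rw [hY, Matrix.mul_assoc, ← Matrix.mul_assoc, mul_nonsing_inv _ hSu, Matrix.one_mul]
  -- `W = S⁻¹[L]` and `Lᵀ S⁻¹ V` are integral
  set W : Matrix (Fin g) (Fin g) ℤ := Kᵀ * d.T * K - Kᵀ * d.U - d.Uᵀ * K + d.P with hWdef
  have hUt : (matR d.U)ᵀ = (4 : ℝ) • ((matR V)ᵀ * (matR S)⁻¹) := by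
    rw [← d.hU, transpose_smul, transpose_mul, hSi]
  have hW : matR W = (matR L)ᵀ * (matR S)⁻¹ * matR L := by
    rw [hWdef, matR_add, matR_sub, matR_sub, matR_mul, matR_mul, matR_mul, matR_mul, ← d.hT,
      ← d.hP, matR_transpose d.U, hUt, ← d.hU, hLr, transpose_sub, transpose_smul, matR_transpose]
    simp only [Matrix.mul_sub, Matrix.sub_mul, Matrix.mul_smul, Matrix.smul_mul, smul_sub,
      smul_smul, Matrix.mul_assoc]
    norm_num
    abel
  have hWs : Wᵀ = W := by
    have : (matR W)ᵀ = matR W := by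
      rw [hW]; simp only [transpose_mul, transpose_transpose, hSi, Matrix.mul_assoc]
    ext i j
    have := congrFun (congrFun this i) j
    simpa using this
  have hLV : (matR L)ᵀ * (matR S)⁻¹ * matR V = matR (Kᵀ * d.U - d.P) := by
    rw [matR_sub (Kᵀ * d.U), matR_mul, ← d.hU, ← d.hP, hLr, transpose_sub, transpose_smul,
      matR_transpose]
    simp only [Matrix.sub_mul, Matrix.mul_smul, Matrix.smul_mul, Matrix.mul_assoc]
  obtain ⟨c1, hc1⟩ : (8 : ℤ) ∣ trace (W * (Aᵀ * C)) :=
    eight_dvd_trace_mul hWs (by rw [transpose_mul, transpose_transpose, h.ac_symm])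
      (fun i j => dvd_mul_left_entries h.dvd_c _ i j) h.diag_ac
  obtain ⟨c2, hc2⟩ : (4 : ℤ) ∣ trace ((Kᵀ * d.U - d.P) * C) := dvd_trace_mul h.dvd_c
  clear_value W Y
  have key : ∀ G : Matrix (Fin 4) (Fin g) ℤ, f (G + Y) = gaussPhase S B D G *
      eChar (trace ((matR L)ᵀ * (matR S)⁻¹ * matR L * ((matR D)⁻¹ * matR C)) / 8) := by
    intro G
    obtain ⟨c3, hc3⟩ : (4 : ℤ) ∣ trace ((Gᵀ * V) * (A - 1)ᵀ) :=
      dvd_trace_mul fun i j => by rw [transpose_apply]; exact h.dvd_a j i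
    simp only [hf]
    rw [gaussPhase, gaussPhase, ← eChar_add, ← eChar_add]
    refine eChar_eq_of_sub (trace (Gᵀ * K * Aᵀ) - c3 + c1 + c2) ?_
    rw [matR_add, trace_quad_add hSr h.transpose_b_mul_inv]
    have t1 : matR S * matR Y * (matR B * (matR D)⁻¹) =
        matR L * (matR A)ᵀ - matR L * (matR D)⁻¹ := by
      rw [hSY, Matrix.mul_assoc, h.transpose_c_mul_b, Matrix.mul_sub]
    have t2 : trace ((matR Y)ᵀ * matR S * matR Y * (matR B * (matR D)⁻¹)) =
        ((trace (W * (Aᵀ * C)) : ℤ) : ℝ) - trace (matR W * ((matR D)⁻¹ * matR C)) := by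
      rw [Matrix.mul_assoc _ (matR S), Matrix.mul_assoc, t1, hY, transpose_mul, transpose_mul,
        transpose_transpose, hSi, Matrix.mul_assoc, trace_mul_comm, ← Matrix.mul_sub,
        ← Matrix.mul_assoc, ← hW, Matrix.mul_assoc, Matrix.sub_mul, Matrix.mul_sub, trace_sub,
        ← matR_trace, matR_mul, matR_mul, matR_transpose]
    have t3 : trace ((matR Y * ((matR D)⁻¹)ᵀ)ᵀ * matR L) =
        trace (matR W * ((matR D)⁻¹ * matR C)) := by
      rw [transpose_mul, transpose_transpose, hY, transpose_mul, transpose_mul,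
        transpose_transpose, hSi, hW, trace_mul_comm (_ * matR L)]
      simp only [Matrix.mul_assoc]
    have t4 : trace ((matR Y)ᵀ * matR V) = ((trace ((Kᵀ * d.U - d.P) * C) : ℤ) : ℝ) := by
      rw [hY, transpose_mul, transpose_mul, transpose_transpose, hSi, Matrix.mul_assoc, hLV,
        trace_mul_comm, ← matR_mul, matR_trace]
    have t5 : trace ((matR G * ((matR D)⁻¹)ᵀ)ᵀ * matR L) =
        trace ((matR G)ᵀ * (matR L * (matR D)⁻¹)) := by
      rw [transpose_mul, transpose_transpose, Matrix.mul_assoc, trace_mul_comm, Matrix.mul_assoc]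
    have t6 : trace ((matR G)ᵀ * (matR L * (matR A)ᵀ)) =
        4 * ((trace (Gᵀ * K * Aᵀ) : ℤ) : ℝ) - ((trace ((Gᵀ * V) * (A - 1)ᵀ) : ℤ) : ℝ) -
          trace ((matR G)ᵀ * matR V) := by
      rw [hLr, ← matR_trace, ← matR_trace, transpose_sub, transpose_one, Matrix.mul_sub,
        Matrix.mul_one, matR_sub, trace_sub]
      simp only [matR_mul, matR_transpose, Matrix.sub_mul, Matrix.mul_sub, trace_sub,
        Matrix.smul_mul, Matrix.mul_smul, trace_smul, smul_eq_mul, Matrix.mul_assoc]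
      ring
    rw [t2, Matrix.add_mul, transpose_add, transpose_add, Matrix.add_mul, Matrix.add_mul,
      trace_add, trace_add, t3, t4, t5, t1, Matrix.mul_sub, trace_sub, t6, hc1, hc2, hc3, hW]
    push_cast
    ring
  rw [← sum_out_add f hper Y]
  simp only [key]
  rw [← Finset.sum_mul, gaussSum4, tsum_fintype]

/-- **Transformation formula** for `ϑ_{S,V}`, with the multiplier as a normalised Gauss sum. -/
theorem thetaSeries_siegelAct {M : symplecticGroup (Fin g) ℤ}
    (h : IgusaBlocks (blockA M) (blockB M) (blockC M) (blockD M)) (hS : (matR S).PosDef)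
    {V : Matrix (Fin 4) (Fin g) ℤ} (d : IsotropicData S V)
    {τ : Matrix (Fin g) (Fin g) ℂ} (hτ : τ ∈ siegelHalfSpace g) :
    thetaSeries 4 S V (siegelAct M τ) =
      gaussSum4 S (blockB M) (blockD M) / ((blockD M).det : ℂ) ^ 2 * (siegelDenom M τ).det ^ 2 *
        thetaSeries 4 S V τ := by
  set B := blockB M
  set C := blockC M
  set D := blockD M with hDdef
  have hD := h.det_ne_zero
  have hu := h.isUnit_det
  have hSs : Sᵀ = S := by
    have := hS.1
    rw [IsHermitian, conjTranspose_eq_transpose_of_trivial] at this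
    ext i j
    have := congrFun (congrFun this i) j
    simpa using this
  have hdet : (matR S).det ≠ 0 := hS.det_pos.ne'
  have := finite_rowQuot hD
  let _ := Fintype.ofFinite (RowQuot D)
  have hshift := siegelShift_mem h hτ
  obtain ⟨κ, hinv⟩ := theta_inversion hS g
  set t := siegelShift C D τ with ht
  set X : RowQuot D → Matrix (Fin 4) (Fin g) ℝ :=
    fun q => matR (Quotient.out q) * ((matR D)⁻¹)ᵀ with hX
  set a : RowQuot D → ℂ := fun q => gaussPhase S B D (Quotient.out q) *
    eChar (trace ((matR (Quotient.out q))ᵀ * matR V) / 4 - trace ((X q)ᵀ * matR V) / 4) with ha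
  have hLr : ∀ K : Matrix (Fin 4) (Fin g) ℤ, (4 : ℝ) • matR K - matR V = matR (4 • K - V) :=
    fun K => by rw [matR_sub]; ext i j; simp
  -- splitting the summation over residue classes
  have hterm : ∀ (q : RowQuot D) (H : Matrix (Fin 4) (Fin g) ℤ),
      eChar (trace ((matR (Quotient.out q + H * Dᵀ))ᵀ * matR V) / 4) *
        qExp (matR S) (siegelAct M τ) (matR (Quotient.out q + H * Dᵀ)) =
      a q * (eChar (trace ((X q + matR H)ᵀ * matR V) / 4) * qExp (matR S) t (X q + matR H)) := by
    intro q H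
    have e1 : matR (Quotient.out q + H * Dᵀ) * ((matR D)⁻¹)ᵀ = X q + matR H := by
      rw [matR_add, matR_mul, Matrix.add_mul, Matrix.mul_assoc (matR H), matR_transpose,
        ← transpose_mul, nonsing_inv_mul _ hu, transpose_one, Matrix.mul_one]
    rw [siegelAct_eq h hτ, qExp_add_real, qExp_congr, e1]
    have e2 : eChar (trace ((matR (Quotient.out q + H * Dᵀ))ᵀ * matR S *
        matR (Quotient.out q + H * Dᵀ) * (matR B * (matR D)⁻¹)) / 8) =
        gaussPhase S B D (Quotient.out q) := gaussPhase_periodic h hSs _ H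
    rw [e2, ha]
    have e3 : eChar (trace ((matR (Quotient.out q + H * Dᵀ))ᵀ * matR V) / 4) =
        eChar (trace ((matR (Quotient.out q))ᵀ * matR V) / 4 - trace ((X q)ᵀ * matR V) / 4) *
          eChar (trace ((X q + matR H)ᵀ * matR V) / 4) := by
      rw [← eChar_add]
      obtain ⟨c, hc⟩ : (4 : ℤ) ∣ trace ((Hᵀ * V) * (D - 1)) := dvd_trace_mul h.dvd_d
      refine eChar_eq_of_sub c ?_
      have e : trace ((matR (H * Dᵀ))ᵀ * matR V) =
          ((trace ((Hᵀ * V) * (D - 1)) : ℤ) : ℝ) + trace ((matR H)ᵀ * matR V) := by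
        rw [Matrix.mul_sub, trace_sub, Matrix.mul_one, ← matR_transpose, ← matR_transpose,
          ← matR_mul, ← matR_mul, matR_trace, matR_trace, transpose_mul, transpose_transpose,
          Matrix.mul_assoc, trace_mul_comm D]
        push_cast
        ring
      rw [matR_add, transpose_add, transpose_add, Matrix.add_mul, Matrix.add_mul, trace_add,
        trace_add, e, hc]
      push_cast
      ring
    rw [e3]
    ring
  have hsum : Summable fun G : Matrix (Fin 4) (Fin g) ℤ =>
      eChar (trace ((matR G)ᵀ * matR V) / 4) * qExp (matR S) (siegelAct M τ) (matR G) := by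
    refine Summable.of_norm ?_
    have := (summable_qExp hS (siegelAct_mem h hτ) 0 one_pos).norm
    refine this.congr fun G => ?_
    rw [norm_mul, norm_eChar, one_mul, one_smul, zero_add]
  have hdual : ∀ q, Summable fun K : Matrix (Fin 4) (Fin g) ℤ =>
      a q * (qExp (matR S)⁻¹ (-t⁻¹) ((4 : ℝ) • matR K - matR V) *
        eChar (trace ((X q)ᵀ * matR K))) := by
    intro q
    refine Summable.mul_left _ (Summable.of_norm ?_)
    have := (summable_qExp hS.inv (siegelHalfSpace_neg_inv hshift) (-((1 / 4 : ℝ) • matR V))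
      (c := 4) (by norm_num)).norm
    refine this.congr fun K => ?_
    rw [norm_mul, norm_eChar, mul_one]
    congr 2
    rw [smul_add, smul_neg, smul_smul]
    norm_num
    abel
  have step1 : thetaSeries 4 S V (siegelAct M τ) =
      κ * (t.det ^ 2)⁻¹ * ∑' K : Matrix (Fin 4) (Fin g) ℤ, ∑ q, a q *
        (qExp (matR S)⁻¹ (-t⁻¹) ((4 : ℝ) • matR K - matR V) *
          eChar (trace ((X q)ᵀ * matR K))) := by
    have hs : Summable fun p : RowQuot D × Matrix (Fin 4) (Fin g) ℤ =>
        eChar (trace ((matR (residueEquiv hD p))ᵀ * matR V) / 4) *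
          qExp (matR S) (siegelAct M τ) (matR (residueEquiv hD p)) :=
      (residueEquiv hD).summable_iff.2 hsum
    rw [thetaSeries_eq, ← (residueEquiv hD).tsum_eq, hs.tsum_prod, tsum_fintype,
      Summable.tsum_finsetSum fun q _ => hdual q, Finset.mul_sum]
    refine Finset.sum_congr rfl fun q _ => ?_
    simp only [residueEquiv_apply, hterm]
    rw [tsum_mul_left, hinv t hshift, tsum_mul_left]
    ring
  have step2 : ∀ K : Matrix (Fin 4) (Fin g) ℤ, ∑ q, a q *
        (qExp (matR S)⁻¹ (-t⁻¹) ((4 : ℝ) • matR K - matR V) *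
          eChar (trace ((X q)ᵀ * matR K))) =
      gaussSum4 S B D * qExp (matR S)⁻¹ (-τ⁻¹) ((4 : ℝ) • matR K - matR V) := by
    intro K
    have hG := sum_gaussPhase_mul h hSs hdet d K
    have e1 : ∀ q, a q * (qExp (matR S)⁻¹ (-t⁻¹) ((4 : ℝ) • matR K - matR V) *
          eChar (trace ((X q)ᵀ * matR K))) =
        qExp (matR S)⁻¹ (-t⁻¹) ((4 : ℝ) • matR K - matR V) *
          (gaussPhase S B D (Quotient.out q) *
            eChar (trace ((matR (Quotient.out q))ᵀ * matR V) / 4 +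
              trace ((X q)ᵀ * matR (4 • K - V)) / 4)) := by
      intro q
      have : trace ((matR (Quotient.out q))ᵀ * matR V) / 4 +
              trace ((X q)ᵀ * matR (4 • K - V)) / 4 =
          (trace ((matR (Quotient.out q))ᵀ * matR V) / 4 - trace ((X q)ᵀ * matR V) / 4) +
            trace ((X q)ᵀ * matR K) := by
        rw [← hLr, Matrix.mul_sub, trace_sub, Matrix.mul_smul, trace_smul, smul_eq_mul]
        ring
      rw [this, eChar_add, ha]
      ring
    rw [Finset.sum_congr rfl fun q _ => e1 q, ← Finset.mul_sum, hG, ht, neg_siegelShift_inv h hτ,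
      qExp_add_real, hLr]
    rw [Matrix.mul_neg, trace_neg, neg_div]
    set θ := trace ((matR (4 • K - V))ᵀ * (matR S)⁻¹ * matR (4 • K - V) *
      ((matR D)⁻¹ * matR C)) / 8
    have : eChar (-θ) * eChar θ = 1 := by rw [← eChar_add, neg_add_cancel, eChar_zero]
    linear_combination (qExp (matR S)⁻¹ (-τ⁻¹) (matR (4 • K - V)) * gaussSum4 S B D) * this
  have step3 : thetaSeries 4 S V τ = κ * (τ.det ^ 2)⁻¹ * ∑' K : Matrix (Fin 4) (Fin g) ℤ,
      qExp (matR S)⁻¹ (-τ⁻¹) ((4 : ℝ) • matR K - matR V) := by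
    have := hinv τ hτ 0 (matR V)
    simp only [zero_add, transpose_zero, Matrix.zero_mul, trace_zero, eChar_zero, mul_one] at this
    rw [thetaSeries_eq, this]
  have hdt : t.det ≠ 0 := siegelHalfSpace_det_ne_zero hshift
  have hdτ : τ.det ≠ 0 := siegelHalfSpace_det_ne_zero hτ
  have hDc : (D.det : ℂ) ≠ 0 := by exact_mod_cast hD
  have hden : (siegelDenom M τ).det = D.det * (t.det)⁻¹ * τ.det := by
    rw [siegelDenom_eq h hτ, det_mul, det_mul, matC_det, matR_det, det_nonsing_inv,
      Ring.inverse_eq_inv', Complex.ofReal_intCast]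
  rw [step1, step3, hden, tsum_congr step2, tsum_mul_left]
  field_simp

end Transformation

/-! ### Quaternary symmetric matrices modulo an odd number -/

section NormalForm

/-- The property of a ring `R` that every symmetric `4 × 4` matrix over `R` with unit determinant
`d` is congruent to `diag(1, 1, 1, d)`. -/
def HasDiagNormalForm (R : Type*) [CommRing R] : Prop :=
  ∀ S : Matrix (Fin 4) (Fin 4) R, Sᵀ = S → IsUnit S.det →
    ∃ P : Matrix (Fin 4) (Fin 4) R, IsUnit P.det ∧ Pᵀ * S * P = diagonal ![1, 1, 1, S.det]

theorem det_diagonal_four {R : Type*} [CommRing R] (a b c d : R) :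
    (diagonal ![a, b, c, d]).det = a * b * c * d := by
  rw [det_diagonal]; simp [Fin.prod_univ_four]

/-- The last diagonal entry may be rescaled by a unit square, so it suffices to reach some
`diag(1, 1, 1, d)`. -/
theorem exists_diagNormalForm_of_exists {R : Type*} [CommRing R] {S : Matrix (Fin 4) (Fin 4) R}
    (h : ∃ (P : Matrix (Fin 4) (Fin 4) R) (d : R), IsUnit P.det ∧
      Pᵀ * S * P = diagonal ![1, 1, 1, d]) :
    ∃ P : Matrix (Fin 4) (Fin 4) R, IsUnit P.det ∧ Pᵀ * S * P = diagonal ![1, 1, 1, S.det] := by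
  obtain ⟨P, d, ⟨u, hu⟩, hP⟩ := h
  have hd : d = S.det * P.det ^ 2 := by
    have := congrArg det hP
    rw [det_mul, det_mul, det_transpose, det_diagonal_four] at this
    linear_combination -this
  refine ⟨P * diagonal ![1, 1, 1, ((u⁻¹ : Rˣ) : R)], ?_, ?_⟩
  · rw [det_mul, det_diagonal_four, ← hu]
    simp
  · have e : (P * diagonal ![1, 1, 1, ((u⁻¹ : Rˣ) : R)])ᵀ * S *
        (P * diagonal ![1, 1, 1, ((u⁻¹ : Rˣ) : R)]) =
        diagonal ![1, 1, 1, ((u⁻¹ : Rˣ) : R)] * (Pᵀ * S * P) *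
          diagonal ![1, 1, 1, ((u⁻¹ : Rˣ) : R)] := by
      rw [transpose_mul, diagonal_transpose]
      simp only [Matrix.mul_assoc]
    rw [e, hP, diagonal_mul_diagonal, diagonal_mul_diagonal]
    congr 1
    funext i
    have hu' : ((u⁻¹ : Rˣ) : R) * u = 1 := u.inv_mul
    fin_cases i <;> simp
    rw [hd, ← hu]
    linear_combination S.det * (((u⁻¹ : Rˣ) : R) * u + 1) * hu'

/-- A Newton step: a congruence between symmetric matrices modulo `c` improves to one modulo
`c ^ 2`. -/
theorem exists_congr_mod_sq {n : Type*} [Fintype n] [DecidableEq n] {R : Type*} [CommRing R]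
    (h2 : IsUnit (2 : R)) {c : R} (hc : IsNilpotent c) {S T Y : Matrix n n R} (hS : Sᵀ = S)
    (hT : Tᵀ = T) (hdet : IsUnit S.det) (h : S = T + c • Y) :
    ∃ Q Y' : Matrix n n R, IsUnit Q.det ∧ Qᵀ * S * Q = T + c ^ 2 • Y' := by
  obtain ⟨v, hv⟩ := h2
  set w : R := ((v⁻¹ : Rˣ) : R) with hw
  have hw2 : 2 * w = 1 := by rw [← hv]; exact v.mul_inv
  have hSi : (S⁻¹)ᵀ = S⁻¹ := by rw [transpose_nonsing_inv, hS]
  have hX : T - S = -(c • Y) := by rw [h]; abel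
  have hXt : (T - S)ᵀ = T - S := by rw [transpose_sub, hS, hT]
  set X := T - S with hXdef
  have hST : T = S + X := by rw [hXdef]; abel
  -- `S[1 + S⁻¹ X / 2] = S + X + S⁻¹[X] / 4`
  refine ⟨1 + w • (S⁻¹ * X), w ^ 2 • (Y * S⁻¹ * Y), ?_, ?_⟩
  · rw [← isUnit_iff_isUnit_det]
    have e : w • (S⁻¹ * X) = c • (-(w • (S⁻¹ * Y))) := by
      rw [hX, Matrix.mul_neg, Matrix.mul_smul, smul_neg, smul_neg, smul_comm]
    rw [e]
    apply IsNilpotent.isUnit_one_add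
    obtain ⟨k, hk⟩ := hc
    exact ⟨k, by rw [smul_pow, hk, zero_smul]⟩
  · have e1 : c ^ 2 • w ^ 2 • (Y * S⁻¹ * Y) = w ^ 2 • (X * S⁻¹ * X) := by
      rw [hX, Matrix.neg_mul, Matrix.mul_neg, Matrix.neg_mul, neg_neg, Matrix.smul_mul,
        Matrix.smul_mul, Matrix.mul_smul, smul_smul, smul_smul, smul_smul]
      congr 1
      ring
    have a1 : S * (S⁻¹ * X) = X := by
      rw [← Matrix.mul_assoc, mul_nonsing_inv _ hdet, Matrix.one_mul]
    have a2 : X * S⁻¹ * S = X := by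
      rw [Matrix.mul_assoc, nonsing_inv_mul _ hdet, Matrix.mul_one]
    rw [e1, transpose_add, transpose_one, transpose_smul, transpose_mul, hSi, hXt, Matrix.add_mul,
      Matrix.one_mul, Matrix.smul_mul, a2, Matrix.mul_add, Matrix.mul_one, Matrix.add_mul,
      Matrix.mul_smul, a1, Matrix.smul_mul, Matrix.mul_smul, ← Matrix.mul_assoc, smul_smul, hST]
    have e2 : w • X + w • X = X := by rw [← add_smul, ← two_mul, hw2, one_smul]
    rw [sq]
    calc _ = S + (w • X + w • X) + (w * w) • (X * S⁻¹ * X) := by abel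
      _ = _ := by rw [e2]

/-- Congruent modulo a nilpotent element implies congruent. -/
theorem exists_congr_of_nilpotent {n : Type*} [Fintype n] [DecidableEq n] {R : Type*} [CommRing R]
    (h2 : IsUnit (2 : R)) {T : Matrix n n R} (hT : Tᵀ = T) (k : ℕ) :
    ∀ {c : R} {S Y : Matrix n n R}, c ^ 2 ^ k = 0 → Sᵀ = S → IsUnit S.det → S = T + c • Y →
      ∃ Q : Matrix n n R, IsUnit Q.det ∧ Qᵀ * S * Q = T := by
  induction k with
  | zero =>
    intro c S Y hc hS hdet h
    rw [pow_zero, pow_one] at hc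
    exact ⟨1, by simp, by simp [h, hc]⟩
  | succ k ih =>
    intro c S Y hc hS hdet h
    obtain ⟨Q, Y', hQ, hY'⟩ := exists_congr_mod_sq h2 ⟨_, hc⟩ hS hT hdet h
    obtain ⟨Q', hQ', e⟩ := ih (c := c ^ 2) (S := Qᵀ * S * Q) (Y := Y')
      (by rw [← pow_mul, ← pow_succ', hc])
      (by simp only [transpose_mul, transpose_transpose, hS, Matrix.mul_assoc])
      (by rw [det_mul, det_mul, det_transpose]; exact (hQ.mul hdet).mul hQ) hY'
    refine ⟨Q * Q', by rw [det_mul]; exact hQ.mul hQ', ?_⟩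
    rw [← e, transpose_mul]
    simp only [Matrix.mul_assoc]

/-- A binary quadratic form over a finite field represents `1`. -/
theorem exists_sq_add_sq_eq_one {p : ℕ} [Fact p.Prime] (hp : p ≠ 2) {a b : ZMod p} (ha : a ≠ 0)
    (hb : b ≠ 0) : ∃ x y : ZMod p, a * x ^ 2 + b * y ^ 2 = 1 := by
  open Polynomial in
  obtain ⟨x, y, h⟩ := FiniteField.exists_root_sum_quadratic (R := ZMod p)
    (f := C a * X ^ 2) (g := C b * X ^ 2 + C 0 * X + C (-1)) (degree_C_mul_X_pow 2 ha)
    (degree_quadratic hb) (by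
      rw [ZMod.card]
      exact (Fact.out : p.Prime).eq_two_or_odd.resolve_left hp)
  refine ⟨x, y, ?_⟩
  simp only [eval_add, eval_mul, eval_C, eval_pow, eval_X] at h
  linear_combination h

/-- If `a x² + b y² = 1`, then `diag(a, b)` is congruent to `diag(1, a b)`, here in the first two
of four coordinates. -/
theorem exists_congr_diagonal_zero_one {R : Type*} [CommRing R] {a b x y : R} (c d : R)
    (h : a * x ^ 2 + b * y ^ 2 = 1) : ∃ P : Matrix (Fin 4) (Fin 4) R, P.det = 1 ∧
      Pᵀ * diagonal ![a, b, c, d] * P = diagonal ![1, a * b, c, d] := by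
  refine ⟨!![x, -(b * y), 0, 0; y, a * x, 0, 0; 0, 0, 1, 0; 0, 0, 0, 1], ?_, ?_⟩
  · simp [det_succ_row_zero, Fin.sum_univ_succ, Fin.succAbove]
    linear_combination h
  · ext i j
    fin_cases i <;> fin_cases j <;> simp [mul_apply, Fin.sum_univ_four, diagonal_apply]
    · linear_combination h
    · ring
    · ring
    · linear_combination a * b * h

theorem exists_congr_diagonal_one_two {R : Type*} [CommRing R] {a b x y : R} (c d : R)
    (h : a * x ^ 2 + b * y ^ 2 = 1) : ∃ P : Matrix (Fin 4) (Fin 4) R, P.det = 1 ∧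
      Pᵀ * diagonal ![c, a, b, d] * P = diagonal ![c, 1, a * b, d] := by
  refine ⟨!![1, 0, 0, 0; 0, x, -(b * y), 0; 0, y, a * x, 0; 0, 0, 0, 1], ?_, ?_⟩
  · simp [det_succ_row_zero, Fin.sum_univ_succ, Fin.succAbove]
    linear_combination h
  · ext i j
    fin_cases i <;> fin_cases j <;> simp [mul_apply, Fin.sum_univ_four, diagonal_apply]
    · linear_combination h
    · ring
    · ring
    · linear_combination a * b * h

theorem exists_congr_diagonal_two_three {R : Type*} [CommRing R] {a b x y : R} (c d : R)
    (h : a * x ^ 2 + b * y ^ 2 = 1) : ∃ P : Matrix (Fin 4) (Fin 4) R, P.det = 1 ∧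
      Pᵀ * diagonal ![c, d, a, b] * P = diagonal ![c, d, 1, a * b] := by
  refine ⟨!![1, 0, 0, 0; 0, 1, 0, 0; 0, 0, x, -(b * y); 0, 0, y, a * x], ?_, ?_⟩
  · simp [det_succ_row_zero, Fin.sum_univ_succ, Fin.succAbove]
    linear_combination h
  · ext i j
    fin_cases i <;> fin_cases j <;> simp [mul_apply, Fin.sum_univ_four, diagonal_apply]
    · linear_combination h
    · ring
    · ring
    · linear_combination a * b * h

theorem hasDiagNormalForm_zmod_prime {p : ℕ} [Fact p.Prime] (hp : p ≠ 2) :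
    HasDiagNormalForm (ZMod p) := by
  intro S hS hdet
  apply exists_diagNormalForm_of_exists
  have h2 : (2 : ZMod p) ≠ 0 := by
    have : ((2 : ℕ) : ZMod p) ≠ 0 := fun h => by
      rw [ZMod.natCast_eq_zero_iff] at h
      exact hp ((Nat.prime_dvd_prime_iff_eq Fact.out Nat.prime_two).1 h)
    exact_mod_cast this
  let _ : Invertible (2 : ZMod p) := invertibleOfNonzero h2
  -- an orthogonal basis
  obtain ⟨w, P, hP, hw⟩ : ∃ (w : Fin 4 → ZMod p) (P : Matrix (Fin 4) (Fin 4) (ZMod p)),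
      IsUnit P.det ∧ Pᵀ * S * P = diagonal w := by
    have hsymm : LinearMap.IsSymm (toBilin' S) := ⟨fun x y => by
      rw [RingHom.id_apply, toBilin'_apply', toBilin'_apply', dotProduct_mulVec, ← mulVec_transpose,
        hS, dotProduct_comm]⟩
    obtain ⟨v, hv⟩ := LinearMap.BilinForm.exists_orthogonal_basis hsymm
    have hfr : Module.finrank (ZMod p) (Fin 4 → ZMod p) = 4 := by simp
    let v' : Module.Basis (Fin 4) (ZMod p) (Fin 4 → ZMod p) := v.reindex (finCongr hfr)
    have hv' : ∀ i j, i ≠ j → toBilin' S (v' i) (v' j) = 0 := fun i j hij => by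
      simp only [v', Module.Basis.reindex_apply]
      exact hv (fun h => hij ((finCongr hfr).symm.injective h))
    set P : Matrix (Fin 4) (Fin 4) (ZMod p) := (Pi.basisFun (ZMod p) (Fin 4)).toMatrix v' with hPdef
    have hPS : ∀ i j, (Pᵀ * S * P) i j = toBilin' S (v' i) (v' j) := fun i j => by
      rw [toBilin'_apply', Matrix.mul_assoc]
      rfl
    refine ⟨fun i => toBilin' S (v' i) (v' i), P, ?_, ?_⟩
    · exact (Pi.basisFun (ZMod p) (Fin 4)).isUnit_det v'
    · ext i j
      by_cases hij : i = j
      · subst hij; rw [hPS, diagonal_apply_eq]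
      · rw [hPS, diagonal_apply_ne _ hij, hv' i j hij]
  have hw0 : ∀ i, w i ≠ 0 := by
    have : (∏ i, w i) ≠ 0 := by
      rw [← det_diagonal, ← hw, det_mul, det_mul, det_transpose]
      exact ((hP.mul hdet).mul hP).ne_zero
    exact fun i => Finset.prod_ne_zero_iff.1 this i (Finset.mem_univ i)
  -- `diag(a, b)` is congruent to `diag(1, a b)`; three such moves
  obtain ⟨x, y, h1⟩ := exists_sq_add_sq_eq_one hp (hw0 0) (hw0 1)
  obtain ⟨z, t, h2⟩ := exists_sq_add_sq_eq_one hp (mul_ne_zero (hw0 0) (hw0 1)) (hw0 2)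
  obtain ⟨r, s, h3⟩ := exists_sq_add_sq_eq_one hp
    (mul_ne_zero (mul_ne_zero (hw0 0) (hw0 1)) (hw0 2)) (hw0 3)
  have hwe : w = ![w 0, w 1, w 2, w 3] := by funext i; fin_cases i <;> rfl
  obtain ⟨P₁, d₁, e₁⟩ := exists_congr_diagonal_zero_one (w 2) (w 3) h1
  obtain ⟨P₂, d₂, e₂⟩ := exists_congr_diagonal_one_two 1 (w 3) h2
  obtain ⟨P₃, d₃, e₃⟩ := exists_congr_diagonal_two_three 1 1 h3
  refine ⟨P * P₁ * P₂ * P₃, w 0 * w 1 * w 2 * w 3, ?_, ?_⟩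
  · rw [det_mul, det_mul, det_mul, d₁, d₂, d₃, mul_one, mul_one, mul_one]
    exact hP
  · rw [← e₃, ← e₂, ← e₁, ← hwe, ← hw]
    simp only [transpose_mul, Matrix.mul_assoc]

/-- Units lift along a surjection with nilpotent kernel. -/
theorem isUnit_of_map_isUnit {R K : Type*} [CommRing R] [CommRing K] {π : R →+* K}
    (hπ : Function.Surjective π) {c : R} (hc : IsNilpotent c) (hker : ∀ x, π x = 0 → c ∣ x) {x : R}
    (hx : IsUnit (π x)) : IsUnit x := by
  obtain ⟨u, hu⟩ := hx
  obtain ⟨y, hy⟩ := hπ ((u⁻¹ : Kˣ) : K)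
  obtain ⟨z, hz⟩ := hker (x * y - 1) (by rw [map_sub, map_mul, hy, ← hu, map_one]; simp)
  have hn : IsNilpotent (c * z) := (Commute.all c z).isNilpotent_mul_right hc
  have hxy : x * y = 1 + c * z := by rw [← hz]; ring
  exact isUnit_of_mul_isUnit_left (hxy ▸ hn.isUnit_one_add)

theorem map_diagonal_four {R K : Type*} [CommRing R] [CommRing K] (f : R →+* K) (a b c d : R) :
    (diagonal ![a, b, c, d]).map f = diagonal ![f a, f b, f c, f d] := by
  rw [diagonal_map (map_zero f)]
  congr 1
  funext i
  fin_cases i <;> rfl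

/-- The normal form lifts along a surjection with nilpotent kernel. -/
theorem HasDiagNormalForm.of_surjective {R K : Type*} [CommRing R] [CommRing K] {π : R →+* K}
    (hπ : Function.Surjective π) (h2 : IsUnit (2 : R)) {c : R} {k : ℕ} (hc : c ^ 2 ^ k = 0)
    (hker : ∀ x, π x = 0 → c ∣ x) (hK : HasDiagNormalForm K) : HasDiagNormalForm R := by
  intro S hS hdet
  apply exists_diagNormalForm_of_exists
  obtain ⟨P₀, hP₀, e₀⟩ := hK (S.map π) (by rw [← transpose_map, hS])
    (by have := hdet.map π; rwa [RingHom.map_det] at this)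
  choose s hs using hπ
  set P : Matrix (Fin 4) (Fin 4) R := P₀.map s with hPdef
  have hPm : P.map π = P₀ := by ext i j; simp [hPdef, hs]
  have hPdet : IsUnit P.det := by
    refine isUnit_of_map_isUnit (fun y => ⟨s y, hs y⟩) ⟨_, hc⟩ hker ?_
    rw [RingHom.map_det, RingHom.mapMatrix_apply, hPm]
    exact hP₀
  set T : Matrix (Fin 4) (Fin 4) R := diagonal ![1, 1, 1, S.det] with hT
  have hmap : (Pᵀ * S * P).map π = T.map π := by
    rw [Matrix.map_mul, Matrix.map_mul, transpose_map, hPm, e₀, hT, map_diagonal_four, map_one,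
      RingHom.map_det]
    rfl
  have hY : ∀ i j, ∃ y, (Pᵀ * S * P) i j = T i j + c * y := fun i j => by
    obtain ⟨y, hy⟩ := hker ((Pᵀ * S * P) i j - T i j) (by
      rw [map_sub, sub_eq_zero]
      exact congrFun (congrFun hmap i) j)
    exact ⟨y, by rw [← hy]; ring⟩
  choose Y hY using hY
  obtain ⟨Q, hQ, e⟩ := exists_congr_of_nilpotent h2 (T := T) (by rw [hT, diagonal_transpose]) k
    (c := c) (S := Pᵀ * S * P) (Y := of Y) hc
    (by simp only [transpose_mul, transpose_transpose, hS, Matrix.mul_assoc])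
    (by rw [det_mul, det_mul, det_transpose]; exact (hPdet.mul hdet).mul hPdet)
    (by ext i j; simp [hY])
  refine ⟨P * Q, S.det, by rw [det_mul]; exact hPdet.mul hQ, ?_⟩
  rw [← hT, ← e, transpose_mul]
  simp only [Matrix.mul_assoc]

theorem HasDiagNormalForm.of_equiv_prod {R R₁ R₂ : Type*} [CommRing R] [CommRing R₁] [CommRing R₂]
    (e : R ≃+* R₁ × R₂) (h₁ : HasDiagNormalForm R₁) (h₂ : HasDiagNormalForm R₂) :
    HasDiagNormalForm R := by
  intro S hS hdet
  set f₁ : R →+* R₁ := (RingHom.fst R₁ R₂).comp e with hf₁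
  set f₂ : R →+* R₂ := (RingHom.snd R₁ R₂).comp e with hf₂
  have hinj : ∀ x y, f₁ x = f₁ y → f₂ x = f₂ y → x = y := fun x y h h' =>
    e.injective (Prod.ext h h')
  obtain ⟨P₁, hP₁, e₁⟩ := h₁ (S.map f₁) (by rw [← transpose_map, hS])
    (by have := hdet.map f₁; rwa [RingHom.map_det] at this)
  obtain ⟨P₂, hP₂, e₂⟩ := h₂ (S.map f₂) (by rw [← transpose_map, hS])
    (by have := hdet.map f₂; rwa [RingHom.map_det] at this)
  set P : Matrix (Fin 4) (Fin 4) R := of fun i j => e.symm (P₁ i j, P₂ i j) with hP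
  have m₁ : P.map f₁ = P₁ := by ext i j; simp [hP, hf₁]
  have m₂ : P.map f₂ = P₂ := by ext i j; simp [hP, hf₂]
  refine ⟨P, ?_, ?_⟩
  · rw [← MulEquiv.isUnit_map e, Prod.isUnit_iff]
    constructor
    · have : (e P.det).1 = f₁ P.det := rfl
      rw [this, RingHom.map_det, RingHom.mapMatrix_apply, m₁]
      exact hP₁
    · have : (e P.det).2 = f₂ P.det := rfl
      rw [this, RingHom.map_det, RingHom.mapMatrix_apply, m₂]
      exact hP₂
  · have k₁ : (Pᵀ * S * P).map f₁ = (diagonal ![1, 1, 1, S.det]).map f₁ := by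
      rw [Matrix.map_mul, Matrix.map_mul, transpose_map, m₁, e₁, map_diagonal_four, map_one,
        RingHom.map_det]
      rfl
    have k₂ : (Pᵀ * S * P).map f₂ = (diagonal ![1, 1, 1, S.det]).map f₂ := by
      rw [Matrix.map_mul, Matrix.map_mul, transpose_map, m₂, e₂, map_diagonal_four, map_one,
        RingHom.map_det]
      rfl
    ext i j
    exact hinj _ _ (congrFun (congrFun k₁ i) j) (congrFun (congrFun k₂ i) j)

theorem isUnit_two_zmod {N : ℕ} (hN : Odd N) : IsUnit (2 : ZMod N) := by
  have := (ZMod.isUnit_iff_coprime 2 N).2 (Nat.coprime_two_left.2 hN)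
  exact_mod_cast this

/-- Over `ℤ/N` with `N` odd, symmetric `4 × 4` matrices with unit determinant are classified by
the determinant. -/
theorem hasDiagNormalForm_zmod {N : ℕ} (hN : Odd N) : HasDiagNormalForm (ZMod N) := by
  induction N using Nat.recOnPosPrimePosCoprime with
  | prime_pow p n hp hn =>
    have : Fact p.Prime := ⟨hp⟩
    have hp2 : p ≠ 2 := by
      rintro rfl
      exact (Nat.not_odd_iff_even.2 ((Nat.even_pow' hn.ne').2 even_two)) hN
    have hdvd : p ∣ p ^ n := dvd_pow_self p hn.ne'
    refine HasDiagNormalForm.of_surjective (π := ZMod.castHom hdvd (ZMod p))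
      (c := (p : ZMod (p ^ n))) (k := n) (ZMod.castHom_surjective hdvd) (isUnit_two_zmod hN) ?_ ?_
      (hasDiagNormalForm_zmod_prime hp2)
    · have h0 : (p : ZMod (p ^ n)) ^ n = 0 := by
        rw [← Nat.cast_pow, ZMod.natCast_self]
      exact pow_eq_zero_of_le Nat.lt_two_pow_self.le h0
    · intro x hx
      have : NeZero (p ^ n) := ⟨pow_ne_zero _ hp.ne_zero⟩
      rw [← ZMod.natCast_zmod_val x, map_natCast, ZMod.natCast_eq_zero_iff] at hx
      obtain ⟨y, hy⟩ := hx
      exact ⟨y, by rw [← ZMod.natCast_zmod_val x, hy, Nat.cast_mul]⟩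
  | zero => exact absurd hN (by decide)
  | one => exact fun S _ _ => ⟨1, by simp, Subsingleton.elim _ _⟩
  | coprime a b ha hb hab iha ihb =>
    exact HasDiagNormalForm.of_equiv_prod (ZMod.chineseRemainder hab)
      (iha (Nat.Odd.of_mul_left hN)) (ihb (Nat.Odd.of_mul_right hN))

end NormalForm

/-! ### Quadratic Gauss sums over finite rings -/

section GaussSum

theorem addChar_map_sum {R ι : Type*} [AddCommMonoid R] (ψ : AddChar R ℂ) (s : Finset ι)
    (f : ι → R) : ψ (∑ i ∈ s, f i) = ∏ i ∈ s, ψ (f i) := by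
  classical
  induction s using Finset.induction_on with
  | empty => simp
  | insert a s ha ih => rw [Finset.sum_insert ha, Finset.prod_insert ha, AddChar.map_add_eq_mul, ih]

variable {R : Type*} [CommRing R] [Fintype R] {n : Type*} [Fintype n] [DecidableEq n]

/-- The Gauss sum `∑_z ψ(c F[z])` of a quadratic form `F` over a finite ring. -/
noncomputable def vecGauss (ψ : AddChar R ℂ) (F : Matrix n n R) (c : R) : ℂ :=
  ∑ z : n → R, ψ (c * (z ⬝ᵥ F *ᵥ z))

/-- The Gauss sum `∑_G ψ(tr(S[G] F))` over `4 × n` matrices over a finite ring. -/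
noncomputable def matGauss (ψ : AddChar R ℂ) (F : Matrix n n R)
    (S : Matrix (Fin 4) (Fin 4) R) : ℂ :=
  ∑ G : Fin 4 → n → R, ψ (trace ((of G)ᵀ * S * of G * F))

theorem matGauss_congr (ψ : AddChar R ℂ) (F : Matrix n n R) (S : Matrix (Fin 4) (Fin 4) R)
    {P : Matrix (Fin 4) (Fin 4) R} (hP : IsUnit P.det) :
    matGauss ψ F (Pᵀ * S * P) = matGauss ψ F S := by
  let e : (Fin 4 → n → R) ≃ (Fin 4 → n → R) :=
    { toFun := fun G => P * of G
      invFun := fun G => P⁻¹ * of G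
      left_inv := fun G => by
        change P⁻¹ * (P * of G) = G
        rw [← Matrix.mul_assoc, nonsing_inv_mul _ hP, Matrix.one_mul]; rfl
      right_inv := fun G => by
        change P * (P⁻¹ * of G) = G
        rw [← Matrix.mul_assoc, mul_nonsing_inv _ hP, Matrix.one_mul]; rfl }
  rw [matGauss, matGauss, ← e.sum_comp fun G => ψ (trace ((of G)ᵀ * S * of G * F))]
  refine Finset.sum_congr rfl fun G _ => ?_
  change _ = ψ (trace ((P * of G)ᵀ * S * (P * of G) * F))
  rw [transpose_mul]
  simp only [Matrix.mul_assoc]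

theorem matGauss_diagonal (ψ : AddChar R ℂ) (F : Matrix n n R) (s : Fin 4 → R) :
    matGauss ψ F (diagonal s) = ∏ a, vecGauss ψ F (s a) := by
  classical
  have e : ∀ G : Fin 4 → n → R, ψ (trace ((of G)ᵀ * diagonal s * of G * F)) =
      ∏ a, ψ (s a * (G a ⬝ᵥ F *ᵥ G a)) := by
    intro G
    rw [← addChar_map_sum]
    congr 1
    rw [Matrix.mul_assoc, Matrix.mul_assoc, trace_mul_comm, trace]
    refine Finset.sum_congr rfl fun a _ => ?_
    rw [diag_apply, Matrix.mul_assoc, diagonal_mul, mul_apply]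
    congr 1
    rw [dotProduct_mulVec, dotProduct]
    rfl
  simp only [matGauss, e, vecGauss]
  rw [Finset.prod_univ_sum, Fintype.piFinset_univ]

theorem sum_char_dotProduct {ψ : AddChar R ℂ} (hψ : ψ.IsPrimitive) (v : n → R) [Decidable (v = 0)] :
    ∑ y : n → R, ψ (y ⬝ᵥ v) = if v = 0 then (Fintype.card R : ℂ) ^ Fintype.card n else 0 := by
  classical
  have h : ∑ y : n → R, ψ (y ⬝ᵥ v) = ∏ i, ∑ t : R, ψ (t * v i) := by
    simp only [dotProduct, addChar_map_sum]
    rw [Finset.prod_univ_sum, Fintype.piFinset_univ]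
  rw [h]
  simp only [AddChar.sum_mulShift _ hψ]
  split_ifs with hv
  · subst hv; simp
  · obtain ⟨i, hi⟩ := Function.ne_iff.1 hv
    exact Finset.prod_eq_zero (Finset.mem_univ i) (by simp [show v i ≠ 0 from hi])

/-- Substituting `x = y + z` in the double sum over `ψ(c (F[x] - F[y]))` makes it linear in `y`, so
only the `z` in the kernel of `F` contribute. -/
theorem vecGauss_mul_vecGauss_neg [DecidableEq R] {ψ : AddChar R ℂ} (hψ : ψ.IsPrimitive)
    {F : Matrix n n R} (hF : Fᵀ = F) {c : R} (hc : IsUnit c) (h2 : IsUnit (2 : R)) :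
    vecGauss ψ F c * vecGauss ψ F (-c) =
      (Fintype.card R : ℂ) ^ Fintype.card n * Fintype.card {z : n → R // F *ᵥ z = 0} := by
  have hsymm : ∀ x y : n → R, x ⬝ᵥ F *ᵥ y = y ⬝ᵥ F *ᵥ x := fun x y => by
    rw [dotProduct_mulVec, ← mulVec_transpose, hF, dotProduct_comm]
  have e1 : ∀ y : n → R, ∑ x : n → R, ψ (c * (x ⬝ᵥ F *ᵥ x)) * ψ (-c * (y ⬝ᵥ F *ᵥ y)) =
      ∑ z : n → R, ψ (c * (z ⬝ᵥ F *ᵥ z)) * ψ (y ⬝ᵥ ((2 * c) • F *ᵥ z)) := by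
    intro y
    rw [← Equiv.sum_comp (Equiv.addLeft y)]
    refine Finset.sum_congr rfl fun z _ => ?_
    rw [← AddChar.map_add_eq_mul, ← AddChar.map_add_eq_mul]
    congr 1
    simp only [Equiv.coe_addLeft, mulVec_add, dotProduct_add, add_dotProduct, dotProduct_smul,
      hsymm z y, smul_eq_mul]
    ring
  rw [vecGauss, vecGauss, Finset.sum_mul_sum, Finset.sum_comm]
  simp only [e1]
  rw [Finset.sum_comm]
  simp only [← Finset.mul_sum, sum_char_dotProduct hψ]
  have h2c : IsUnit (2 * c) := h2.mul hc
  have hz : ∀ z : n → R, (2 * c) • F *ᵥ z = 0 ↔ F *ᵥ z = 0 := fun z => h2c.smul_eq_zero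
  simp only [hz]
  have e2 : ∀ z : n → R, ψ (c * (z ⬝ᵥ F *ᵥ z)) *
      (if F *ᵥ z = 0 then (Fintype.card R : ℂ) ^ Fintype.card n else 0) =
      if F *ᵥ z = 0 then (Fintype.card R : ℂ) ^ Fintype.card n else 0 := fun z => by
    split_ifs with h
    · rw [h]; simp
    · simp
  simp only [e2]
  rw [← Finset.sum_filter, Finset.sum_const, nsmul_eq_mul, Fintype.card_subtype, mul_comm]

theorem vecGauss_mul_sq (ψ : AddChar R ℂ) (F : Matrix n n R) (c : R) {d : R} (hd : IsUnit d) :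
    vecGauss ψ F (c * d ^ 2) = vecGauss ψ F c := by
  obtain ⟨u, rfl⟩ := hd
  rw [vecGauss, vecGauss,
    ← Equiv.sum_comp (MulAction.toPerm u) fun z : n → R => ψ (c * (z ⬝ᵥ F *ᵥ z))]
  refine Finset.sum_congr rfl fun z _ => ?_
  rw [MulAction.toPerm_apply]
  congr 1
  have : u • z = (u : R) • z := rfl
  rw [this, mulVec_smul, dotProduct_smul, smul_dotProduct, smul_eq_mul, smul_eq_mul]
  ring

variable {ψ : AddChar R ℂ} {F : Matrix n n R}

theorem matGauss_eq (hR : HasDiagNormalForm R) {S : Matrix (Fin 4) (Fin 4) R} (hS : Sᵀ = S)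
    (hdet : IsUnit S.det) : matGauss ψ F S = vecGauss ψ F 1 ^ 3 * vecGauss ψ F S.det := by
  obtain ⟨P, hP, e⟩ := hR S hS hdet
  rw [← matGauss_congr ψ F S hP, e, matGauss_diagonal]
  simp only [Fin.prod_univ_four, cons_val_zero, cons_val_one, cons_val]
  ring

/-- This compares the Gauss sums of `diag(1, -1, 1, -1)` and of the congruent unit matrix. -/
theorem vecGauss_one_pow_four [DecidableEq R] (hψ : ψ.IsPrimitive) (hF : Fᵀ = F)
    (h2 : IsUnit (2 : R)) (hR : HasDiagNormalForm R) :
    vecGauss ψ F 1 ^ 4 = ((Fintype.card R : ℂ) ^ Fintype.card n *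
      Fintype.card {z : n → R // F *ᵥ z = 0}) ^ 2 := by
  have hd : (diagonal ![(1 : R), -1, 1, -1]).det = 1 := by rw [det_diagonal_four]; ring
  have h := matGauss_eq (ψ := ψ) (F := F) hR (diagonal_transpose ![(1 : R), -1, 1, -1])
    (by rw [hd]; exact isUnit_one)
  rw [hd, matGauss_diagonal] at h
  simp only [Fin.prod_univ_four, cons_val_zero, cons_val_one, cons_val] at h
  rw [← vecGauss_mul_vecGauss_neg hψ hF isUnit_one h2]
  linear_combination -h

/-- This compares the Gauss sums of `diag(1, 1, d, d)` and of the congruent unit matrix. -/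
theorem vecGauss_one_sq_mul_sq (hR : HasDiagNormalForm R) {d : R} (hd : IsUnit d) :
    vecGauss ψ F 1 ^ 2 * vecGauss ψ F d ^ 2 = vecGauss ψ F 1 ^ 4 := by
  have hdet : (diagonal ![(1 : R), 1, d, d]).det = 1 * d ^ 2 := by rw [det_diagonal_four]; ring
  have h := matGauss_eq (ψ := ψ) (F := F) hR (diagonal_transpose ![(1 : R), 1, d, d])
    (by rw [hdet]; exact isUnit_one.mul (hd.pow 2))
  rw [hdet, vecGauss_mul_sq ψ F 1 hd, matGauss_diagonal] at h
  simp only [Fin.prod_univ_four, cons_val_zero, cons_val_one, cons_val] at h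
  linear_combination h

theorem matGauss_of_det_eq_sq [DecidableEq R] (hψ : ψ.IsPrimitive) (hF : Fᵀ = F)
    (h2 : IsUnit (2 : R)) (hR : HasDiagNormalForm R) {S : Matrix (Fin 4) (Fin 4) R} (hS : Sᵀ = S)
    {d : R} (hd : IsUnit d) (hdet : S.det = d ^ 2) :
    matGauss ψ F S = ((Fintype.card R : ℂ) ^ Fintype.card n *
      Fintype.card {z : n → R // F *ᵥ z = 0}) ^ 2 := by
  rw [matGauss_eq hR hS (hdet ▸ hd.pow 2), hdet, ← one_mul (d ^ 2), vecGauss_mul_sq ψ F 1 hd,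
    ← vecGauss_one_pow_four hψ hF h2 hR]
  ring

/-- The square of `matGauss ψ F S` does not depend on `S`. -/
theorem matGauss_sq [DecidableEq R] (hψ : ψ.IsPrimitive) (hF : Fᵀ = F)
    (h2 : IsUnit (2 : R)) (hR : HasDiagNormalForm R) {S : Matrix (Fin 4) (Fin 4) R} (hS : Sᵀ = S)
    (hdet : IsUnit S.det) :
    matGauss ψ F S ^ 2 = ((Fintype.card R : ℂ) ^ Fintype.card n *
      Fintype.card {z : n → R // F *ᵥ z = 0}) ^ 4 := by
  have h1 := vecGauss_one_pow_four hψ hF h2 hR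
  have h3 := vecGauss_one_sq_mul_sq (ψ := ψ) (F := F) hR hdet
  rw [matGauss_eq hR hS hdet]
  calc _ = vecGauss ψ F 1 ^ 4 * (vecGauss ψ F 1 ^ 2 * vecGauss ψ F S.det ^ 2) := by ring
    _ = _ := by rw [h3, h1]; ring

theorem vecGauss_diagonal (ψ : AddChar R ℂ) (f : n → R) (c : R) :
    vecGauss ψ (diagonal f) c = ∏ i, ∑ x : R, ψ (c * f i * x ^ 2) := by
  classical
  have h : ∀ z : n → R, c * (z ⬝ᵥ diagonal f *ᵥ z) = ∑ i, c * f i * z i ^ 2 := fun z => by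
    rw [dotProduct, Finset.mul_sum]
    refine Finset.sum_congr rfl fun i _ => ?_
    rw [mulVec_diagonal]
    ring
  simp only [vecGauss, h, addChar_map_sum]
  rw [Finset.prod_univ_sum, Fintype.piFinset_univ]

end GaussSum

/-! ### The multiplier as a Gauss sum modulo `det D` -/

section Reduction

variable {g : ℕ} {A B C D : Matrix (Fin g) (Fin g) ℤ} {N : ℕ} {E : Matrix (Fin g) (Fin g) ℤ}

/-- Reduction of an integral matrix modulo `N`. -/
def matZ {m n : Type*} (N : ℕ) (X : Matrix m n ℤ) : Matrix m n (ZMod N) :=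
  X.map (Int.castRingHom (ZMod N))

theorem matZ_apply {m n : Type*} (X : Matrix m n ℤ) (i : m) (j : n) :
    matZ N X i j = (X i j : ZMod N) := rfl

theorem matZ_mul {l m n : Type*} [Fintype m] (X : Matrix l m ℤ) (Y : Matrix m n ℤ) :
    matZ N (X * Y) = matZ N X * matZ N Y := Matrix.map_mul

theorem matZ_eq_iff {m n : Type*} (X Y : Matrix m n ℤ) :
    matZ N X = matZ N Y ↔ ∃ Z : Matrix m n ℤ, X - Y = (N : ℤ) • Z := by
  constructor
  · intro h
    have : ∀ i j, ∃ z, X i j - Y i j = N * z := fun i j => by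
      have h' := congrFun (congrFun h i) j
      rw [matZ_apply, matZ_apply, ← sub_eq_zero, ← Int.cast_sub] at h'
      exact (ZMod.intCast_zmod_eq_zero_iff_dvd _ N).1 h'
    choose Z hZ using this
    exact ⟨of Z, by ext i j; simp [hZ]⟩
  · rintro ⟨Z, hZ⟩
    ext i j
    have h' := congrFun (congrFun hZ i) j
    rw [matZ_apply, matZ_apply, ← sub_eq_zero, ← Int.cast_sub, ← Matrix.sub_apply, h',
      Matrix.smul_apply, smul_eq_mul, Int.cast_mul]
    simp

/-- `N = |det D|` and `E = N B D⁻¹`, with the latter stated over `ℤ`. -/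
structure IsScaledQuotient (B D : Matrix (Fin g) (Fin g) ℤ) (N : ℕ)
    (E : Matrix (Fin g) (Fin g) ℤ) : Prop where
  natAbs_det : D.det.natAbs = N
  mul_eq : E * D = (N : ℤ) • B

theorem exists_isScaledQuotient (B D : Matrix (Fin g) (Fin g) ℤ) :
    IsScaledQuotient B D D.det.natAbs (D.det.sign • (B * D.adjugate)) := by
  refine ⟨rfl, ?_⟩
  rw [Matrix.smul_mul, Matrix.mul_assoc, adjugate_mul, Matrix.mul_smul, Matrix.mul_one, smul_smul,
    Int.sign_mul_self_eq_natAbs]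

namespace IsScaledQuotient

theorem smul_mem_rowLattice (q : IsScaledQuotient B D N E) (Z : Matrix (Fin 4) (Fin g) ℤ) :
    (N : ℤ) • Z ∈ rowLattice D := by
  have h : (D.det.sign • (Z * Dᵀ.adjugate)) * Dᵀ = (N : ℤ) • Z := by
    rw [Matrix.smul_mul, Matrix.mul_assoc, adjugate_mul, Matrix.mul_smul, Matrix.mul_one, smul_smul,
      det_transpose, Int.sign_mul_self_eq_natAbs, q.natAbs_det]
  exact ⟨D.det.sign • (Z * Dᵀ.adjugate), h⟩

theorem det_eq (q : IsScaledQuotient B D N E) : (D.det : ℤ) = N ∨ (D.det : ℤ) = -N := by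
  rw [← q.natAbs_det]; exact Int.natAbs_eq _

theorem ne_zero (q : IsScaledQuotient B D N E) (h : IgusaBlocks A B C D) : N ≠ 0 := by
  rw [← q.natAbs_det]; exact Int.natAbs_ne_zero.2 h.det_ne_zero

theorem odd (q : IsScaledQuotient B D N E) (h : IgusaBlocks A B C D) : Odd N := by
  rw [← q.natAbs_det]; exact Int.natAbs_odd.2 (det_odd h.dvd_d)

theorem matR_eq (q : IsScaledQuotient B D N E) (h : IgusaBlocks A B C D) :
    matR E = (N : ℝ) • (matR B * (matR D)⁻¹) := by
  have e := congrArg matR q.mul_eq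
  rw [matR_mul, matR_smul] at e
  have e' := congrArg (· * (matR D)⁻¹) e
  simp only [Matrix.mul_assoc, mul_nonsing_inv _ h.isUnit_det, Matrix.mul_one,
    Matrix.smul_mul] at e'
  rw [e']; norm_num

theorem transpose_eq (q : IsScaledQuotient B D N E) (h : IgusaBlocks A B C D) : Eᵀ = E := by
  have e : (matR E)ᵀ = matR E := by rw [q.matR_eq h, transpose_smul, h.transpose_b_mul_inv]
  ext i j
  have := congrFun (congrFun e i) j
  simpa using this

/-- Since `E` is integral and `8 | tr(W E)`, the phase `tr(W B D⁻¹) / 8` is an integer over `N`. -/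
theorem eight_dvd_trace (q : IsScaledQuotient B D N E) (h : IgusaBlocks A B C D)
    {W : Matrix (Fin g) (Fin g) ℤ} (hW : Wᵀ = W) : (8 : ℤ) ∣ trace (W * E) := by
  -- `det(D)² E` is `N` times the conjugate of `Dᵀ B` by the adjugate of `D`
  have e : D.det ^ 2 * trace (W * E) =
      N * trace (D.adjugate * W * D.adjugateᵀ * (Dᵀ * B)) := by
    have h1 : D.det • E = (N : ℤ) • (B * D.adjugate) := by
      have := congrArg (· * D.adjugate) q.mul_eq
      simpa only [Matrix.mul_assoc, mul_adjugate, Matrix.mul_smul, Matrix.mul_one,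
        Matrix.smul_mul] using this
    have h2 : D.adjugateᵀ * Dᵀ = D.det • (1 : Matrix (Fin g) (Fin g) ℤ) := by
      rw [← transpose_mul, mul_adjugate, transpose_smul, transpose_one]
    calc D.det ^ 2 * trace (W * E) = trace (W * (D.det • (1 : Matrix (Fin g) (Fin g) ℤ)) *
          (D.det • E)) := by
          simp only [Matrix.mul_smul, Matrix.smul_mul, Matrix.mul_one, trace_smul, smul_eq_mul]
          ring
      _ = N * trace (W * (D.adjugateᵀ * Dᵀ) * (B * D.adjugate)) := by
          rw [h1, h2, Matrix.mul_smul, trace_smul, smul_eq_mul]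
      _ = _ := by
          rw [← Matrix.mul_assoc _ B, trace_mul_comm _ D.adjugate]
          simp only [Matrix.mul_assoc]
  have h8 : (8 : ℤ) ∣ D.det ^ 2 * trace (W * E) := by
    rw [e]
    refine Dvd.dvd.mul_left (eight_dvd_trace_mul ?_ ?_
      (fun i j => dvd_mul_left_entries h.dvd_b _ i j) h.diag_bd) _
    · simp only [transpose_mul, transpose_transpose, hW, Matrix.mul_assoc]
    · rw [transpose_mul, transpose_transpose, h.bd_symm]
  refine IsCoprime.dvd_of_dvd_mul_left ?_ h8
  have h2 : IsCoprime (2 : ℤ) D.det := by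
    obtain ⟨k, hk⟩ := det_odd h.dvd_d
    exact ⟨-k, 1, by rw [hk]; ring⟩
  have : IsCoprime ((2 : ℤ) ^ 3) (D.det ^ 2) := h2.pow
  simpa using this

variable {S : Matrix (Fin 4) (Fin 4) ℤ}

theorem gaussPhase_eq [NeZero N] (q : IsScaledQuotient B D N E) (h : IgusaBlocks A B C D)
    (hS : Sᵀ = S) {u : ZMod N} (hu : 8 * u = 1) (G : Matrix (Fin 4) (Fin g) ℤ) :
    gaussPhase S B D G = ZMod.stdAddChar
      (trace ((matZ N G)ᵀ * matZ N S * matZ N G * (u • matZ N E))) := by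
  obtain ⟨t, ht⟩ := q.eight_dvd_trace h (W := Gᵀ * S * G)
    (by simp only [transpose_mul, transpose_transpose, hS, Matrix.mul_assoc])
  have e1 : trace ((matZ N G)ᵀ * matZ N S * matZ N G * (u • matZ N E)) = (t : ZMod N) := by
    have : trace ((matZ N G)ᵀ * matZ N S * matZ N G * matZ N E) =
        ((trace (Gᵀ * S * G * E) : ℤ) : ZMod N) := by
      have e : (matZ N G)ᵀ = matZ N Gᵀ := rfl
      rw [e, ← matZ_mul, ← matZ_mul, ← matZ_mul]
      exact (AddMonoidHom.map_trace (Int.castRingHom (ZMod N)) _).symm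
    rw [Matrix.mul_smul, trace_smul, this, ht, smul_eq_mul]
    push_cast
    linear_combination (t : ZMod N) * hu
  have e2 : (N : ℝ) * trace ((matR G)ᵀ * matR S * matR G * (matR B * (matR D)⁻¹)) = 8 * t := by
    have : ((trace (Gᵀ * S * G * E) : ℤ) : ℝ) = 8 * t := by rw [ht]; push_cast; ring
    rw [← this, ← matR_trace, matR_mul, matR_mul, matR_mul, q.matR_eq h, Matrix.mul_smul,
      trace_smul, smul_eq_mul, matR_transpose]
  have hN : (N : ℝ) ≠ 0 := by exact_mod_cast NeZero.ne N
  have e3 : trace ((matR G)ᵀ * matR S * matR G * (matR B * (matR D)⁻¹)) / 8 = t / N := by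
    field_simp
    linarith
  rw [gaussPhase, e3, e1, ZMod.stdAddChar_coe, eChar]
  congr 1
  push_cast
  ring

/-- The lattice `ℤ^{4×g} Dᵀ` is the kernel of `G ↦ G E` modulo `N`. -/
theorem mem_rowLattice_iff (q : IsScaledQuotient B D N E) (h : IgusaBlocks A B C D)
    (hAD : A * Dᵀ - B * Cᵀ = 1) (hCD : C * Dᵀ = D * Cᵀ) (G : Matrix (Fin 4) (Fin g) ℤ) :
    G ∈ rowLattice D ↔ matZ N G * matZ N E = 0 := by
  have hN : (N : ℤ) ≠ 0 := by exact_mod_cast q.ne_zero h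
  have h0 : matZ N G * matZ N E = 0 ↔ ∃ Z, G * E = (N : ℤ) • Z := by
    have e : (0 : Matrix (Fin 4) (Fin g) (ZMod N)) = matZ N 0 := by ext; simp [matZ_apply]
    rw [← matZ_mul, e, matZ_eq_iff]
    simp only [sub_zero]
  rw [h0]
  constructor
  · rintro ⟨H, rfl⟩
    have hE : Dᵀ * E = (N : ℤ) • Bᵀ := by
      rw [← transpose_smul, ← q.mul_eq, transpose_mul, q.transpose_eq h]
    exact ⟨H * Bᵀ, by rw [mulRightLinearMap_apply, Matrix.mul_assoc, hE, Matrix.mul_smul]⟩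
  · rintro ⟨Z, hZ⟩
    have hGB : G * B = Z * D := by
      refine smul_right_injective _ hN ?_
      have := congrArg (· * D) hZ
      simpa only [Matrix.mul_assoc, q.mul_eq, Matrix.mul_smul, Matrix.smul_mul] using this
    refine ⟨G * A - Z * C, ?_⟩
    rw [mulRightLinearMap_apply]
    calc (G * A - Z * C) * Dᵀ = G * (A * Dᵀ) - Z * (C * Dᵀ) := by
          rw [Matrix.sub_mul, Matrix.mul_assoc, Matrix.mul_assoc]
      _ = G * (A * Dᵀ - B * Cᵀ) := by
          rw [hCD, ← Matrix.mul_assoc Z, ← hGB, Matrix.mul_sub, Matrix.mul_assoc G B]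
      _ = G := by rw [hAD, Matrix.mul_one]

theorem card_matrix_kernel [NeZero N] (F : Matrix (Fin g) (Fin g) (ZMod N)) (hF : Fᵀ = F) :
    Fintype.card {G : Fin 4 → Fin g → ZMod N // of G * F = 0} =
      Fintype.card {z : Fin g → ZMod N // F *ᵥ z = 0} ^ 4 := by
  have hrow : ∀ G : Fin 4 → Fin g → ZMod N, of G * F = 0 ↔ ∀ a, F *ᵥ G a = 0 := fun G => by
    have : ∀ a j, (of G * F) a j = (F *ᵥ G a) j := fun a j => by
      rw [← vecMul_transpose, hF]; rfl
    constructor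
    · intro h a
      funext j
      rw [← this, h]; rfl
    · intro h
      ext a j
      rw [this, h]; rfl
  have e : {G : Fin 4 → Fin g → ZMod N // of G * F = 0} ≃
      (Fin 4 → {z : Fin g → ZMod N // F *ᵥ z = 0}) :=
    (Equiv.subtypeEquivRight hrow).trans (Equiv.subtypePiEquivPi (p := fun _ z => F *ᵥ z = 0))
  rw [Fintype.card_congr e, Fintype.card_fun, Fintype.card_fin]

/-- Comparison of the sums over `ℤ^{4×g} / ℤ^{4×g} Dᵀ` and over matrices modulo `N`. -/
theorem sum_reduction [NeZero N] (q : IsScaledQuotient B D N E) (h : IgusaBlocks A B C D)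
    (hAD : A * Dᵀ - B * Cᵀ = 1) (hCD : C * Dᵀ = D * Cᵀ) [Fintype (RowQuot D)]
    {F : Matrix (Fin g) (Fin g) (ZMod N)} (hF : Fᵀ = F)
    (hFE : ∀ G : Matrix (Fin 4) (Fin g) (ZMod N), G * F = 0 ↔ G * matZ N E = 0)
    (f : Matrix (Fin 4) (Fin g) (ZMod N) → ℂ) (f' : Matrix (Fin 4) (Fin g) ℤ → ℂ)
    (hf : ∀ G, f' G = f (matZ N G))
    (hper : ∀ G H : Matrix (Fin 4) (Fin g) ℤ, f' (G + H * Dᵀ) = f' G) :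
    ∑ G : Fin 4 → Fin g → ZMod N, f (of G) =
      (Fintype.card {z : Fin g → ZMod N // F *ᵥ z = 0} : ℂ) ^ 4 *
        ∑ x : RowQuot D, f' (Quotient.out x) := by
  classical
  let lift : (Fin 4 → Fin g → ZMod N) → Matrix (Fin 4) (Fin g) ℤ := fun G =>
    of fun i j => (G i j).cast
  have hlift : ∀ G, matZ N (lift G) = of G := fun G => by
    ext i j
    rw [matZ_apply]
    exact ZMod.intCast_zmod_cast _
  have hmk : ∀ X Y : Matrix (Fin 4) (Fin g) ℤ, matZ N X = matZ N Y →
      (Submodule.Quotient.mk X : RowQuot D) = Submodule.Quotient.mk Y := fun X Y hXY => by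
    obtain ⟨Z, hZ⟩ := (matZ_eq_iff X Y).1 hXY
    rw [Submodule.Quotient.eq, hZ]
    exact q.smul_mem_rowLattice Z
  let ρ : (Fin 4 → Fin g → ZMod N) →+ RowQuot D := AddMonoidHom.mk'
    (fun G => Submodule.Quotient.mk (lift G)) fun G H => by
      rw [← Submodule.Quotient.mk_add]
      apply hmk
      have : matZ N (lift G + lift H) = matZ N (lift G) + matZ N (lift H) := by
        ext i j; simp [matZ_apply]
      rw [this, hlift, hlift, hlift]
      rfl
  have hsurj : Function.Surjective ρ := fun x => by
    obtain ⟨X, rfl⟩ := Submodule.Quotient.mk_surjective _ x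
    exact ⟨matZ N X, hmk _ _ (hlift _)⟩
  have hfρ : ∀ G, f (of G) = f' (Quotient.out (ρ G)) := fun G => by
    rw [← hlift, ← hf]
    have : Quotient.out (ρ G) - lift G ∈ rowLattice D :=
      (Submodule.Quotient.eq _).1 (Quotient.out_eq (ρ G))
    obtain ⟨H, hH⟩ := this
    rw [mulRightLinearMap_apply] at hH
    rw [← hper (lift G) H, hH, add_sub_cancel]
  have hker : ∀ G, ρ G = 0 ↔ of G * F = 0 := fun G => by
    rw [hFE, ← hlift, ← q.mem_rowLattice_iff h hAD hCD]
    exact Submodule.Quotient.mk_eq_zero _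
  have hfib : ∀ x : RowQuot D, (Finset.univ.filter fun G => ρ G = x).card =
      Fintype.card {z : Fin g → ZMod N // F *ᵥ z = 0} ^ 4 := fun x => by
    rw [AddMonoidHom.card_fiber_eq_of_mem_range ρ (hsurj x) (hsurj 0), ← card_matrix_kernel F hF,
      Fintype.card_subtype]
    simp only [hker]
  simp only [hfρ]
  rw [← Finset.sum_fiberwise_of_maps_to (g := ρ) (t := Finset.univ) fun _ _ => Finset.mem_univ _,
    Finset.mul_sum]
  refine Finset.sum_congr rfl fun x _ => ?_
  rw [Finset.sum_congr rfl (g := fun _ => f' (Quotient.out x)) fun G hG => by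
    rw [(Finset.mem_filter.1 hG).2], Finset.sum_const, hfib, nsmul_eq_mul]
  push_cast
  ring

/-- Reduction modulo `N` turns the normalised phase sum into a Gauss sum over `ℤ/N`. -/
theorem matGauss_eq_gaussSum4 [NeZero N] (q : IsScaledQuotient B D N E) (h : IgusaBlocks A B C D)
    (hAD : A * Dᵀ - B * Cᵀ = 1) (hCD : C * Dᵀ = D * Cᵀ) (hS : Sᵀ = S) {u : ZMod N}
    (hu : 8 * u = 1) :
    matGauss ZMod.stdAddChar (u • matZ N E) (matZ N S) =
      (Fintype.card {z : Fin g → ZMod N // (u • matZ N E) *ᵥ z = 0} : ℂ) ^ 4 *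
        gaussSum4 S B D := by
  have := finite_rowQuot h.det_ne_zero
  let _ := Fintype.ofFinite (RowQuot D)
  have hF : (u • matZ N E)ᵀ = u • matZ N E := by
    rw [transpose_smul]
    exact congrArg (fun X => u • matZ N X) (q.transpose_eq h)
  have hFE : ∀ G : Matrix (Fin 4) (Fin g) (ZMod N), G * (u • matZ N E) = 0 ↔ G * matZ N E = 0 :=
    fun G => by
      rw [Matrix.mul_smul]
      exact (IsUnit.of_mul_eq_one_right 8 hu).smul_eq_zero
  rw [gaussSum4, tsum_fintype]
  exact q.sum_reduction h hAD hCD hF hFE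
    (fun G => ZMod.stdAddChar (trace (Gᵀ * matZ N S * G * (u • matZ N E))))
    (gaussPhase S B D) (fun G => q.gaussPhase_eq h hS hu G) (gaussPhase_periodic h hS)

/-- Counting the matrices modulo `N` in the fibres over `ℤ^{4×g} / ℤ^{4×g} Dᵀ` determines the size
of the kernel of `E` modulo `N`. -/
theorem pow_eq_card_mul [NeZero N] (q : IsScaledQuotient B D N E) (h : IgusaBlocks A B C D)
    (hAD : A * Dᵀ - B * Cᵀ = 1) (hCD : C * Dᵀ = D * Cᵀ) {u : ZMod N}
    (hu : 8 * u = 1) :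
    N ^ g = Fintype.card {z : Fin g → ZMod N // (u • matZ N E) *ᵥ z = 0} * N := by
  have := finite_rowQuot h.det_ne_zero
  let _ := Fintype.ofFinite (RowQuot D)
  have hF : (u • matZ N E)ᵀ = u • matZ N E := by
    rw [transpose_smul]
    exact congrArg (fun X => u • matZ N X) (q.transpose_eq h)
  have hFE : ∀ G : Matrix (Fin 4) (Fin g) (ZMod N), G * (u • matZ N E) = 0 ↔ G * matZ N E = 0 :=
    fun G => by
      rw [Matrix.mul_smul]
      exact (IsUnit.of_mul_eq_one_right 8 hu).smul_eq_zero
  have e := q.sum_reduction h hAD hCD hF hFE (fun _ => 1) (fun _ => 1) (fun _ => rfl) fun _ _ => rfl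
  simp only [Finset.sum_const, Finset.card_univ, nsmul_eq_mul, mul_one] at e
  rw [← Nat.card_eq_fintype_card (α := RowQuot D), natCard_rowQuot h.det_ne_zero, q.natAbs_det,
    Fintype.card_fun, Fintype.card_fun, ZMod.card, Fintype.card_fin, Fintype.card_fin] at e
  have e' : (N ^ g) ^ 4 =
      (Fintype.card {z : Fin g → ZMod N // (u • matZ N E) *ᵥ z = 0} * N) ^ 4 := by
    rw [mul_pow]; exact_mod_cast e
  exact Nat.pow_left_injective (by norm_num) e'

end IsScaledQuotient

end Reduction

/-! ### Values of the multiplier -/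

section Values

variable {g : ℕ} {A B C D : Matrix (Fin g) (Fin g) ℤ} {S : Matrix (Fin 4) (Fin 4) ℤ}

theorem exists_eight_mul_eq_one {N : ℕ} (hN : Odd N) : ∃ u : ZMod N, 8 * u = 1 := by
  obtain ⟨v, hv⟩ := isUnit_two_zmod hN
  refine ⟨((v⁻¹ : (ZMod N)ˣ) : ZMod N) ^ 3, ?_⟩
  have : (2 : ZMod N) * ((v⁻¹ : (ZMod N)ˣ) : ZMod N) = 1 := by rw [← hv]; exact v.mul_inv
  calc (8 : ZMod N) * ((v⁻¹ : (ZMod N)ˣ) : ZMod N) ^ 3 =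
        (2 * ((v⁻¹ : (ZMod N)ˣ) : ZMod N)) ^ 3 := by ring
    _ = 1 := by rw [this, one_pow]

theorem matZ_det {n : Type*} [Fintype n] [DecidableEq n] {N : ℕ} (X : Matrix n n ℤ) :
    (matZ N X).det = (X.det : ZMod N) := ((Int.castRingHom (ZMod N)).map_det X).symm

theorem matZ_transpose_eq {n : Type*} {N : ℕ} {X : Matrix n n ℤ} (h : Xᵀ = X) :
    (matZ N X)ᵀ = matZ N X := congrArg (matZ N) h

theorem smul_matZ_transpose_eq {n : Type*} {N : ℕ} {X : Matrix n n ℤ} (h : Xᵀ = X) (u : ZMod N) :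
    (u • matZ N X)ᵀ = u • matZ N X := by rw [transpose_smul, matZ_transpose_eq h]

theorem card_kernel_ne_zero {N : ℕ} [NeZero N] (F : Matrix (Fin g) (Fin g) (ZMod N)) :
    (Fintype.card {z : Fin g → ZMod N // F *ᵥ z = 0} : ℂ) ≠ 0 := by
  have : Nonempty {z : Fin g → ZMod N // F *ᵥ z = 0} := ⟨⟨0, mulVec_zero _⟩⟩
  exact_mod_cast Fintype.card_ne_zero

theorem IsScaledQuotient.det_sq {N : ℕ} {E : Matrix (Fin g) (Fin g) ℤ}
    (q : IsScaledQuotient B D N E) : (D.det : ℂ) ^ 2 = (N : ℂ) ^ 2 := by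
  rcases q.det_eq with h | h <;> rw [h] <;> push_cast <;> ring

/-- The square of the multiplier is `1` if the determinant of `S` is a power of `2`. -/
theorem gaussSum4_sq (h : IgusaBlocks A B C D) (hAD : A * Dᵀ - B * Cᵀ = 1)
    (hCD : C * Dᵀ = D * Cᵀ) (hS : Sᵀ = S) {k : ℕ} (hk : S.det = 2 ^ k) :
    gaussSum4 S B D ^ 2 = ((D.det : ℂ) ^ 2) ^ 2 := by
  have q := exists_isScaledQuotient B D
  set N := D.det.natAbs
  set E := D.det.sign • (B * D.adjugate)
  have : NeZero N := ⟨q.ne_zero h⟩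
  obtain ⟨u, hu⟩ := exists_eight_mul_eq_one (q.odd h)
  have h2 := isUnit_two_zmod (q.odd h)
  have e1 := q.matGauss_eq_gaussSum4 h hAD hCD hS hu
  have e2 := congrArg (Nat.cast : ℕ → ℂ) (q.pow_eq_card_mul h hAD hCD hu)
  push_cast at e2
  have e3 := matGauss_sq (ZMod.isPrimitive_stdAddChar N)
    (smul_matZ_transpose_eq (q.transpose_eq h) u) h2 (hasDiagNormalForm_zmod (q.odd h))
    (matZ_transpose_eq hS) (by rw [matZ_det, hk]; push_cast; exact h2.pow k)
  rw [e1, ZMod.card, Fintype.card_fin, e2] at e3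
  have h0 := card_kernel_ne_zero (u • matZ N E)
  refine mul_left_cancel₀ (pow_ne_zero 8 h0) ?_
  rw [q.det_sq]
  linear_combination e3

/-- The multiplier is trivial if the determinant of `S` is a square. -/
theorem gaussSum4_of_isSquare (h : IgusaBlocks A B C D) (hAD : A * Dᵀ - B * Cᵀ = 1)
    (hCD : C * Dᵀ = D * Cᵀ) (hS : Sᵀ = S) {k : ℕ} (hk : S.det = (2 ^ k) ^ 2) :
    gaussSum4 S B D = (D.det : ℂ) ^ 2 := by
  have q := exists_isScaledQuotient B D
  set N := D.det.natAbs
  set E := D.det.sign • (B * D.adjugate)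
  have : NeZero N := ⟨q.ne_zero h⟩
  obtain ⟨u, hu⟩ := exists_eight_mul_eq_one (q.odd h)
  have h2 := isUnit_two_zmod (q.odd h)
  have e1 := q.matGauss_eq_gaussSum4 h hAD hCD hS hu
  have e2 := congrArg (Nat.cast : ℕ → ℂ) (q.pow_eq_card_mul h hAD hCD hu)
  push_cast at e2
  have e3 := matGauss_of_det_eq_sq (ZMod.isPrimitive_stdAddChar N)
    (smul_matZ_transpose_eq (q.transpose_eq h) u) h2 (hasDiagNormalForm_zmod (q.odd h))
    (matZ_transpose_eq hS) (h2.pow k) (by rw [matZ_det, hk]; push_cast; rfl)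
  rw [e1, ZMod.card, Fintype.card_fin, e2] at e3
  have h0 := card_kernel_ne_zero (u • matZ N E)
  refine mul_left_cancel₀ (pow_ne_zero 4 h0) ?_
  rw [q.det_sq]
  linear_combination e3

/-! ### An element with nontrivial multiplier -/

/-- The diagonal matrix `diag(t, c, …, c)`, with `t` in position `i₀`. -/
def diagAt {R : Type*} [Zero R] (i₀ : Fin g) (t c : R) : Matrix (Fin g) (Fin g) R :=
  diagonal fun i => if i = i₀ then t else c

theorem diagAt_transpose {R : Type*} [Zero R] (i₀ : Fin g) (t c : R) :
    (diagAt i₀ t c)ᵀ = diagAt i₀ t c := diagonal_transpose _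

theorem diagAt_mul (i₀ : Fin g) (s t c d : ℤ) :
    diagAt i₀ s c * diagAt i₀ t d = diagAt i₀ (s * t) (c * d) := by
  rw [diagAt, diagAt, diagonal_mul_diagonal, diagAt]
  congr 1
  funext i
  split_ifs <;> rfl

theorem diagAt_sub (i₀ : Fin g) (s t c d : ℤ) :
    diagAt i₀ s c - diagAt i₀ t d = diagAt i₀ (s - t) (c - d) := by
  rw [diagAt, diagAt, diagonal_sub, diagAt]
  congr 1
  funext i
  split_ifs <;> rfl

theorem diagAt_one (i₀ : Fin g) : diagAt i₀ (1 : ℤ) 1 = 1 := by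
  rw [diagAt, ← diagonal_one]
  congr 1
  funext i
  split_ifs <;> rfl

/-- The element of `Γ_g[4,8]` acting on the coordinate `i₀` through `(13 8; 8 5)`. -/
def diagElement (i₀ : Fin g) : symplecticGroup (Fin g) ℤ :=
  ⟨fromBlocks (diagAt i₀ 13 1) (diagAt i₀ 8 0) (diagAt i₀ 8 0) (diagAt i₀ 5 1), by
    rw [SymplecticGroup.fromBlocks_mem_iff]
    simp only [diagAt_transpose, diagAt_mul, diagAt_sub]
    refine ⟨by norm_num, by norm_num, ?_⟩
    norm_num [diagAt_one]⟩

theorem diagElement_mem (i₀ : Fin g) : diagElement i₀ ∈ igusaGroup g 4 := by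
  have hA : blockA (diagElement i₀) = diagAt i₀ 13 1 := toBlocks_fromBlocks₁₁ _ _ _ _
  have hB : blockB (diagElement i₀) = diagAt i₀ 8 0 := toBlocks_fromBlocks₁₂ _ _ _ _
  have hC : blockC (diagElement i₀) = diagAt i₀ 8 0 := toBlocks_fromBlocks₂₁ _ _ _ _
  have hD : blockD (diagElement i₀) = diagAt i₀ 5 1 := toBlocks_fromBlocks₂₂ _ _ _ _
  refine ⟨?_, ?_, ?_⟩
  · change (fromBlocks (diagAt i₀ 13 1) (diagAt i₀ 8 0) (diagAt i₀ 8 0) (diagAt i₀ 5 1)).map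
      (Int.castRingHom (ZMod 4)) = 1
    have h13 : (13 : ZMod 4) = 1 := by decide
    have h5 : (5 : ZMod 4) = 1 := by decide
    have h8 : (8 : ZMod 4) = 0 := by decide
    ext i j
    rcases i with i | i <;> rcases j with j | j <;>
      simp only [map_apply, fromBlocks_apply₁₁, fromBlocks_apply₁₂, fromBlocks_apply₂₁,
        fromBlocks_apply₂₂, diagAt, diagonal_apply, one_apply, Sum.inl.injEq, Sum.inr.injEq,
        reduceCtorEq, if_false, Int.coe_castRingHom] <;>
      split_ifs <;> simp [h13, h5, h8]
  · rw [hA, hB, diagAt_transpose, diagAt_mul]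
    intro i
    rw [diagAt, diagonal_apply_eq]
    split_ifs <;> norm_num
  · rw [hC, hD, diagAt_transpose, diagAt_mul]
    intro i
    rw [diagAt, diagonal_apply_eq]
    split_ifs <;> norm_num

/-- As `2` is not a square modulo `5`, `x²` and `2 x²` together take every value modulo `5` twice,
so the two sums over `ℤ/5` add up to `2 ∑_x ψ(x) = 0`. -/
theorem vecGauss_five (i₀ : Fin g) :
    vecGauss ZMod.stdAddChar (diagAt i₀ (1 : ZMod 5) 0) 2 =
      -vecGauss ZMod.stdAddChar (diagAt i₀ (1 : ZMod 5) 0) 1 := by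
  have h0 : ∑ x : ZMod 5, ZMod.stdAddChar x = (0 : ℂ) := by
    have := AddChar.sum_mulShift (1 : ZMod 5) (ZMod.isPrimitive_stdAddChar 5)
    rw [if_neg (by decide)] at this
    simpa using this
  have h1 : ∑ x : ZMod 5, ZMod.stdAddChar (2 * 1 * x ^ 2) =
      -(∑ x : ZMod 5, (ZMod.stdAddChar (1 * 1 * x ^ 2) : ℂ)) := by
    have s : ∀ f : ZMod 5 → ℂ, ∑ x, f x = f 0 + f 1 + f 2 + f 3 + f 4 := Fin.sum_univ_five
    rw [s] at h0
    rw [s, s]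
    have c2 : (2 * 1 * 1 ^ 2 : ZMod 5) = 2 := by decide
    have c3 : (2 * 1 * 2 ^ 2 : ZMod 5) = 3 := by decide
    have c4 : (2 * 1 * 3 ^ 2 : ZMod 5) = 3 := by decide
    have c5 : (2 * 1 * 4 ^ 2 : ZMod 5) = 2 := by decide
    have c1 : (2 * 1 * 0 ^ 2 : ZMod 5) = 0 := by decide
    have d2 : (1 * 1 * 1 ^ 2 : ZMod 5) = 1 := by decide
    have d3 : (1 * 1 * 2 ^ 2 : ZMod 5) = 4 := by decide
    have d4 : (1 * 1 * 3 ^ 2 : ZMod 5) = 4 := by decide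
    have d5 : (1 * 1 * 4 ^ 2 : ZMod 5) = 1 := by decide
    have d1 : (1 * 1 * 0 ^ 2 : ZMod 5) = 0 := by decide
    rw [c1, c2, c3, c4, c5, d1, d2, d3, d4, d5]
    linear_combination 2 * h0
  rw [diagAt, vecGauss_diagonal, vecGauss_diagonal,
    ← Finset.mul_prod_erase _ _ (Finset.mem_univ i₀),
    ← Finset.mul_prod_erase _ _ (Finset.mem_univ i₀), if_pos rfl, h1, neg_mul]
  congr 2
  refine Finset.prod_congr rfl fun i hi => ?_
  rw [if_neg (Finset.ne_of_mem_erase hi), mul_zero, mul_zero]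

/-- For an odd power `det S` of `2`, the multiplier of `diagElement` is `-1`. -/
theorem gaussSum4_diagElement (i₀ : Fin g) (hS : Sᵀ = S) {k : ℕ} (hk : S.det = 2 * (2 ^ k) ^ 2) :
    gaussSum4 S (blockB (diagElement i₀)) (blockD (diagElement i₀)) =
      -((blockD (diagElement i₀)).det : ℂ) ^ 2 := by
  have h := igusaBlocks_of_mem (diagElement_mem i₀)
  obtain ⟨-, hCD, hAD⟩ := blocks_rel' (diagElement i₀)
  have hB : blockB (diagElement i₀) = diagAt i₀ 8 0 := toBlocks_fromBlocks₁₂ _ _ _ _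
  have hD : blockD (diagElement i₀) = diagAt i₀ 5 1 := toBlocks_fromBlocks₂₂ _ _ _ _
  have hdetD : (blockD (diagElement i₀)).det = 5 := by
    rw [hD, diagAt, det_diagonal, Finset.prod_ite_eq']
    simp
  have q : IsScaledQuotient (blockB (diagElement i₀)) (blockD (diagElement i₀)) 5
      (diagAt i₀ 8 0) := by
    refine ⟨by rw [hdetD]; rfl, ?_⟩
    rw [hB, hD, diagAt_mul]
    ext i j
    rw [Matrix.smul_apply, diagAt, diagAt, diagonal_apply, diagonal_apply]
    split_ifs <;> simp
  have hu : (8 * 2 : ZMod 5) = 1 := by decide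
  have hodd : Odd 5 := by decide
  have hF : (2 : ZMod 5) • matZ 5 (diagAt i₀ 8 0) = diagAt i₀ 1 0 := by
    have h8 : (2 : ZMod 5) * 8 = 1 := by decide
    ext i j
    rw [Matrix.smul_apply, matZ_apply, diagAt, diagAt, diagonal_apply, diagonal_apply, smul_eq_mul]
    split_ifs <;> simp [h8]
  have h2 := isUnit_two_zmod hodd
  have e1 := q.matGauss_eq_gaussSum4 h hAD hCD hS hu
  have e2 := congrArg (Nat.cast : ℕ → ℂ) (q.pow_eq_card_mul h hAD hCD hu)
  push_cast at e2
  have hdet : (matZ 5 S).det = 2 * (2 ^ k) ^ 2 := by rw [matZ_det, hk]; push_cast; rfl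
  have e3 := matGauss_eq (ψ := ZMod.stdAddChar) (F := diagAt i₀ (1 : ZMod 5) 0)
    (hasDiagNormalForm_zmod hodd) (matZ_transpose_eq hS)
    (by rw [hdet]; exact h2.mul ((h2.pow k).pow 2))
  have e4 := vecGauss_one_pow_four (ZMod.isPrimitive_stdAddChar 5)
    (diagAt_transpose i₀ (1 : ZMod 5) 0) h2 (hasDiagNormalForm_zmod hodd)
  have h0 := card_kernel_ne_zero (diagAt i₀ (1 : ZMod 5) 0)
  rw [hF] at e1 e2
  rw [hdet, vecGauss_mul_sq _ _ _ (h2.pow k), vecGauss_five, e1] at e3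
  rw [ZMod.card, Fintype.card_fin] at e4
  push_cast at e4
  rw [e2] at e4
  refine mul_left_cancel₀ (pow_ne_zero 4 h0) ?_
  rw [hdetD]
  push_cast
  linear_combination e3 - e4

end Values

/-! ### The character -/

section Multiplier

variable {g : ℕ} {S : Matrix (Fin 4) (Fin 4) ℤ}

theorem transpose_eq_of_posDef (hS : (matR S).PosDef) : Sᵀ = S := by
  have := hS.1
  rw [IsHermitian, conjTranspose_eq_transpose_of_trivial] at this
  ext i j
  have := congrFun (congrFun this i) j
  simpa using this

/-- Since `16 S⁻¹` is integral, `det S` divides `16⁴`. -/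
theorem det_eq_two_pow (hS : (matR S).PosDef) {T : Matrix (Fin 4) (Fin 4) ℤ}
    (hT : (16 : ℝ) • (matR S)⁻¹ = matR T) : ∃ k, S.det = 2 ^ k := by
  have hpos : 0 < S.det := by
    have := hS.det_pos
    rw [matR_det] at this
    exact_mod_cast this
  have e : S.det * T.det = 2 ^ 16 := by
    have h1 : matR S * matR T = (16 : ℝ) • 1 := by
      rw [← hT, Matrix.mul_smul, mul_nonsing_inv _ (isUnit_iff_ne_zero.2 hS.det_pos.ne')]
    have h2 := congrArg det h1
    rw [det_mul, det_smul, det_one, Fintype.card_fin, matR_det, matR_det, mul_one] at h2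
    have h3 : S.det * T.det = 16 ^ 4 := by exact_mod_cast h2
    rw [h3]; norm_num
  have hdvd : S.det.natAbs ∣ 2 ^ 16 := by
    have := Int.natAbs_dvd_natAbs.2 (Dvd.intro _ e)
    simpa using this
  obtain ⟨k, -, hk⟩ := (Nat.dvd_prime_pow Nat.prime_two).1 hdvd
  refine ⟨k, ?_⟩
  rw [← Int.natAbs_of_nonneg hpos.le, hk]
  push_cast
  rfl

theorem not_isSquare_two_pow_odd (m : ℕ) : ¬ IsSquare (2 * (2 ^ m) ^ 2 : ℤ) := by
  rintro ⟨r, hr⟩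
  have e : 2 ^ (2 * m + 1) = r.natAbs * r.natAbs := by
    have := congrArg Int.natAbs hr
    rw [Int.natAbs_mul, Int.natAbs_mul, Int.natAbs_pow, Int.natAbs_pow] at this
    rw [← this]
    simp only [Int.reduceAbs]
    ring
  obtain ⟨j, -, hj⟩ := (Nat.dvd_prime_pow Nat.prime_two).1 (Dvd.intro _ e.symm)
  rw [hj, ← pow_add] at e
  have := Nat.pow_right_injective le_rfl e
  omega

/-- The base point `i` of the Siegel upper half space. -/
noncomputable def siegelI (g : ℕ) : Matrix (Fin g) (Fin g) ℂ := Complex.I • 1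

theorem siegelI_mem : siegelI g ∈ siegelHalfSpace g := by
  constructor
  · rw [siegelI, transpose_smul, transpose_one]
  · have : (siegelI g).map Complex.im = 1 := by
      ext i j
      rw [map_apply, siegelI, Matrix.smul_apply, one_apply, one_apply]
      split_ifs <;> simp
    rw [this]
    exact PosDef.one

theorem thetaSeries_zero_siegelI_ne_zero (hS : (matR S).PosDef) :
    thetaSeries 4 S (0 : Matrix (Fin 4) (Fin g) ℤ) (siegelI g) ≠ 0 := by
  -- all terms are positive real numbers
  have hterm : ∀ G : Matrix (Fin 4) (Fin g) ℤ, qExp (matR S) (siegelI g) (matR G) =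
      ((Real.exp (-(Real.pi / 4 * trace ((matR G)ᵀ * matR S * matR G))) : ℝ) : ℂ) := fun G => by
    rw [qExp, siegelI, Matrix.mul_smul, Matrix.mul_one, trace_smul, matC_trace, smul_eq_mul,
      Complex.ofReal_exp]
    congr 1
    push_cast
    linear_combination (Real.pi / 4 * trace ((matR G)ᵀ * matR S * matR G) : ℂ) * Complex.I_mul_I
  have hsum := summable_qExp hS siegelI_mem (0 : Matrix (Fin 4) (Fin g) ℝ) one_pos
  simp only [zero_add, one_smul, hterm] at hsum
  rw [thetaSeries_eq]
  have e : ∀ G : Matrix (Fin 4) (Fin g) ℤ,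
      trace ((matR G)ᵀ * matR (0 : Matrix (Fin 4) (Fin g) ℤ)) / 4 = 0 := fun G => by
    have : matR (0 : Matrix (Fin 4) (Fin g) ℤ) = 0 := by ext; simp
    rw [this, Matrix.mul_zero, trace_zero, zero_div]
  simp only [e, eChar_zero, one_mul, hterm]
  rw [← Complex.ofReal_tsum, Complex.ofReal_ne_zero]
  exact ((Complex.summable_ofReal.1 hsum).tsum_pos (fun G => (Real.exp_pos _).le) 0
    (Real.exp_pos _)).ne'

theorem isIsotropic_zero (S : Matrix (Fin 4) (Fin 4) ℤ) :
    IsIsotropic 4 S (0 : Matrix (Fin 4) (Fin g) ℤ) :=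
  ⟨⟨0, by simp⟩, ⟨0, by simp⟩⟩

theorem IsIsotropic.nonempty_isotropicData {V : Matrix (Fin 4) (Fin g) ℤ} (hV : IsIsotropic 4 S V)
    {T : Matrix (Fin 4) (Fin 4) ℤ} (hT : (16 : ℝ) • (matR S)⁻¹ = matR T) :
    Nonempty (IsotropicData S V) := by
  obtain ⟨⟨P, hP⟩, ⟨U, hU⟩⟩ := hV
  exact ⟨⟨T, U, P, hT, by exact_mod_cast hU, hP⟩⟩

/-- The multiplier `det(D)⁻² ∑_G exp((πi/4) tr(S[G] B D⁻¹))`. -/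
noncomputable def multiplier (S : Matrix (Fin 4) (Fin 4) ℤ) (M : symplecticGroup (Fin g) ℤ) : ℂ :=
  gaussSum4 S (blockB M) (blockD M) / ((blockD M).det : ℂ) ^ 2

/-- The values on `M`, `N` and `M N` are compared through `ϑ_{S,0}`, which is nonzero at `i`. -/
theorem multiplier_mul (hS : (matR S).PosDef) {T : Matrix (Fin 4) (Fin 4) ℤ}
    (hT : (16 : ℝ) • (matR S)⁻¹ = matR T) {M N : symplecticGroup (Fin g) ℤ}
    (hM : M ∈ igusaGroup g 4) (hN : N ∈ igusaGroup g 4) :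
    multiplier S (M * N) = multiplier S M * multiplier S N := by
  obtain ⟨d⟩ := (isIsotropic_zero (g := g) S).nonempty_isotropicData hT
  have bM := igusaBlocks_of_mem hM
  have bN := igusaBlocks_of_mem hN
  have bMN := igusaBlocks_of_mem (mul_mem hM hN)
  have hI := siegelI_mem (g := g)
  have e1 := thetaSeries_siegelAct bMN hS d hI
  rw [siegelAct_mul bN hI, thetaSeries_siegelAct bM hS d (siegelAct_mem bN hI),
    thetaSeries_siegelAct bN hS d hI] at e1
  have hj := siegelDenom_det_ne_zero bMN hI
  have hθ := thetaSeries_zero_siegelI_ne_zero (g := g) hS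
  refine mul_right_cancel₀ (mul_ne_zero (pow_ne_zero 2 hj) hθ) ?_
  rw [multiplier, ← mul_assoc, ← e1, siegelDenom_mul bN hI, det_mul, multiplier, multiplier]
  ring

theorem multiplier_sq (hS : (matR S).PosDef) {k : ℕ} (hk : S.det = 2 ^ k)
    {M : symplecticGroup (Fin g) ℤ} (hM : M ∈ igusaGroup g 4) : multiplier S M ^ 2 = 1 := by
  have bM := igusaBlocks_of_mem hM
  obtain ⟨-, hCD, hAD⟩ := blocks_rel' M
  have hD : ((blockD M).det : ℂ) ≠ 0 := by exact_mod_cast bM.det_ne_zero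
  rw [multiplier, div_pow, gaussSum4_sq bM hAD hCD (transpose_eq_of_posDef hS) hk]
  exact div_self (pow_ne_zero _ (pow_ne_zero _ hD))

theorem norm_multiplier (hS : (matR S).PosDef) {k : ℕ} (hk : S.det = 2 ^ k)
    {M : symplecticGroup (Fin g) ℤ} (hM : M ∈ igusaGroup g 4) : ‖multiplier S M‖ = 1 := by
  have := congrArg norm (multiplier_sq hS hk hM)
  rw [norm_pow, norm_one] at this
  exact (pow_eq_one_iff_of_nonneg (norm_nonneg _) two_ne_zero).1 this

/-- The multiplier as a character of `Γ_g[4,8]`. -/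
noncomputable def multiplierChar (hS : (matR S).PosDef) {T : Matrix (Fin 4) (Fin 4) ℤ}
    (hT : (16 : ℝ) • (matR S)⁻¹ = matR T) {k : ℕ} (hk : S.det = 2 ^ k) :
    igusaGroup g 4 →* Circle :=
  MonoidHom.mk'
    (fun M => ⟨multiplier S M.1, mem_sphere_zero_iff_norm.2 (norm_multiplier hS hk M.2)⟩)
    fun M N => Circle.ext (multiplier_mul hS hT M.2 N.2)

theorem isThetaMultiplier_multiplierChar (hS : (matR S).PosDef) {T : Matrix (Fin 4) (Fin 4) ℤ}
    (hT : (16 : ℝ) • (matR S)⁻¹ = matR T) {k : ℕ} (hk : S.det = 2 ^ k) :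
    IsThetaMultiplier (g := g) 4 S (multiplierChar hS hT hk) := by
  intro V hV M τ hτ
  obtain ⟨d⟩ := hV.nonempty_isotropicData hT
  exact thetaSeries_siegelAct (igusaBlocks_of_mem M.2) hS d hτ

/-- The multiplier is determined by its values on `ϑ_{S,0}`. -/
theorem IsThetaMultiplier.apply_eq (hS : (matR S).PosDef) {T : Matrix (Fin 4) (Fin 4) ℤ}
    (hT : (16 : ℝ) • (matR S)⁻¹ = matR T) {ε : igusaGroup g 4 →* Circle}
    (hε : IsThetaMultiplier 4 S ε) (M : igusaGroup g 4) : (ε M : ℂ) = multiplier S M.1 := by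
  have bM := igusaBlocks_of_mem M.2
  obtain ⟨d⟩ := (isIsotropic_zero (g := g) S).nonempty_isotropicData hT
  have e := hε 0 (isIsotropic_zero S) M _ siegelI_mem
  rw [thetaSeries_siegelAct bM hS d siegelI_mem] at e
  have hj := siegelDenom_det_ne_zero bM siegelI_mem
  have hθ := thetaSeries_zero_siegelI_ne_zero (g := g) hS
  exact (mul_right_cancel₀ (pow_ne_zero 2 hj) (mul_right_cancel₀ hθ e)).symm

end Multiplier

theorem lemma3p1 (g : ℕ) (hg : 1 ≤ g) (S : Matrix (Fin 4) (Fin 4) ℤ)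
    (hS : (S.map (Int.cast : ℤ → ℝ)).PosDef)
    (hS' : IsIntegralMatrix ((16 : ℝ) • (S.map (Int.cast : ℤ → ℝ))⁻¹)) :
    (∃! ε : igusaGroup g 4 →* Circle, IsThetaMultiplier 4 S ε) ∧
    ∀ ε : igusaGroup g 4 →* Circle, IsThetaMultiplier 4 S ε → (ε = 1 ↔ IsSquare S.det) := by
  change (matR S).PosDef at hS
  obtain ⟨T, hT⟩ := hS'
  change (16 : ℝ) • (matR S)⁻¹ = matR T at hT
  obtain ⟨k, hk⟩ := det_eq_two_pow hS hT
  have hSs := transpose_eq_of_posDef hS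
  refine ⟨⟨multiplierChar hS hT hk, isThetaMultiplier_multiplierChar hS hT hk, fun ε hε => ?_⟩,
    fun ε hε => ?_⟩
  · refine MonoidHom.ext fun M => Circle.ext ?_
    rw [hε.apply_eq hS hT, (isThetaMultiplier_multiplierChar hS hT hk).apply_eq hS hT]
  · rcases Nat.even_or_odd' k with ⟨m, rfl | rfl⟩
    · have hk' : S.det = (2 ^ m) ^ 2 := by rw [hk, pow_mul']
      refine iff_of_true (MonoidHom.ext fun M => Circle.ext ?_) ⟨2 ^ m, by rw [hk', sq]⟩
      obtain ⟨-, hCD, hAD⟩ := blocks_rel' M.1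
      have bM := igusaBlocks_of_mem M.2
      have hD : ((blockD M.1).det : ℂ) ≠ 0 := by exact_mod_cast bM.det_ne_zero
      rw [hε.apply_eq hS hT, multiplier, gaussSum4_of_isSquare bM hAD hCD hSs hk',
        div_self (pow_ne_zero 2 hD)]
      rfl
    · have hk' : S.det = 2 * (2 ^ m) ^ 2 := by rw [hk, pow_succ', pow_mul']
      refine iff_of_false (fun h1 => ?_) (by rw [hk']; exact not_isSquare_two_pow_odd m)
      have i₀ : Fin g := ⟨0, hg⟩
      have hM := diagElement_mem i₀
      have hD : ((blockD (diagElement i₀)).det : ℂ) ≠ 0 := by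
        exact_mod_cast (igusaBlocks_of_mem hM).det_ne_zero
      have e := hε.apply_eq hS hT ⟨diagElement i₀, hM⟩
      rw [h1, multiplier, gaussSum4_diagElement i₀ hSs hk', neg_div,
        div_self (pow_ne_zero 2 hD)] at e
      have e' : (1 : ℂ) = -1 := e
      norm_num at e'
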